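/- Let $\mathcal V$ be a braided monoidal category, with braiding $c$, in which equalizers of coreflexive pairs exist and are preserved by each functor $X\otimes-$. Let $\mathrm{Comod}(\mathcal V)$ be the monoidal bicategory whose objects are the comonoids in $\mathcal V$, whose 1-cells $M: C\nrightarrow D$ are the objects with commuting left $C$- and right $D$-coactions, composed by the cotensor product $M\otimes_D N$, and whose 2-cells are the maps of comodules. For a comonoid $C=(C,\delta,\varepsilon)$ put $C^o=(C,c\,\delta,\varepsilon)$. Then $C^o\otimes C$ is a monoidale with multiplication $p=1\otimes e\otimes 1$ and unit $j$, where $e: C\otimes C^o\nrightarrow I$ and $j: I\nrightarrow C^o\otimes C$ are both the object $C$, with coactions $(1\otimes c)\delta_3$ and $(c\otimes 1)\delta_3$, and $\delta_3$ is the threefold comultiplication. A *quantum category* $(C,A)$ is a comonoid $C$ with a monoidal comonad $A$ on the monoidale $C^o\otimes C$, that is, a comonad $(A,\delta,\epsilon)$ with 2-cells $\mu_2:p\circ(A\otimes A)\Rightarrow A\circ p$ and $\mu_0: j\Rightarrow A\circ j$ that make $A$ a monoidal morphism and the comultiplication and counit of $A$ monoidal 2-cells. A *quantum functor* $(C,A)\to(C',A')$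 is a pair $(f,\sigma)$ of a comonoid map $f:C\to C'$ and a 2-cell $\sigma:(f^{*o}\otimes f_*)\circ A\Rightarrow A'\circ(f^{*o}\otimes f_*)$ such that $(f^{*o}\otimes f_*,\sigma)$ is an opmorphism of monoidal comonads, i.e. a comonad map such that $\sigma$ is compatible with $\mu_2,\mu_0$ and the canonical opmonoidal structure $\omega_2,\omega_0$ of $f^{*o}\otimes f_*$ (induced by the unit and the counit of the adjunction between $f_*$ and $f^*$). For a quantum category $(C,A)$ the object $A$ is a comonoid in $\mathcal V$; the counit $\epsilon:A\to C^o\otimes C$ has components $s,t:A\to C$, which make $A$ a comodule $C\nrightarrow C$; $\mu_2$ and $\mu_0$ determine maps $\nu_2:A\otimes_C A\to A$ and $\nu_0:C\to A$. The 2-cell $\sigma$ of a quantum functor determines a map $\varphi:A\to A'$, by applying the counit of $f^{*o}\otimes f_*$. Then: 1. For every quantum functor $(f,\sigma)$, the map $\varphi$ is a comonoid map, and $$\varphi\text{ satisfies } s\varphi=fs,\quad t\varphi=ft,\quad \varphi\,\nu_2=\nu_2\,(\varphi\otimes\varphi)|,\quad \varphi\,\nu_0=\nu_0 f,$$ where $(\varphi\otimes\varphi)|:A\otimes_C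 A\to A'\otimes_{C'}A'$ is the restriction of $\varphi\otimes\varphi$. 2. Conversely, for comonoid maps $f:C\to C'$ and $\varphi:A\to A'$ that satisfy these equations there is exactly one quantum functor $(f,\sigma)$ whose map on arrows is $\varphi$. 3. Quantum categories and quantum functors form a category $\mathrm{qCat}\,\mathcal V$, in which the composite of $(f,\varphi)$ and $(f',\varphi')$ is $(f'f,\varphi'\varphi)$ and the identities are $(1,1)$. -/

import Mathlib

open CategoryTheory MonoidalCategory Limits
open scoped ComonObj

set_option linter.unusedSectionVars false

universe v u

/-- The standing assumption on the base: equalizers of coreflexive pairs exist, and each functor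
`X ⊗ -` preserves them. -/
class CoreflexiveTensor (V : Type u) [Category.{v} V] [MonoidalCategory V] : Prop where
  hasCoreflexiveEqualizers : HasCoreflexiveEqualizers V
  preserves : ∀ (X : V) {A B : V} (f g : A ⟶ B) [IsCoreflexivePair f g],
    PreservesLimit (parallelPair f g) (tensorLeft X)

attribute [instance] CoreflexiveTensor.hasCoreflexiveEqualizers CoreflexiveTensor.preserves

noncomputable section

section Lifts

variable {V : Type u} [Category.{v} V] [MonoidalCategory V]

/-- Maps which stay monic after tensoring. -/
class TensorMono {A B : V} (f : A ⟶ B) : Prop where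
  mono : ∀ X Y : V, Mono ((X ◁ f) ▷ Y)

instance TensorMono.comp {A B C : V} (f : A ⟶ B) (g : B ⟶ C) [TensorMono f] [TensorMono g] :
    TensorMono (f ≫ g) where
  mono X Y := by
    have := TensorMono.mono (f := f) X Y
    have := TensorMono.mono (f := g) X Y
    rw [whiskerLeft_comp, comp_whiskerRight]
    exact mono_comp _ _

instance TensorMono.ofIso {A B : V} (f : A ⟶ B) [IsIso f] : TensorMono f where
  mono _ _ := inferInstance

instance TensorMono.left {A B : V} (f : A ⟶ B) [TensorMono f] (Z : V) : TensorMono (Z ◁ f) where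
  mono X Y := by
    have := TensorMono.mono (f := f) (X ⊗ Z) Y
    have e : (X ◁ (Z ◁ f)) ▷ Y =
        (α_ X Z A).inv ▷ Y ≫ ((X ⊗ Z) ◁ f) ▷ Y ≫ (α_ X Z B).hom ▷ Y := by
      simp [← comp_whiskerRight]
    rw [e]; infer_instance

instance TensorMono.right {A B : V} (f : A ⟶ B) [TensorMono f] (Z : V) : TensorMono (f ▷ Z) where
  mono X Y := by
    have := TensorMono.mono (f := f) X (Z ⊗ Y)
    have e : (X ◁ (f ▷ Z)) ▷ Y =
        ((α_ X A Z).inv ▷ Y ≫ (α_ _ _ _).hom) ≫ (X ◁ f) ▷ (Z ⊗ Y) ≫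
          (α_ _ _ _).inv ≫ (α_ X B Z).hom ▷ Y := by
      simp
    rw [e]; infer_instance

theorem TensorMono.toMono {A B : V} (f : A ⟶ B) [TensorMono f] : Mono f := by
  have := TensorMono.mono (f := f) (𝟙_ V) (𝟙_ V)
  have e : f = ((λ_ A).inv ≫ (ρ_ _).inv) ≫ ((𝟙_ V) ◁ f) ▷ (𝟙_ V) ≫ (ρ_ _).hom ≫ (λ_ B).hom := by
    simp
  rw [e]; infer_instance

/-- Cancellation of a map which stays monic after tensoring. -/
theorem tcancel {A B T : V} (f : A ⟶ B) [TensorMono f] {g h : T ⟶ A} (e : g ≫ f = h ≫ f) :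
    g = h := by
  have := TensorMono.toMono f
  exact (cancel_mono f).1 e

variable [BraidedCategory V] [CoreflexiveTensor V]

instance CoreflexiveTensor.preservesRight (X : V) {A B : V} (f g : A ⟶ B) [IsCoreflexivePair f g] :
    PreservesLimit (parallelPair f g) (tensorRight X) :=
  preservesLimit_of_natIso _ (BraidedCategory.tensorLeftIsoTensorRight X)

variable {A B : V} (f g : A ⟶ B) [IsCoreflexivePair f g]

theorem exists_liftLeft (X : V) {T : V} (k : T ⟶ X ⊗ A) (h : k ≫ X ◁ f = k ≫ X ◁ g) :
    ∃ m : T ⟶ X ⊗ equalizer f g, m ≫ X ◁ equalizer.ι f g = k :=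
  ⟨_, (Fork.IsLimit.lift' (isLimitOfHasEqualizerOfPreservesLimit (tensorLeft X) f g) k h).2⟩

theorem exists_liftRight (X : V) {T : V} (k : T ⟶ A ⊗ X) (h : k ≫ f ▷ X = k ≫ g ▷ X) :
    ∃ m : T ⟶ equalizer f g ⊗ X, m ≫ equalizer.ι f g ▷ X = k :=
  ⟨_, (Fork.IsLimit.lift' (isLimitOfHasEqualizerOfPreservesLimit (tensorRight X) f g) k h).2⟩

instance tensorMono_ι : TensorMono (equalizer.ι f g) where
  mono X Y := by
    have : IsCoreflexivePair (X ◁ f) (X ◁ g) :=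
      IsCoreflexivePair.mk' (X ◁ commonRetraction f g)
        (by rw [← whiskerLeft_comp]; simp) (by rw [← whiskerLeft_comp]; simp)
    have h := isLimitOfHasEqualizerOfPreservesLimit (tensorLeft X) f g
    have : PreservesLimit (parallelPair ((tensorLeft X).map f) ((tensorLeft X).map g))
        (tensorRight Y) := CoreflexiveTensor.preservesRight Y (X ◁ f) (X ◁ g)
    exact Fork.IsLimit.mono (isLimitForkMapOfIsLimit (tensorRight Y) 
      (by rw [← Functor.map_comp, equalizer.condition, Functor.map_comp]) h)

end Lifts

section Bicomodules

variable {V : Type u} [Category.{v} V] [MonoidalCategory V]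

/-- A comodule from the comonoid `C` to the comonoid `D`: an object with a left `C`-coaction and a
right `D`-coaction which commute. -/
structure Bicomod (C D : Comon V) where
  X : V
  l : X ⟶ C.X ⊗ X
  r : X ⟶ X ⊗ D.X
  l_counit : l ≫ ε[C.X] ▷ X = (λ_ X).inv
  l_coassoc : l ≫ C.X ◁ l = l ≫ Δ[C.X] ▷ X ≫ (α_ C.X C.X X).hom
  r_counit : r ≫ X ◁ ε[D.X] = (ρ_ X).inv
  r_coassoc : r ≫ r ▷ D.X = r ≫ X ◁ Δ[D.X] ≫ (α_ X D.X D.X).inv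
  lr : r ≫ l ▷ D.X ≫ (α_ C.X X D.X).hom = l ≫ C.X ◁ r

namespace Bicomod

section

variable {C D : Comon V} (M : Bicomod C D)

attribute [simp] l_counit r_counit

@[simp] theorem l_counit_assoc {Z : V} (t : _ ⟶ Z) :
    M.l ≫ ε[C.X] ▷ M.X ≫ t = (λ_ M.X).inv ≫ t := by
  rw [← Category.assoc, l_counit]

@[simp] theorem r_counit_assoc {Z : V} (t : _ ⟶ Z) :
    M.r ≫ M.X ◁ ε[D.X] ≫ t = (ρ_ M.X).inv ≫ t := by
  rw [← Category.assoc, r_counit]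

theorem l_coassoc_assoc {Z : V} (t : _ ⟶ Z) :
    M.l ≫ C.X ◁ M.l ≫ t = M.l ≫ Δ[C.X] ▷ M.X ≫ (α_ C.X C.X M.X).hom ≫ t := by
  rw [← Category.assoc, l_coassoc]; simp only [Category.assoc]

theorem r_coassoc_assoc {Z : V} (t : _ ⟶ Z) :
    M.r ≫ M.r ▷ D.X ≫ t = M.r ≫ M.X ◁ Δ[D.X] ≫ (α_ M.X D.X D.X).inv ≫ t := by
  rw [← Category.assoc, r_coassoc]; simp only [Category.assoc]

end

/-- A 2-cell: a map which respects the coactions. -/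
@[ext]
structure Hom {C D : Comon V} (M N : Bicomod C D) where
  hom : M.X ⟶ N.X
  l_comm : hom ≫ N.l = M.l ≫ C.X ◁ hom
  r_comm : hom ≫ N.r = M.r ≫ hom ▷ D.X

attribute [simp] Hom.l_comm Hom.r_comm

@[simp] theorem Hom.l_comm_assoc {C D : Comon V} {M N : Bicomod C D} (f : Hom M N) {Z : V}
    (t : _ ⟶ Z) : f.hom ≫ N.l ≫ t = M.l ≫ C.X ◁ f.hom ≫ t := by
  rw [← Category.assoc, Hom.l_comm]; simp only [Category.assoc]

@[simp] theorem Hom.r_comm_assoc {C D : Comon V} {M N : Bicomod C D} (f : Hom M N) {Z : V}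
    (t : _ ⟶ Z) : f.hom ≫ N.r ≫ t = M.r ≫ f.hom ▷ D.X ≫ t := by
  rw [← Category.assoc, Hom.r_comm]; simp only [Category.assoc]

instance category (C D : Comon V) : Category (Bicomod C D) where
  Hom M N := Hom M N
  id M := { hom := 𝟙 _, l_comm := by simp, r_comm := by simp }
  comp f g := { hom := f.hom ≫ g.hom, l_comm := by simp, r_comm := by simp }

@[simp] theorem id_hom {C D : Comon V} (M : Bicomod C D) : Hom.hom (𝟙 M) = 𝟙 M.X := rfl

@[simp] theorem comp_hom {C D : Comon V} {M N P : Bicomod C D} (f : M ⟶ N) (g : N ⟶ P) :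
    Hom.hom (f ≫ g) = Hom.hom f ≫ Hom.hom g := rfl

@[ext] theorem hom_ext {C D : Comon V} {M N : Bicomod C D} {f g : M ⟶ N}
    (h : Hom.hom f = Hom.hom g) : f = g := Hom.ext h

/-- Invertible 2-cells from invertible underlying maps. -/
def isoMk {C D : Comon V} {M N : Bicomod C D} (f : M ⟶ N) (g : N.X ⟶ M.X)
    (h₁ : f.hom ≫ g = 𝟙 _) (h₂ : g ≫ f.hom = 𝟙 _) : M ≅ N where
  hom := f
  inv :=
    { hom := g
      l_comm := by
        have h := g ≫= f.l_comm =≫ C.X ◁ g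
        simp only [Category.assoc, reassoc_of% h₂, ← whiskerLeft_comp, h₁] at h
        simpa using h.symm
      r_comm := by
        have h := g ≫= f.r_comm =≫ g ▷ D.X
        simp only [Category.assoc, reassoc_of% h₂, ← comp_whiskerRight, h₁] at h
        simpa using h.symm }
  hom_inv_id := by ext; exact h₁
  inv_hom_id := by ext; exact h₂

/-- The comonoid `C` as a comodule from `C` to `C`. -/
@[reducible] def reg (C : Comon V) : Bicomod C C where
  X := C.X
  l := Δ
  r := Δ
  l_counit := by simp
  l_coassoc := by simp
  r_counit := by simp
  r_coassoc := by simp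
  lr := by simp

variable {C D E F : Comon V}

section Comp

variable (M : Bicomod C D) (N : Bicomod D E)

instance coreflexive :
    IsCoreflexivePair (M.r ▷ N.X ≫ (α_ M.X D.X N.X).hom) (M.X ◁ N.l) :=
  IsCoreflexivePair.mk' (M.X ◁ (ε[D.X] ▷ N.X ≫ (λ_ N.X).hom))
    (by
      have h := M.r_counit =≫ (ρ_ M.X).hom
      have h' : M.r ▷ N.X ≫ (M.X ◁ ε[D.X]) ▷ N.X ≫ (ρ_ M.X).hom ▷ N.X = 𝟙 _ := by
        rw [← comp_whiskerRight, ← comp_whiskerRight, r_counit_assoc]; simp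
      rw [← h']; monoidal)
    (by rw [← whiskerLeft_comp]; simp)

variable [BraidedCategory V] [CoreflexiveTensor V]

/-- The object `M ⊗_D N`. -/
def compX : V := equalizer (M.r ▷ N.X ≫ (α_ M.X D.X N.X).hom) (M.X ◁ N.l)

/-- The canonical map `M ⊗_D N ⟶ M ⊗ N`. -/
def ι₀ : compX M N ⟶ M.X ⊗ N.X := equalizer.ι _ _

instance : TensorMono (ι₀ M N) := tensorMono_ι _ _

variable {M N}

@[ext]
theorem compX_ext {T : V} {f g : T ⟶ compX M N} (h : f ≫ ι₀ M N = g ≫ ι₀ M N) : f = g :=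
  tcancel (ι₀ M N) h

variable (M N)

theorem ι₀_cond : ι₀ M N ≫ M.X ◁ N.l = ι₀ M N ≫ M.r ▷ N.X ≫ (α_ M.X D.X N.X).hom :=
  (equalizer.condition _ _).symm

theorem ι₀_cond_assoc {Z : V} (t : _ ⟶ Z) :
    ι₀ M N ≫ M.X ◁ N.l ≫ t = ι₀ M N ≫ M.r ▷ N.X ≫ (α_ M.X D.X N.X).hom ≫ t := by
  rw [← Category.assoc, ι₀_cond]; simp only [Category.assoc]

variable {M N}

/-- The map into `M ⊗_D N` induced by a map which equalizes the two coactions. -/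
def lift₀ {T : V} (k : T ⟶ M.X ⊗ N.X) (h : k ≫ M.r ▷ N.X ≫ (α_ M.X D.X N.X).hom = k ≫ M.X ◁ N.l) :
    T ⟶ compX M N := equalizer.lift k h

@[simp] theorem lift₀_ι₀ {T : V} (k : T ⟶ M.X ⊗ N.X)
    (h : k ≫ M.r ▷ N.X ≫ (α_ M.X D.X N.X).hom = k ≫ M.X ◁ N.l) : lift₀ k h ≫ ι₀ M N = k :=
  equalizer.lift_ι _ _

@[simp] theorem lift₀_ι₀_assoc {T : V} (k : T ⟶ M.X ⊗ N.X)
    (h : k ≫ M.r ▷ N.X ≫ (α_ M.X D.X N.X).hom = k ≫ M.X ◁ N.l) {Z : V} (t : _ ⟶ Z) :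
    lift₀ k h ≫ ι₀ M N ≫ t = k ≫ t := by
  rw [← Category.assoc, lift₀_ι₀]

theorem exists_left (Y : V) {T : V} (k : T ⟶ Y ⊗ (M.X ⊗ N.X))
    (h : k ≫ Y ◁ (M.r ▷ N.X ≫ (α_ M.X D.X N.X).hom) = k ≫ Y ◁ (M.X ◁ N.l)) :
    ∃ m : T ⟶ Y ⊗ compX M N, m ≫ Y ◁ ι₀ M N = k :=
  exists_liftLeft _ _ Y k h

theorem exists_right (Y : V) {T : V} (k : T ⟶ (M.X ⊗ N.X) ⊗ Y)
    (h : k ≫ (M.r ▷ N.X ≫ (α_ M.X D.X N.X).hom) ▷ Y = k ≫ (M.X ◁ N.l) ▷ Y) :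
    ∃ m : T ⟶ compX M N ⊗ Y, m ≫ ι₀ M N ▷ Y = k :=
  exists_liftRight _ _ Y k h

/-- The map `T ⟶ Y ⊗ (M ⊗_D N)` induced by a map which equalizes the two coactions. -/
def liftLeft₀ (Y : V) {T : V} (k : T ⟶ Y ⊗ (M.X ⊗ N.X))
    (h : k ≫ Y ◁ (M.r ▷ N.X ≫ (α_ M.X D.X N.X).hom) = k ≫ Y ◁ (M.X ◁ N.l)) : T ⟶ Y ⊗ compX M N :=
  (exists_left Y k h).choose

/-- The map `T ⟶ (M ⊗_D N) ⊗ Y` induced by a map which equalizes the two coactions. -/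
def liftRight₀ (Y : V) {T : V} (k : T ⟶ (M.X ⊗ N.X) ⊗ Y)
    (h : k ≫ (M.r ▷ N.X ≫ (α_ M.X D.X N.X).hom) ▷ Y = k ≫ (M.X ◁ N.l) ▷ Y) : T ⟶ compX M N ⊗ Y :=
  (exists_right Y k h).choose

@[simp] theorem liftLeft₀_ι₀ (Y : V) {T : V} (k : T ⟶ Y ⊗ (M.X ⊗ N.X))
    (h : k ≫ Y ◁ (M.r ▷ N.X ≫ (α_ M.X D.X N.X).hom) = k ≫ Y ◁ (M.X ◁ N.l)) :
    liftLeft₀ Y k h ≫ Y ◁ ι₀ M N = k := (exists_left Y k h).choose_spec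

@[simp] theorem liftLeft₀_ι₀_assoc (Y : V) {T : V} (k : T ⟶ Y ⊗ (M.X ⊗ N.X))
    (h : k ≫ Y ◁ (M.r ▷ N.X ≫ (α_ M.X D.X N.X).hom) = k ≫ Y ◁ (M.X ◁ N.l)) {Z : V} (t : _ ⟶ Z) :
    liftLeft₀ Y k h ≫ Y ◁ ι₀ M N ≫ t = k ≫ t := by
  rw [← Category.assoc, liftLeft₀_ι₀]

@[simp] theorem liftRight₀_ι₀ (Y : V) {T : V} (k : T ⟶ (M.X ⊗ N.X) ⊗ Y)
    (h : k ≫ (M.r ▷ N.X ≫ (α_ M.X D.X N.X).hom) ▷ Y = k ≫ (M.X ◁ N.l) ▷ Y) :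
    liftRight₀ Y k h ≫ ι₀ M N ▷ Y = k := (exists_right Y k h).choose_spec

@[simp] theorem liftRight₀_ι₀_assoc (Y : V) {T : V} (k : T ⟶ (M.X ⊗ N.X) ⊗ Y)
    (h : k ≫ (M.r ▷ N.X ≫ (α_ M.X D.X N.X).hom) ▷ Y = k ≫ (M.X ◁ N.l) ▷ Y) {Z : V} (t : _ ⟶ Z) :
    liftRight₀ Y k h ≫ ι₀ M N ▷ Y ≫ t = k ≫ t := by
  rw [← Category.assoc, liftRight₀_ι₀]

variable (M N)

/-- The left coaction on `M ⊗_D N`. -/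
def compL : compX M N ⟶ C.X ⊗ compX M N :=
  liftLeft₀ C.X (ι₀ M N ≫ M.l ▷ N.X ≫ (α_ C.X M.X N.X).hom) (by
    have h := ι₀_cond M N =≫ (M.l ▷ (D.X ⊗ N.X) ≫ (α_ _ _ _).hom)
    simp only [Category.assoc] at h ⊢
    calc
      _ = ι₀ M N ≫ 𝟙 _ ⊗≫ (M.l ≫ C.X ◁ M.r) ▷ N.X ⊗≫ 𝟙 _ := by monoidal
      _ = ι₀ M N ≫ M.r ▷ N.X ≫ (α_ _ _ _).hom ≫ M.l ▷ (D.X ⊗ N.X) ≫ (α_ _ _ _).hom := by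
        rw [← lr]; monoidal
      _ = _ := by
        rw [← h, whisker_exchange_assoc, associator_naturality_right])

/-- The right coaction on `M ⊗_D N`. -/
def compR : compX M N ⟶ compX M N ⊗ E.X :=
  liftRight₀ E.X (ι₀ M N ≫ M.X ◁ N.r ≫ (α_ M.X N.X E.X).inv) (by
    have h := ι₀_cond M N =≫ (M.X ◁ D.X ◁ N.r)
    simp only [Category.assoc] at h ⊢
    calc
      _ = ι₀ M N ≫ (M.X ◁ N.r ≫ M.r ▷ (N.X ⊗ E.X)) ⊗≫ 𝟙 _ := by monoidal
      _ = (ι₀ M N ≫ M.r ▷ N.X ≫ (α_ _ _ _).hom ≫ M.X ◁ D.X ◁ N.r) ⊗≫ 𝟙 _ := by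
        rw [whisker_exchange]; monoidal
      _ = ι₀ M N ≫ M.X ◁ (N.l ≫ D.X ◁ N.r) ⊗≫ 𝟙 _ := by rw [← h]; monoidal
      _ = _ := by rw [← lr]; monoidal)

@[simp] theorem compL_ι₀ : compL M N ≫ C.X ◁ ι₀ M N = ι₀ M N ≫ M.l ▷ N.X ≫ (α_ C.X M.X N.X).hom :=
  liftLeft₀_ι₀ _ _ _

@[simp] theorem compL_ι₀_assoc {Z : V} (t : _ ⟶ Z) :
    compL M N ≫ C.X ◁ ι₀ M N ≫ t = ι₀ M N ≫ M.l ▷ N.X ≫ (α_ C.X M.X N.X).hom ≫ t := by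
  rw [← Category.assoc, compL_ι₀]; simp only [Category.assoc]

@[simp] theorem compR_ι₀ : compR M N ≫ ι₀ M N ▷ E.X = ι₀ M N ≫ M.X ◁ N.r ≫ (α_ M.X N.X E.X).inv :=
  liftRight₀_ι₀ _ _ _

@[simp] theorem compR_ι₀_assoc {Z : V} (t : _ ⟶ Z) :
    compR M N ≫ ι₀ M N ▷ E.X ≫ t = ι₀ M N ≫ M.X ◁ N.r ≫ (α_ M.X N.X E.X).inv ≫ t := by
  rw [← Category.assoc, compR_ι₀]; simp only [Category.assoc]

/-- The composite of `M : C ⇸ D` and `N : D ⇸ E`. -/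
def comp : Bicomod C E where
  X := compX M N
  l := compL M N
  r := compR M N
  l_counit := by
    apply tcancel (𝟙_ V ◁ ι₀ M N)
    rw [Category.assoc, ← whisker_exchange, compL_ι₀_assoc]
    calc
      _ = ι₀ M N ≫ (M.l ≫ ε ▷ M.X) ▷ N.X ⊗≫ 𝟙 _ := by monoidal
      _ = ι₀ M N ⊗≫ 𝟙 _ := by rw [l_counit]; monoidal
      _ = _ := by monoidal
  l_coassoc := by
    apply tcancel (C.X ◁ C.X ◁ ι₀ M N)
    calc
      _ = compL M N ≫ C.X ◁ (compL M N ≫ C.X ◁ ι₀ M N) := by monoidal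
      _ = compL M N ≫ C.X ◁ (ι₀ M N ≫ M.l ▷ N.X ≫ (α_ C.X M.X N.X).hom) := by rw [compL_ι₀]
      _ = (compL M N ≫ C.X ◁ ι₀ M N) ≫ C.X ◁ (M.l ▷ N.X ≫ (α_ C.X M.X N.X).hom) := by monoidal
      _ = ι₀ M N ≫ (M.l ≫ C.X ◁ M.l) ▷ N.X ⊗≫ 𝟙 _ := by rw [compL_ι₀]; monoidal
      _ = (ι₀ M N ≫ M.l ▷ N.X ≫ (α_ C.X M.X N.X).hom) ≫ Δ[C.X] ▷ (M.X ⊗ N.X) ≫ (α_ _ _ _).hom := by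
        rw [l_coassoc]; monoidal
      _ = compL M N ≫ (C.X ◁ ι₀ M N ≫ Δ[C.X] ▷ (M.X ⊗ N.X)) ≫ (α_ _ _ _).hom := by
        rw [← compL_ι₀]; monoidal
      _ = _ := by rw [whisker_exchange]; monoidal
  r_counit := by
    apply tcancel (ι₀ M N ▷ 𝟙_ V)
    rw [Category.assoc, whisker_exchange, compR_ι₀_assoc]
    calc
      _ = ι₀ M N ≫ M.X ◁ (N.r ≫ N.X ◁ ε) ⊗≫ 𝟙 _ := by monoidal
      _ = ι₀ M N ⊗≫ 𝟙 _ := by rw [r_counit]; monoidal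
      _ = _ := by monoidal
  r_coassoc := by
    apply tcancel ((ι₀ M N ▷ E.X) ▷ E.X)
    calc
      _ = compR M N ≫ (compR M N ≫ ι₀ M N ▷ E.X) ▷ E.X := by monoidal
      _ = compR M N ≫ (ι₀ M N ≫ M.X ◁ N.r ≫ (α_ M.X N.X E.X).inv) ▷ E.X := by rw [compR_ι₀]
      _ = (compR M N ≫ ι₀ M N ▷ E.X) ≫ (M.X ◁ N.r ≫ (α_ M.X N.X E.X).inv) ▷ E.X := by monoidal
      _ = ι₀ M N ≫ M.X ◁ (N.r ≫ N.r ▷ E.X) ⊗≫ 𝟙 _ := by rw [compR_ι₀]; monoidal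
      _ = (ι₀ M N ≫ M.X ◁ N.r ≫ (α_ M.X N.X E.X).inv) ≫ (M.X ⊗ N.X) ◁ Δ[E.X] ≫ (α_ _ _ _).inv := by
        rw [r_coassoc]; monoidal
      _ = compR M N ≫ (ι₀ M N ▷ E.X ≫ (M.X ⊗ N.X) ◁ Δ[E.X]) ≫ (α_ _ _ _).inv := by
        rw [← compR_ι₀]; monoidal
      _ = _ := by rw [← whisker_exchange]; monoidal
  lr := by
    apply tcancel (C.X ◁ (ι₀ M N ▷ E.X))
    calc
      _ = compR M N ≫ (compL M N ≫ C.X ◁ ι₀ M N) ▷ E.X ⊗≫ 𝟙 _ := by monoidal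
      _ = (compR M N ≫ ι₀ M N ▷ E.X) ≫ (M.l ▷ N.X) ▷ E.X ⊗≫ 𝟙 _ := by rw [compL_ι₀]; monoidal
      _ = ι₀ M N ≫ (M.X ◁ N.r ≫ M.l ▷ (N.X ⊗ E.X)) ⊗≫ 𝟙 _ := by rw [compR_ι₀]; monoidal
      _ = (ι₀ M N ≫ M.l ▷ N.X ≫ (α_ C.X M.X N.X).hom) ≫ C.X ◁ (M.X ◁ N.r) ⊗≫ 𝟙 _ := by
        rw [whisker_exchange]; monoidal
      _ = compL M N ≫ C.X ◁ (ι₀ M N ≫ M.X ◁ N.r ≫ (α_ M.X N.X E.X).inv) ⊗≫ 𝟙 _ := by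
        rw [← compL_ι₀]; monoidal
      _ = _ := by rw [← compR_ι₀]; monoidal


/-- The canonical map `M ⊗_D N ⟶ M ⊗ N`. -/
def ι : (comp M N).X ⟶ M.X ⊗ N.X := ι₀ M N

instance : TensorMono (ι M N) := inferInstanceAs (TensorMono (ι₀ M N))

variable {M N}

@[ext]
theorem comp_ext {T : V} {f g : T ⟶ (comp M N).X} (h : f ≫ ι M N = g ≫ ι M N) : f = g :=
  tcancel (ι M N) h

/-- The map into `M ⊗_D N` induced by a map which equalizes the two coactions. -/
def lift {T : V} (k : T ⟶ M.X ⊗ N.X) (h : k ≫ M.r ▷ N.X ≫ (α_ M.X D.X N.X).hom = k ≫ M.X ◁ N.l) :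
    T ⟶ (comp M N).X := lift₀ k h

@[simp] theorem lift_ι {T : V} (k : T ⟶ M.X ⊗ N.X)
    (h : k ≫ M.r ▷ N.X ≫ (α_ M.X D.X N.X).hom = k ≫ M.X ◁ N.l) : lift k h ≫ ι M N = k :=
  lift₀_ι₀ _ _

@[simp] theorem lift_ι_assoc {T : V} (k : T ⟶ M.X ⊗ N.X)
    (h : k ≫ M.r ▷ N.X ≫ (α_ M.X D.X N.X).hom = k ≫ M.X ◁ N.l) {Z : V} (t : _ ⟶ Z) :
    lift k h ≫ ι M N ≫ t = k ≫ t := by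
  rw [← Category.assoc, lift_ι]

/-- The map `T ⟶ Y ⊗ (M ⊗_D N)` induced by a map which equalizes the two coactions. -/
def liftLeft (Y : V) {T : V} (k : T ⟶ Y ⊗ (M.X ⊗ N.X))
    (h : k ≫ Y ◁ (M.r ▷ N.X ≫ (α_ M.X D.X N.X).hom) = k ≫ Y ◁ (M.X ◁ N.l)) :
    T ⟶ Y ⊗ (comp M N).X := liftLeft₀ Y k h

/-- The map `T ⟶ (M ⊗_D N) ⊗ Y` induced by a map which equalizes the two coactions. -/
def liftRight (Y : V) {T : V} (k : T ⟶ (M.X ⊗ N.X) ⊗ Y)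
    (h : k ≫ (M.r ▷ N.X ≫ (α_ M.X D.X N.X).hom) ▷ Y = k ≫ (M.X ◁ N.l) ▷ Y) :
    T ⟶ (comp M N).X ⊗ Y := liftRight₀ Y k h

@[simp] theorem liftLeft_ι (Y : V) {T : V} (k : T ⟶ Y ⊗ (M.X ⊗ N.X))
    (h : k ≫ Y ◁ (M.r ▷ N.X ≫ (α_ M.X D.X N.X).hom) = k ≫ Y ◁ (M.X ◁ N.l)) :
    liftLeft Y k h ≫ Y ◁ ι M N = k := liftLeft₀_ι₀ _ _ _

@[simp] theorem liftLeft_ι_assoc (Y : V) {T : V} (k : T ⟶ Y ⊗ (M.X ⊗ N.X))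
    (h : k ≫ Y ◁ (M.r ▷ N.X ≫ (α_ M.X D.X N.X).hom) = k ≫ Y ◁ (M.X ◁ N.l)) {Z : V} (t : _ ⟶ Z) :
    liftLeft Y k h ≫ Y ◁ ι M N ≫ t = k ≫ t := by
  rw [← Category.assoc, liftLeft_ι]

@[simp] theorem liftRight_ι (Y : V) {T : V} (k : T ⟶ (M.X ⊗ N.X) ⊗ Y)
    (h : k ≫ (M.r ▷ N.X ≫ (α_ M.X D.X N.X).hom) ▷ Y = k ≫ (M.X ◁ N.l) ▷ Y) :
    liftRight Y k h ≫ ι M N ▷ Y = k := liftRight₀_ι₀ _ _ _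

@[simp] theorem liftRight_ι_assoc (Y : V) {T : V} (k : T ⟶ (M.X ⊗ N.X) ⊗ Y)
    (h : k ≫ (M.r ▷ N.X ≫ (α_ M.X D.X N.X).hom) ▷ Y = k ≫ (M.X ◁ N.l) ▷ Y) {Z : V} (t : _ ⟶ Z) :
    liftRight Y k h ≫ ι M N ▷ Y ≫ t = k ≫ t := by
  rw [← Category.assoc, liftRight_ι]

variable (M N)

theorem ι_cond : ι M N ≫ M.X ◁ N.l = ι M N ≫ M.r ▷ N.X ≫ (α_ M.X D.X N.X).hom :=
  ι₀_cond M N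

theorem ι_cond_assoc {Z : V} (t : _ ⟶ Z) :
    ι M N ≫ M.X ◁ N.l ≫ t = ι M N ≫ M.r ▷ N.X ≫ (α_ M.X D.X N.X).hom ≫ t := by
  rw [← Category.assoc, ι_cond]; simp only [Category.assoc]

@[simp] theorem l_ι : (comp M N).l ≫ C.X ◁ ι M N = ι M N ≫ M.l ▷ N.X ≫ (α_ C.X M.X N.X).hom :=
  compL_ι₀ M N

@[simp] theorem l_ι_assoc {Z : V} (t : _ ⟶ Z) :
    (comp M N).l ≫ C.X ◁ ι M N ≫ t = ι M N ≫ M.l ▷ N.X ≫ (α_ C.X M.X N.X).hom ≫ t := by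
  rw [← Category.assoc, l_ι]; simp only [Category.assoc]

@[simp] theorem r_ι : (comp M N).r ≫ ι M N ▷ E.X = ι M N ≫ M.X ◁ N.r ≫ (α_ M.X N.X E.X).inv :=
  compR_ι₀ M N

@[simp] theorem r_ι_assoc {Z : V} (t : _ ⟶ Z) :
    (comp M N).r ≫ ι M N ▷ E.X ≫ t = ι M N ≫ M.X ◁ N.r ≫ (α_ M.X N.X E.X).inv ≫ t := by
  rw [← Category.assoc, r_ι]; simp only [Category.assoc]

/-- The map underlying the left whiskering. -/
def wlHom (M : Bicomod C D) {N N' : Bicomod D E} (g : N ⟶ N') : (comp M N).X ⟶ (comp M N').X :=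
  lift (ι M N ≫ M.X ◁ g.hom) (by
    rw [Category.assoc, Category.assoc, ← whiskerLeft_comp, Hom.l_comm, whisker_exchange_assoc,
      whiskerLeft_comp, ι_cond_assoc, associator_naturality_right])

@[simp] theorem wlHom_ι (M : Bicomod C D) {N N' : Bicomod D E} (g : N ⟶ N') :
    wlHom M g ≫ ι M N' = ι M N ≫ M.X ◁ g.hom := lift_ι _ _

@[simp] theorem wlHom_ι_assoc (M : Bicomod C D) {N N' : Bicomod D E} (g : N ⟶ N') {Z : V} (t : _ ⟶ Z) :
    wlHom M g ≫ ι M N' ≫ t = ι M N ≫ M.X ◁ g.hom ≫ t := by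
  rw [← Category.assoc, wlHom_ι]; simp only [Category.assoc]

/-- Left whiskering `M ◁ g`. -/
def wl (M : Bicomod C D) {N N' : Bicomod D E} (g : N ⟶ N') : comp M N ⟶ comp M N' where
  hom := wlHom M g
  l_comm := by
    apply tcancel (C.X ◁ ι M N')
    calc
      _ = wlHom M g ≫ ((comp M N').l ≫ C.X ◁ ι M N') := by monoidal
      _ = ι M N ≫ (M.X ◁ g.hom ≫ M.l ▷ N'.X) ⊗≫ 𝟙 _ := by rw [l_ι, wlHom_ι_assoc]; monoidal
      _ = ((comp M N).l ≫ C.X ◁ ι M N) ≫ C.X ◁ M.X ◁ g.hom := by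
        rw [whisker_exchange, l_ι]; monoidal
      _ = (comp M N).l ≫ C.X ◁ (ι M N ≫ M.X ◁ g.hom) := by monoidal
      _ = _ := by rw [Category.assoc, ← whiskerLeft_comp, wlHom_ι]
  r_comm := by
    apply tcancel (ι M N' ▷ E.X)
    calc
      _ = wlHom M g ≫ ((comp M N').r ≫ ι M N' ▷ E.X) := by monoidal
      _ = ι M N ≫ M.X ◁ (g.hom ≫ N'.r) ⊗≫ 𝟙 _ := by rw [r_ι, wlHom_ι_assoc]; monoidal
      _ = ((comp M N).r ≫ ι M N ▷ E.X) ≫ (M.X ◁ g.hom) ▷ E.X := by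
        rw [Hom.r_comm, r_ι]; monoidal
      _ = (comp M N).r ≫ (ι M N ≫ M.X ◁ g.hom) ▷ E.X := by monoidal
      _ = _ := by rw [Category.assoc, ← comp_whiskerRight, wlHom_ι]

/-- The map underlying the right whiskering. -/
def wrHom {M M' : Bicomod C D} (f : M ⟶ M') (N : Bicomod D E) : (comp M N).X ⟶ (comp M' N).X :=
  lift (ι M N ≫ f.hom ▷ N.X) (by
    rw [Category.assoc, Category.assoc, ← comp_whiskerRight_assoc, Hom.r_comm, ← whisker_exchange,
      ι_cond_assoc]
    simp)

@[simp] theorem wrHom_ι {M M' : Bicomod C D} (f : M ⟶ M') (N : Bicomod D E) :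
    wrHom f N ≫ ι M' N = ι M N ≫ f.hom ▷ N.X := lift_ι _ _

@[simp] theorem wrHom_ι_assoc {M M' : Bicomod C D} (f : M ⟶ M') (N : Bicomod D E) {Z : V} (t : _ ⟶ Z) :
    wrHom f N ≫ ι M' N ≫ t = ι M N ≫ f.hom ▷ N.X ≫ t := by
  rw [← Category.assoc, wrHom_ι]; simp only [Category.assoc]

/-- Right whiskering `f ▷ N`. -/
def wr {M M' : Bicomod C D} (f : M ⟶ M') (N : Bicomod D E) : comp M N ⟶ comp M' N where
  hom := wrHom f N
  l_comm := by
    apply tcancel (C.X ◁ ι M' N)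
    calc
      _ = wrHom f N ≫ ((comp M' N).l ≫ C.X ◁ ι M' N) := by monoidal
      _ = ι M N ≫ (f.hom ≫ M'.l) ▷ N.X ⊗≫ 𝟙 _ := by rw [l_ι, wrHom_ι_assoc]; monoidal
      _ = ((comp M N).l ≫ C.X ◁ ι M N) ≫ C.X ◁ f.hom ▷ N.X := by
        rw [Hom.l_comm, l_ι]; monoidal
      _ = (comp M N).l ≫ C.X ◁ (ι M N ≫ f.hom ▷ N.X) := by monoidal
      _ = _ := by rw [Category.assoc, ← whiskerLeft_comp, wrHom_ι]
  r_comm := by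
    apply tcancel (ι M' N ▷ E.X)
    calc
      _ = wrHom f N ≫ ((comp M' N).r ≫ ι M' N ▷ E.X) := by monoidal
      _ = ι M N ≫ (f.hom ▷ N.X ≫ M'.X ◁ N.r) ⊗≫ 𝟙 _ := by rw [r_ι, wrHom_ι_assoc]; monoidal
      _ = ((comp M N).r ≫ ι M N ▷ E.X) ≫ (f.hom ▷ N.X) ▷ E.X := by
        rw [← whisker_exchange, r_ι]; monoidal
      _ = (comp M N).r ≫ (ι M N ≫ f.hom ▷ N.X) ▷ E.X := by monoidal
      _ = _ := by rw [Category.assoc, ← comp_whiskerRight, wrHom_ι]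

@[simp] theorem wl_hom (M : Bicomod C D) {N N' : Bicomod D E} (g : N ⟶ N') :
    (wl M g).hom = wlHom M g := rfl

@[simp] theorem wr_hom {M M' : Bicomod C D} (f : M ⟶ M') (N : Bicomod D E) :
    (wr f N).hom = wrHom f N := rfl

/-- The map `(M ⊗_D N) ⊗_E P ⟶ M ⊗ (N ⊗_E P)`. -/
def assocAux (M : Bicomod C D) (N : Bicomod D E) (P : Bicomod E F) :
    (comp (comp M N) P).X ⟶ M.X ⊗ (comp N P).X :=
  liftLeft M.X (ι (comp M N) P ≫ ι M N ▷ P.X ≫ (α_ _ _ _).hom) (by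
    have h := ι_cond (comp M N) P
    calc
      _ = ι (comp M N) P ≫ (ι M N ≫ M.X ◁ N.r ≫ (α_ _ _ _).inv) ▷ P.X ⊗≫ 𝟙 _ := by monoidal
      _ = (ι (comp M N) P ≫ (comp M N).r ▷ P.X ≫ (α_ _ _ _).hom) ≫
          ι M N ▷ (E.X ⊗ P.X) ⊗≫ 𝟙 _ := by rw [← r_ι]; monoidal
      _ = ι (comp M N) P ≫ ((comp M N).X ◁ P.l ≫ ι M N ▷ (E.X ⊗ P.X)) ⊗≫ 𝟙 _ := by
        have h' : ι (comp M N) P ≫ (comp M N).r ▷ P.X ≫ (α_ _ _ _).hom =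
          ι (comp M N) P ≫ (comp M N).X ◁ P.l := h.symm
        rw [h']; monoidal
      _ = _ := by rw [whisker_exchange]; monoidal)

@[simp] theorem assocAux_ι (M : Bicomod C D) (N : Bicomod D E) (P : Bicomod E F) :
    assocAux M N P ≫ M.X ◁ ι N P = ι (comp M N) P ≫ ι M N ▷ P.X ≫ (α_ _ _ _).hom :=
  liftLeft_ι _ _ _

@[simp] theorem assocAux_ι_assoc (M : Bicomod C D) (N : Bicomod D E) (P : Bicomod E F) {Z : V} (t : _ ⟶ Z) :
    assocAux M N P ≫ M.X ◁ ι N P ≫ t = ι (comp M N) P ≫ ι M N ▷ P.X ≫ (α_ _ _ _).hom ≫ t := by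
  rw [← Category.assoc, assocAux_ι]; simp only [Category.assoc]

/-- The map `M ⊗_D (N ⊗_E P) ⟶ (M ⊗_D N) ⊗ P`. -/
def assocInvAux (M : Bicomod C D) (N : Bicomod D E) (P : Bicomod E F) :
    (comp M (comp N P)).X ⟶ (comp M N).X ⊗ P.X :=
  liftRight P.X (ι M (comp N P) ≫ M.X ◁ ι N P ≫ (α_ _ _ _).inv) (by
    have h := ι_cond M (comp N P)
    have h' : ι M (comp N P) ≫ M.r ▷ (comp N P).X ≫ (α_ _ _ _).hom =
          ι M (comp N P) ≫ M.X ◁ (comp N P).l := h.symm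
    symm
    calc
      _ = ι M (comp N P) ≫ M.X ◁ (ι N P ≫ N.l ▷ P.X ≫ (α_ _ _ _).hom) ⊗≫ 𝟙 _ := by monoidal
      _ = (ι M (comp N P) ≫ M.X ◁ (comp N P).l) ≫ M.X ◁ D.X ◁ ι N P ⊗≫ 𝟙 _ := by
        rw [← l_ι]; monoidal
      _ = ι M (comp N P) ≫ (M.r ▷ (comp N P).X ≫ (M.X ⊗ D.X) ◁ ι N P) ⊗≫ 𝟙 _ := by
        rw [← h']; monoidal
      _ = _ := by rw [← whisker_exchange]; monoidal)

@[simp] theorem assocInvAux_ι (M : Bicomod C D) (N : Bicomod D E) (P : Bicomod E F) :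
    assocInvAux M N P ≫ ι M N ▷ P.X = ι M (comp N P) ≫ M.X ◁ ι N P ≫ (α_ _ _ _).inv :=
  liftRight_ι _ _ _

@[simp] theorem assocInvAux_ι_assoc (M : Bicomod C D) (N : Bicomod D E) (P : Bicomod E F) {Z : V} (t : _ ⟶ Z) :
    assocInvAux M N P ≫ ι M N ▷ P.X ≫ t = ι M (comp N P) ≫ M.X ◁ ι N P ≫ (α_ _ _ _).inv ≫ t := by
  rw [← Category.assoc, assocInvAux_ι]; simp only [Category.assoc]

/-- The map underlying the associativity isomorphism. -/
def assocHom (M : Bicomod C D) (N : Bicomod D E) (P : Bicomod E F) :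
    (comp (comp M N) P).X ⟶ (comp M (comp N P)).X :=
  lift (M := M) (N := comp N P) (assocAux M N P) (by
    apply tcancel (M.X ◁ D.X ◁ ι N P)
    calc
      _ = assocAux M N P ≫ (M.r ▷ (comp N P).X ≫ (M.X ⊗ D.X) ◁ ι N P) ≫ (α_ _ _ _).hom := by
        monoidal
      _ = (assocAux M N P ≫ M.X ◁ ι N P) ≫ M.r ▷ (N.X ⊗ P.X) ⊗≫ 𝟙 _ := by
        rw [← whisker_exchange]; monoidal
      _ = ι (comp M N) P ≫ (ι M N ≫ M.r ▷ N.X ≫ (α_ _ _ _).hom) ▷ P.X ⊗≫ 𝟙 _ := by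
        rw [assocAux_ι]; monoidal
      _ = (assocAux M N P ≫ M.X ◁ ι N P) ≫ M.X ◁ (N.l ▷ P.X ≫ (α_ _ _ _).hom) := by
        rw [assocAux_ι, ← ι_cond]; monoidal
      _ = assocAux M N P ≫ M.X ◁ (ι N P ≫ N.l ▷ P.X ≫ (α_ _ _ _).hom) := by monoidal
      _ = _ := by rw [← l_ι]; monoidal)

/-- The inverse of the map underlying the associativity isomorphism. -/
def assocInv (M : Bicomod C D) (N : Bicomod D E) (P : Bicomod E F) :
    (comp M (comp N P)).X ⟶ (comp (comp M N) P).X :=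
  lift (M := comp M N) (N := P) (assocInvAux M N P) (by
    apply tcancel (ι M N ▷ (E.X ⊗ P.X))
    calc
      _ = assocInvAux M N P ≫ ((comp M N).r ≫ ι M N ▷ E.X) ▷ P.X ⊗≫ 𝟙 _ := by monoidal
      _ = (assocInvAux M N P ≫ ι M N ▷ P.X) ≫ (M.X ◁ N.r) ▷ P.X ⊗≫
          𝟙 ((M.X ⊗ N.X) ⊗ E.X ⊗ P.X) := by
        rw [r_ι]; monoidal
      _ = ι M (comp N P) ≫ M.X ◁ (ι N P ≫ N.r ▷ P.X ≫ (α_ _ _ _).hom) ⊗≫ 𝟙 _ := by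
        rw [assocInvAux_ι]; monoidal
      _ = (assocInvAux M N P ≫ ι M N ▷ P.X) ≫ (M.X ⊗ N.X) ◁ P.l := by
        rw [assocInvAux_ι, ← ι_cond]; monoidal
      _ = _ := by rw [Category.assoc, ← whisker_exchange, Category.assoc])

@[simp] theorem assocHom_ι (M : Bicomod C D) (N : Bicomod D E) (P : Bicomod E F) :
    assocHom M N P ≫ ι M (comp N P) = assocAux M N P := lift_ι _ _

@[simp] theorem assocHom_ι_assoc (M : Bicomod C D) (N : Bicomod D E) (P : Bicomod E F) {Z : V} (t : _ ⟶ Z) :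
    assocHom M N P ≫ ι M (comp N P) ≫ t = assocAux M N P ≫ t := by
  rw [← Category.assoc, assocHom_ι]

@[simp] theorem assocInv_ι (M : Bicomod C D) (N : Bicomod D E) (P : Bicomod E F) :
    assocInv M N P ≫ ι (comp M N) P = assocInvAux M N P := lift_ι _ _

@[simp] theorem assocInv_ι_assoc (M : Bicomod C D) (N : Bicomod D E) (P : Bicomod E F) {Z : V} (t : _ ⟶ Z) :
    assocInv M N P ≫ ι (comp M N) P ≫ t = assocInvAux M N P ≫ t := by
  rw [← Category.assoc, assocInv_ι]

/-- The associativity isomorphism. -/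
def assoc (M : Bicomod C D) (N : Bicomod D E) (P : Bicomod E F) :
    comp (comp M N) P ≅ comp M (comp N P) :=
  isoMk
    { hom := assocHom M N P
      l_comm := by
        apply tcancel (C.X ◁ (ι M (comp N P) ≫ M.X ◁ ι N P))
        calc
          _ = assocHom M N P ≫ ((comp M (comp N P)).l ≫ C.X ◁ ι M (comp N P)) ≫
              C.X ◁ M.X ◁ ι N P := by monoidal
          _ = assocAux M N P ≫ (M.l ▷ (comp N P).X ≫ (C.X ⊗ M.X) ◁ ι N P) ⊗≫ 𝟙 _ := by
            rw [l_ι, Category.assoc, assocHom_ι_assoc]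
            monoidal
          _ = (assocAux M N P ≫ M.X ◁ ι N P) ≫ M.l ▷ (N.X ⊗ P.X) ⊗≫ 𝟙 _ := by
            rw [← whisker_exchange]; monoidal
          _ = ι (comp M N) P ≫ (ι M N ≫ M.l ▷ N.X ≫ (α_ _ _ _).hom) ▷ P.X ⊗≫ 𝟙 _ := by
            rw [assocAux_ι]; monoidal
          _ = (ι (comp M N) P ≫ (comp M N).l ▷ P.X ≫ (α_ _ _ _).hom) ≫ C.X ◁ ι M N ▷ P.X ⊗≫ 𝟙 _ := by
            rw [← l_ι]; monoidal
          _ = ((comp (comp M N) P).l ≫ C.X ◁ ι (comp M N) P) ≫ C.X ◁ ι M N ▷ P.X ⊗≫ 𝟙 _ := by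
            rw [l_ι]
          _ = (comp (comp M N) P).l ≫ C.X ◁ (ι (comp M N) P ≫ ι M N ▷ P.X ≫ (α_ _ _ _).hom) := by
            monoidal
          _ = _ := by rw [← assocAux_ι, ← assocHom_ι]; monoidal
      r_comm := by
        apply tcancel ((ι M (comp N P) ≫ M.X ◁ ι N P) ▷ F.X)
        calc
          _ = assocHom M N P ≫ ((comp M (comp N P)).r ≫ ι M (comp N P) ▷ F.X) ≫
              (M.X ◁ ι N P) ▷ F.X := by monoidal
          _ = assocAux M N P ≫ M.X ◁ ((comp N P).r ≫ ι N P ▷ F.X) ⊗≫ 𝟙 _ := by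
            rw [r_ι, Category.assoc, assocHom_ι_assoc]
            monoidal
          _ = (assocAux M N P ≫ M.X ◁ ι N P) ≫ M.X ◁ N.X ◁ P.r ⊗≫ 𝟙 _ := by
            rw [r_ι]; monoidal
          _ = ι (comp M N) P ≫ (ι M N ▷ P.X ≫ (M.X ⊗ N.X) ◁ P.r) ⊗≫ 𝟙 _ := by
            rw [assocAux_ι]; monoidal
          _ = (ι (comp M N) P ≫ (comp M N).X ◁ P.r ≫ (α_ _ _ _).inv) ≫
              ι M N ▷ P.X ▷ F.X ⊗≫ 𝟙 _ := by
            rw [← whisker_exchange]; monoidal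
          _ = ((comp (comp M N) P).r ≫ ι (comp M N) P ▷ F.X) ≫ ι M N ▷ P.X ▷ F.X ⊗≫ 𝟙 _ := by
            rw [r_ι]
          _ = (comp (comp M N) P).r ≫ (ι (comp M N) P ≫ ι M N ▷ P.X ≫ (α_ _ _ _).hom) ▷ F.X := by
            monoidal
          _ = _ := by rw [← assocAux_ι, ← assocHom_ι]; monoidal }
    (assocInv M N P)
    (by
      apply tcancel (ι (comp M N) P ≫ ι M N ▷ P.X)
      simp)
    (by
      apply tcancel (ι M (comp N P) ≫ M.X ◁ ι N P)
      simp)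

@[simp] theorem assoc_hom_hom (M : Bicomod C D) (N : Bicomod D E) (P : Bicomod E F) :
    (assoc M N P).hom.hom = assocHom M N P := rfl

@[simp] theorem assoc_inv_hom (M : Bicomod C D) (N : Bicomod D E) (P : Bicomod E F) :
    (assoc M N P).inv.hom = assocInv M N P := rfl

/-- The left unit isomorphism `C ⊗_C M ≅ M`. -/
def lunit (M : Bicomod C D) : comp (reg C) M ≅ M :=
  (isoMk (M := M) (N := comp (reg C) M)
    { hom := lift M.l (by simpa using M.l_coassoc.symm)
      l_comm := by
        apply tcancel (C.X ◁ ι (reg C) M)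
        rw [Category.assoc, l_ι, lift_ι_assoc, Category.assoc, ← whiskerLeft_comp, lift_ι]
        exact M.l_coassoc.symm
      r_comm := by
        apply tcancel (ι (reg C) M ▷ D.X)
        rw [Category.assoc, r_ι, lift_ι_assoc, Category.assoc, ← comp_whiskerRight, lift_ι,
          ← reassoc_of% M.lr]
        simp }
    (ι (reg C) M ≫ ε[C.X] ▷ M.X ≫ (λ_ M.X).hom)
    (by simp)
    (by
      apply tcancel (ι (reg C) M)
      dsimp only
      calc
        _ = ι (reg C) M ≫ (ε[C.X] ▷ M.X ≫ (𝟙_ V) ◁ M.l) ≫ (λ_ _).hom := by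
          rw [Category.assoc, lift_ι]; monoidal
        _ = (ι (reg C) M ≫ C.X ◁ M.l) ≫ ε[C.X] ▷ (C.X ⊗ M.X) ≫ (λ_ _).hom := by
          rw [← whisker_exchange]; monoidal
        _ = ι (reg C) M ≫ (Δ[C.X] ≫ ε[C.X] ▷ C.X) ▷ M.X ⊗≫ 𝟙 _ := by
          have h := ι_cond (reg C) M
          rw [h]; monoidal
        _ = _ := by
          rw [ComonObj.counit_comul]; monoidal)).symm

/-- The right unit isomorphism `M ⊗_D D ≅ M`. -/
def runit (M : Bicomod C D) : comp M (reg D) ≅ M :=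
  (isoMk (M := M) (N := comp M (reg D))
    { hom := lift M.r (by simp [r_coassoc_assoc])
      l_comm := by
        apply tcancel (C.X ◁ ι M (reg D))
        rw [Category.assoc, l_ι, lift_ι_assoc, Category.assoc, ← whiskerLeft_comp, lift_ι,
          ← M.lr]
      r_comm := by
        apply tcancel (ι M (reg D) ▷ D.X)
        rw [Category.assoc, r_ι, lift_ι_assoc, Category.assoc, ← comp_whiskerRight, lift_ι]
        exact M.r_coassoc.symm }
    (ι M (reg D) ≫ M.X ◁ ε[D.X] ≫ (ρ_ M.X).hom)
    (by simp)
    (by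
      apply tcancel (ι M (reg D))
      dsimp only
      calc
        _ = ι M (reg D) ≫ (M.X ◁ ε[D.X] ≫ M.r ▷ (𝟙_ V)) ≫ (ρ_ _).hom := by
          rw [Category.assoc, lift_ι]; monoidal
        _ = (ι M (reg D) ≫ M.r ▷ D.X ≫ (α_ _ _ _).hom) ≫ M.X ◁ (D.X ◁ ε[D.X] ≫ (ρ_ _).hom) := by
          rw [whisker_exchange]; monoidal
        _ = ι M (reg D) ≫ M.X ◁ (Δ[D.X] ≫ D.X ◁ ε[D.X]) ⊗≫ 𝟙 _ := by
          have h := ι_cond M (reg D)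
          rw [← h]; monoidal
        _ = _ := by
          rw [ComonObj.comul_counit]; monoidal)).symm

theorem lunit_hom_hom (M : Bicomod C D) :
    (lunit M).hom.hom = ι (reg C) M ≫ ε[C.X] ▷ M.X ≫ (λ_ M.X).hom := rfl

theorem runit_hom_hom (M : Bicomod C D) :
    (runit M).hom.hom = ι M (reg D) ≫ M.X ◁ ε[D.X] ≫ (ρ_ M.X).hom := rfl

theorem assocHom_ι_ι (M : Bicomod C D) (N : Bicomod D E) (P : Bicomod E F) :
    assocHom M N P ≫ ι M (comp N P) ≫ M.X ◁ ι N P =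
      ι (comp M N) P ≫ ι M N ▷ P.X ≫ (α_ _ _ _).hom := by simp

@[simp] theorem lunit_inv_hom_ι (M : Bicomod C D) : (lunit M).inv.hom ≫ ι (reg C) M = M.l :=
  lift_ι _ _

@[simp] theorem runit_inv_hom_ι (M : Bicomod C D) : (runit M).inv.hom ≫ ι M (reg D) = M.r :=
  lift_ι _ _

end Comp
end Bicomod

variable (V) in
/-- The bicategory of comonoids, comodules and comodule maps. -/
structure Comod where
  comon : Comon V

variable [BraidedCategory V] [CoreflexiveTensor V]

open Bicomod in
instance Comod.bicategory : Bicategory (Comod V) where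
  Hom C D := Bicomod C.comon D.comon
  id C := reg C.comon
  comp M N := comp M N
  homCategory C D := Bicomod.category C.comon D.comon
  whiskerLeft M _ _ g := wl M g
  whiskerRight f N := wr f N
  associator M N P := Bicomod.assoc M N P
  leftUnitor M := lunit M
  rightUnitor M := runit M
  whiskerLeft_id M N := by
    ext; simp
  whiskerLeft_comp M _ _ _ g h := by
    ext; simp
  id_whiskerLeft g := by
    rw [← Iso.inv_comp_eq]
    ext
    simp only [comp_hom, wl_hom, Category.assoc, wlHom_ι, lunit_inv_hom_ι, Hom.l_comm]
    rw [← Category.assoc, lunit_inv_hom_ι]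
  comp_whiskerLeft M N _ _ g := by
    rw [← Category.assoc, Iso.eq_comp_inv]
    ext
    apply tcancel (M.X ◁ ι N _)
    simp only [comp_hom, wl_hom, assoc_hom_hom, Category.assoc, assocHom_ι, wlHom_ι, assocAux_ι,
      wlHom_ι_assoc, assocHom_ι_assoc]
    rw [← MonoidalCategory.whiskerLeft_comp, wlHom_ι, MonoidalCategory.whiskerLeft_comp,
      assocAux_ι_assoc, MonoidalCategory.whisker_exchange_assoc]
    simp
  id_whiskerRight M N := by
    ext; simp
  comp_whiskerRight f g N := by
    ext; simp
  whiskerRight_id f := by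
    rw [← Category.assoc, Iso.eq_comp_inv]
    ext
    simp only [comp_hom, wr_hom, runit_hom_hom, wrHom_ι_assoc, Category.assoc]
    rw [← MonoidalCategory.whisker_exchange_assoc]; simp
  whiskerRight_comp f M N := by
    rw [Iso.eq_inv_comp]
    ext
    apply tcancel (_ ◁ ι M N)
    simp only [comp_hom, wr_hom, assoc_hom_hom, Category.assoc, assocHom_ι, wrHom_ι, assocAux_ι,
      wrHom_ι_assoc, assocHom_ι_assoc]
    rw [← MonoidalCategory.whisker_exchange, assocAux_ι_assoc, 
      ← MonoidalCategory.comp_whiskerRight_assoc, wrHom_ι]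
    simp
  whisker_assoc M _ _ g N := by
    rw [← Category.assoc, Iso.eq_comp_inv]
    ext
    apply tcancel (_ ◁ ι _ N)
    simp only [comp_hom, wr_hom, wl_hom, assoc_hom_hom, Category.assoc, assocHom_ι, assocAux_ι,
      wrHom_ι_assoc, assocHom_ι_assoc, wlHom_ι]
    rw [← MonoidalCategory.whiskerLeft_comp, wrHom_ι, MonoidalCategory.whiskerLeft_comp,
      assocAux_ι_assoc, ← MonoidalCategory.comp_whiskerRight_assoc, wlHom_ι]
    simp
  whisker_exchange f g := by
    ext; simp [MonoidalCategory.whisker_exchange]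
  pentagon M N P Q := by
    ext
    apply tcancel (M.X ◁ (ι N (comp P Q) ≫ N.X ◁ ι P Q))
    have h := assocHom_ι_ι N P Q
    simp only [comp_hom, wr_hom, wl_hom, assoc_hom_hom, Category.assoc, assocHom_ι, wlHom_ι,
      assocHom_ι_assoc]
    rw [← MonoidalCategory.whiskerLeft_comp, h]
    simp only [MonoidalCategory.whiskerLeft_comp, assocAux_ι_assoc, assocHom_ι_assoc, wrHom_ι_assoc]
    rw [← MonoidalCategory.comp_whiskerRight_assoc, assoc_hom_hom, assocHom_ι]
    calc
      _ = ι (comp (comp M N) P) Q ≫ (assocAux M N P ≫ M.X ◁ ι N P) ▷ Q.X ⊗≫ 𝟙 _ := by monoidal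
      _ = (ι (comp (comp M N) P) Q ≫ ι (comp M N) P ▷ Q.X ≫ (α_ _ _ _).hom) ≫
          ι M N ▷ (P.X ⊗ Q.X) ⊗≫ 𝟙 _ := by rw [assocAux_ι]; monoidal
      _ = assocAux (comp M N) P Q ≫ ((comp M N).X ◁ ι P Q ≫ ι M N ▷ (P.X ⊗ Q.X)) ⊗≫ 𝟙 _ := by
        rw [← assocAux_ι]; monoidal
      _ = _ := by rw [MonoidalCategory.whisker_exchange]; monoidal
  triangle M N := by
    ext
    simp only [comp_hom, wr_hom, wl_hom, assoc_hom_hom, Category.assoc, wlHom_ι, wrHom_ι,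
      runit_hom_hom, lunit_hom_hom, assocHom_ι_assoc]
    simp
    
end Bicomodules

section Tensor

variable {V : Type u} [Category.{v} V] [MonoidalCategory V] [BraidedCategory V]

theorem tensorμ_wr {A A' B B' : V} (f : A ⟶ A') (g : B ⟶ B') (X Y : V) :
    tensorμ A X B Y ≫ (f ⊗ₘ g) ▷ (X ⊗ Y) = (f ▷ X ⊗ₘ g ▷ Y) ≫ tensorμ A' X B' Y := by
  have h := tensorμ_natural f (𝟙 X) g (𝟙 Y)
  rw [tensorHom_id, tensorHom_id] at h
  rw [h]; simp

theorem tensorμ_wr_assoc {A A' B B' : V} (f : A ⟶ A') (g : B ⟶ B') (X Y : V) {Z : V}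
    (t : _ ⟶ Z) : tensorμ A X B Y ≫ (f ⊗ₘ g) ▷ (X ⊗ Y) ≫ t =
      (f ▷ X ⊗ₘ g ▷ Y) ≫ tensorμ A' X B' Y ≫ t := by
  rw [← Category.assoc, tensorμ_wr, Category.assoc]

theorem tensorμ_wl {A A' B B' : V} (f : A ⟶ A') (g : B ⟶ B') (X Y : V) :
    tensorμ X A Y B ≫ (X ⊗ Y) ◁ (f ⊗ₘ g) = (X ◁ f ⊗ₘ Y ◁ g) ≫ tensorμ X A' Y B' := by
  have h := tensorμ_natural (𝟙 X) f (𝟙 Y) g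
  rw [id_tensorHom, id_tensorHom] at h
  rw [h]; simp

theorem tensorμ_wl_assoc {A A' B B' : V} (f : A ⟶ A') (g : B ⟶ B') (X Y : V) {Z : V}
    (t : _ ⟶ Z) : tensorμ X A Y B ≫ (X ⊗ Y) ◁ (f ⊗ₘ g) ≫ t =
      (X ◁ f ⊗ₘ Y ◁ g) ≫ tensorμ X A' Y B' ≫ t := by
  rw [← Category.assoc, tensorμ_wl, Category.assoc]

/-- The tensor product of comonoids, with comultiplication `(1 ⊗ c ⊗ 1)(δ ⊗ δ)`. -/
@[reducible] def CategoryTheory.Comon.tens (C D : Comon V) : Comon V := Comon.mk (C.X ⊗ D.X)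

/-- The unit object as a comonoid. -/
@[reducible] def CategoryTheory.Comon.one (V : Type u) [Category.{v} V] [MonoidalCategory V] :
    Comon V :=
  @Comon.mk V _ _ (𝟙_ V) (ComonObj.instTensorUnit V)

/-- The comonoid `C^o`, with comultiplication `c δ`. -/
@[reducible] def CategoryTheory.Comon.opp (C : Comon V) : Comon V :=
  @Comon.mk V _ _ C.X
    { counit := ε[C.X]
      comul := Δ[C.X] ≫ (β_ C.X C.X).hom
      counit_comul := by
        rw [Category.assoc, ← BraidedCategory.braiding_naturality_right]; simp
      comul_counit := by
        rw [Category.assoc, ← BraidedCategory.braiding_naturality_left]; simp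
      comul_assoc := by
        have h := ComonObj.comul_assoc C.X
        have y := BraidedCategory.yang_baxter C.X C.X C.X
        simp only [MonoidalCategory.whiskerLeft_comp, MonoidalCategory.comp_whiskerRight,
          Category.assoc]
        rw [← BraidedCategory.braiding_naturality_left_assoc,
          ← BraidedCategory.braiding_naturality_right_assoc, reassoc_of% h,
          BraidedCategory.braiding_tensor_left_hom, BraidedCategory.braiding_tensor_right_hom]
        simp only [Category.assoc, y] }

theorem CategoryTheory.Comon.opp_comul (C : Comon V) :
    Δ[C.opp.X] = Δ[C.X] ≫ (β_ C.X C.X).hom := rfl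

theorem CategoryTheory.Comon.opp_counit (C : Comon V) : ε[C.opp.X] = ε[C.X] := rfl

/-- The tensor product of comonoid maps. -/
@[reducible] def CategoryTheory.Comon.tensMap {C D C' D' : Comon V} (f : C ⟶ C') (g : D ⟶ D') :
    C.tens D ⟶ C'.tens D' where
  hom := f.hom ⊗ₘ g.hom
  isComonHom_hom :=
    { hom_counit := by simp
      hom_comul := by
        have h := tensorμ_natural f.hom f.hom g.hom g.hom
        rw [Comon.tensorObj_comul, Comon.tensorObj_comul, Category.assoc, ← h,
          tensorHom_comp_tensorHom_assoc, tensorHom_comp_tensorHom_assoc, IsComonHom.hom_comul,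
          IsComonHom.hom_comul] }

/-- A comonoid map `f : C ⟶ D` as a comonoid map `C^o ⟶ D^o`. -/
@[reducible] def CategoryTheory.Comon.oppMap {C D : Comon V} (f : C ⟶ D) : C.opp ⟶ D.opp :=
  @Comon.Hom.mk V _ _ C.opp D.opp f.hom
    { hom_counit := IsComonHom.hom_counit f.hom
      hom_comul := by
        have h := IsComonHom.hom_comul f.hom
        change f.hom ≫ Δ ≫ (β_ _ _).hom = (Δ ≫ (β_ _ _).hom) ≫ _
        rw [reassoc_of% h, Category.assoc, BraidedCategory.braiding_naturality] }

namespace Bicomod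

variable {C D C' D' : Comon V}

/-- The tensor product of comodules. -/
@[reducible] def tensor (M : Bicomod C D) (N : Bicomod C' D') :
    Bicomod (C.tens C') (D.tens D') where
  X := M.X ⊗ N.X
  l := (M.l ⊗ₘ N.l) ≫ tensorμ C.X M.X C'.X N.X
  r := (M.r ⊗ₘ N.r) ≫ tensorμ M.X D.X N.X D'.X
  l_counit := by
    have h := leftUnitor_monoidal M.X N.X
    rw [Comon.tensorObj_counit, MonoidalCategory.comp_whiskerRight, Category.assoc,
      tensorμ_wr_assoc, tensorHom_comp_tensorHom_assoc, l_counit, l_counit,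
      ← cancel_mono (λ_ (M.X ⊗ N.X)).hom, Category.assoc, Category.assoc, ← h]
    simp
  l_coassoc := by
    have a := associator_monoidal C.X C.X M.X C'.X C'.X N.X
    rw [Comon.tensorObj_comul, MonoidalCategory.comp_whiskerRight,
      MonoidalCategory.whiskerLeft_comp]
    simp only [Category.assoc]
    rw [tensorμ_wl_assoc, tensorμ_wr_assoc, a, tensorHom_comp_tensorHom_assoc, l_coassoc,
      l_coassoc, tensorHom_comp_tensorHom_assoc, tensorHom_comp_tensorHom_assoc]
    simp only [Category.assoc]
  r_counit := by
    have h := rightUnitor_monoidal M.X N.X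
    rw [Comon.tensorObj_counit, MonoidalCategory.whiskerLeft_comp, Category.assoc,
      tensorμ_wl_assoc, tensorHom_comp_tensorHom_assoc, r_counit, r_counit,
      ← cancel_mono (ρ_ (M.X ⊗ N.X)).hom, Category.assoc, Category.assoc, ← h]
    simp
  r_coassoc := by
    have a := associator_monoidal M.X D.X D.X N.X D'.X D'.X
    rw [Comon.tensorObj_comul, MonoidalCategory.comp_whiskerRight,
      MonoidalCategory.whiskerLeft_comp, ← cancel_mono (α_ _ _ _).hom]
    simp only [Category.assoc]
    rw [tensorμ_wl_assoc, tensorμ_wr_assoc, a, tensorHom_comp_tensorHom_assoc, r_coassoc,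
      r_coassoc, tensorHom_comp_tensorHom_assoc, tensorHom_comp_tensorHom_assoc]
    simp
  lr := by
    have a := associator_monoidal C.X M.X D.X C'.X N.X D'.X
    rw [MonoidalCategory.whiskerLeft_comp, MonoidalCategory.comp_whiskerRight]
    simp only [Category.assoc]
    rw [tensorμ_wl_assoc, tensorμ_wr_assoc, a, tensorHom_comp_tensorHom_assoc,
      tensorHom_comp_tensorHom_assoc, tensorHom_comp_tensorHom_assoc]
    simp only [Category.assoc, lr]

/-- The tensor product of comodule maps. -/
@[reducible] def tensorMap {M M' : Bicomod C D} {N N' : Bicomod C' D'} (f : M ⟶ M') (g : N ⟶ N') :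
    M.tensor N ⟶ M'.tensor N' where
  hom := f.hom ⊗ₘ g.hom
  l_comm := by
    dsimp only [tensor]
    rw [Category.assoc, tensorμ_wl, tensorHom_comp_tensorHom_assoc, tensorHom_comp_tensorHom_assoc,
      Hom.l_comm, Hom.l_comm]
  r_comm := by
    dsimp only [tensor]
    rw [Category.assoc, tensorμ_wr, tensorHom_comp_tensorHom_assoc, tensorHom_comp_tensorHom_assoc,
      Hom.r_comm, Hom.r_comm]

/-- The comodule obtained by pushing the coactions forward along comonoid maps. -/
@[reducible] def corestrict (g : C ⟶ C') (h : D ⟶ D') (M : Bicomod C D) : Bicomod C' D' where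
  X := M.X
  l := M.l ≫ g.hom ▷ M.X
  r := M.r ≫ M.X ◁ h.hom
  l_counit := by
    rw [Category.assoc, ← MonoidalCategory.comp_whiskerRight, IsComonHom.hom_counit, l_counit]
  l_coassoc := by
    have e := IsComonHom.hom_comul g.hom
    rw [Category.assoc, Category.assoc, ← MonoidalCategory.comp_whiskerRight_assoc, e]
    calc
      _ = M.l ≫ (g.hom ▷ M.X ≫ C'.X ◁ M.l) ≫ C'.X ◁ g.hom ▷ M.X := by monoidal
      _ = (M.l ≫ C.X ◁ M.l) ≫ g.hom ▷ (C.X ⊗ M.X) ≫ C'.X ◁ g.hom ▷ M.X := by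
        rw [← whisker_exchange]; monoidal
      _ = _ := by rw [l_coassoc, MonoidalCategory.tensorHom_def]; monoidal
  r_counit := by
    rw [Category.assoc, ← MonoidalCategory.whiskerLeft_comp, IsComonHom.hom_counit, r_counit]
  r_coassoc := by
    have e := IsComonHom.hom_comul h.hom
    rw [Category.assoc, Category.assoc, ← MonoidalCategory.whiskerLeft_comp_assoc, e]
    calc
      _ = M.r ≫ (M.X ◁ h.hom ≫ M.r ▷ D'.X) ≫ (M.X ◁ h.hom) ▷ D'.X := by monoidal
      _ = (M.r ≫ M.r ▷ D.X) ≫ (M.X ⊗ D.X) ◁ h.hom ≫ (M.X ◁ h.hom) ▷ D'.X := by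
        rw [whisker_exchange]; monoidal
      _ = _ := by rw [r_coassoc, tensorHom_def']; monoidal
  lr := by
    calc
      _ = M.r ≫ (M.X ◁ h.hom ≫ M.l ▷ D'.X) ≫ (g.hom ▷ M.X) ▷ D'.X ⊗≫ 𝟙 _ := by monoidal
      _ = (M.r ≫ M.l ▷ D.X ≫ (α_ _ _ _).hom) ≫ C.X ◁ M.X ◁ h.hom ≫ g.hom ▷ (M.X ⊗ D'.X) := by
        rw [whisker_exchange]; monoidal
      _ = M.l ≫ C.X ◁ (M.r ≫ M.X ◁ h.hom) ≫ g.hom ▷ (M.X ⊗ D'.X) := by rw [lr]; monoidal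
      _ = _ := by rw [whisker_exchange]; monoidal

end Bicomod
end Tensor

section Interchange

variable {V : Type u} [Category.{v} V] [MonoidalCategory V] [BraidedCategory V]

instance isIso_tensorμ (X X' Y Y' : V) : IsIso (tensorμ X X' Y Y') :=
  ⟨tensorδ X X' Y Y', by simp, by simp⟩

namespace Bicomod

variable {C D E C' D' E' : Comon V}

/-- The tensor product of identity 1-cells is the identity 1-cell. -/
@[reducible] def unitIso (C D : Comon V) : (reg C).tensor (reg D) ≅ reg (C.tens D) :=
  isoMk { hom := 𝟙 (C.X ⊗ D.X)
          l_comm := by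
            dsimp only [tensor, reg]
            rw [Comon.tensorObj_comul, MonoidalCategory.whiskerLeft_id, Category.id_comp,
              Category.comp_id]
          r_comm := by
            dsimp only [tensor, reg]
            rw [Comon.tensorObj_comul, MonoidalCategory.id_whiskerRight, Category.id_comp,
              Category.comp_id] }
    (𝟙 (C.X ⊗ D.X)) (Category.comp_id _) (Category.comp_id _)

variable (M : Bicomod C D) (M' : Bicomod D E) (N : Bicomod C' D') (N' : Bicomod D' E')

theorem shuffle_r : tensorμ M.X M'.X N.X N'.X ≫ (M.tensor N).r ▷ (M'.X ⊗ N'.X) ≫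
      (α_ (M.X ⊗ N.X) (D.X ⊗ D'.X) (M'.X ⊗ N'.X)).hom =
    ((M.r ▷ M'.X ≫ (α_ M.X D.X M'.X).hom) ⊗ₘ (N.r ▷ N'.X ≫ (α_ N.X D'.X N'.X).hom)) ≫
      tensorμ M.X (D.X ⊗ M'.X) N.X (D'.X ⊗ N'.X) ≫
        (M.X ⊗ N.X) ◁ tensorμ D.X M'.X D'.X N'.X := by
  have a := associator_monoidal M.X D.X M'.X N.X D'.X N'.X
  dsimp only [tensor]
  rw [MonoidalCategory.comp_whiskerRight, Category.assoc, tensorμ_wr_assoc, a,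
    tensorHom_comp_tensorHom_assoc]

theorem shuffle_l : tensorμ M.X M'.X N.X N'.X ≫ (M.X ⊗ N.X) ◁ (M'.tensor N').l =
    ((M.X ◁ M'.l) ⊗ₘ (N.X ◁ N'.l)) ≫
      tensorμ M.X (D.X ⊗ M'.X) N.X (D'.X ⊗ N'.X) ≫
        (M.X ⊗ N.X) ◁ tensorμ D.X M'.X D'.X N'.X := by
  dsimp only [tensor]
  rw [MonoidalCategory.whiskerLeft_comp, tensorμ_wl_assoc]

variable [CoreflexiveTensor V]

/-- The map `(M ⊗_D M') ⊗ (N ⊗_{D'} N') ⟶ (M ⊗ N) ⊗_{D ⊗ D'} (M' ⊗ N')`. -/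
def interHom : (comp M M').X ⊗ (comp N N').X ⟶ (comp (M.tensor N) (M'.tensor N')).X :=
  lift (M := M.tensor N) (N := M'.tensor N') ((ι M M' ⊗ₘ ι N N') ≫ tensorμ M.X M'.X N.X N'.X) (by
    rw [Category.assoc, Category.assoc, shuffle_r, shuffle_l, tensorHom_comp_tensorHom_assoc,
      tensorHom_comp_tensorHom_assoc, ι_cond, ι_cond])

theorem interHom_ι : interHom M M' N N' ≫ ι (M.tensor N) (M'.tensor N') =
    (ι M M' ⊗ₘ ι N N') ≫ tensorμ M.X M'.X N.X N'.X :=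
  lift_ι _ _

/-- A map which equalizes the tensor products of two coreflexive pairs equalizes the first. -/
theorem eq_first {A B A' B' T : V} {f g : A ⟶ B} {f' g' : A' ⟶ B'} [IsCoreflexivePair f' g']
    {k : T ⟶ A ⊗ A'} (h : k ≫ (f ⊗ₘ f') = k ≫ (g ⊗ₘ g')) : k ≫ f ▷ A' = k ≫ g ▷ A' := by
  have h' := h =≫ (B ◁ commonRetraction f' g')
  simpa [MonoidalCategory.tensorHom_def, ← MonoidalCategory.whiskerLeft_comp] using h'

/-- A map which equalizes the tensor products of two coreflexive pairs equalizes the second. -/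
theorem eq_second {A B A' B' T : V} {f g : A ⟶ B} {f' g' : A' ⟶ B'} [IsCoreflexivePair f g]
    {k : T ⟶ A ⊗ A'} (h : k ≫ (f ⊗ₘ f') = k ≫ (g ⊗ₘ g')) : k ≫ A ◁ f' = k ≫ A ◁ g' := by
  have h' := h =≫ (commonRetraction f g ▷ B')
  simpa [MonoidalCategory.tensorHom_def', ← MonoidalCategory.comp_whiskerRight] using h'

theorem exists_inter {T : V} (k : T ⟶ (M.X ⊗ M'.X) ⊗ (N.X ⊗ N'.X))
    (h : k ≫ ((M.r ▷ M'.X ≫ (α_ M.X D.X M'.X).hom) ⊗ₘ (N.r ▷ N'.X ≫ (α_ N.X D'.X N'.X).hom)) =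
      k ≫ ((M.X ◁ M'.l) ⊗ₘ (N.X ◁ N'.l))) :
    ∃ m : T ⟶ (comp M M').X ⊗ (comp N N').X, m ≫ (ι M M' ⊗ₘ ι N N') = k := by
  have h₁ := eq_first h
  have h₂ := eq_second h
  refine ⟨liftLeft (M := N) (N := N') (comp M M').X (liftRight (M := M) (N := M') _ k h₁) ?_, ?_⟩
  · apply tcancel (ι M M' ▷ _)
    rw [Category.assoc, Category.assoc, whisker_exchange, whisker_exchange, liftRight_ι_assoc,
      liftRight_ι_assoc, h₂]
  · rw [MonoidalCategory.tensorHom_def', liftLeft_ι_assoc, liftRight_ι]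

theorem exists_interInv : ∃ m : (comp (M.tensor N) (M'.tensor N')).X ⟶ _,
    m ≫ (ι M M' ⊗ₘ ι N N') = ι (M.tensor N) (M'.tensor N') ≫ tensorδ M.X M'.X N.X N'.X :=
  exists_inter M M' N N' _ (by
    have h := ι_cond (M.tensor N) (M'.tensor N')
    have hr := shuffle_r M M' N N'
    have hl := shuffle_l M M' N N'
    rw [← cancel_mono (tensorμ M.X (D.X ⊗ M'.X) N.X (D'.X ⊗ N'.X) ≫
      (M.X ⊗ N.X) ◁ tensorμ D.X M'.X D'.X N'.X)]
    simp only [Category.assoc]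
    rw [← hr, ← hl, tensorδ_tensorμ_assoc, tensorδ_tensorμ_assoc]
    exact h.symm)

/-- The inverse of `interHom`. -/
def interInv : (comp (M.tensor N) (M'.tensor N')).X ⟶ (comp M M').X ⊗ (comp N N').X :=
  (exists_interInv M M' N N').choose

theorem interInv_ι : interInv M M' N N' ≫ (ι M M' ⊗ₘ ι N N') =
    ι (M.tensor N) (M'.tensor N') ≫ tensorδ M.X M'.X N.X N'.X :=
  (exists_interInv M M' N N').choose_spec

instance : TensorMono (ι M M' ⊗ₘ ι N N') := by
  rw [MonoidalCategory.tensorHom_def]; infer_instance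

/-- The interchange of tensor product and composition of 1-cells. -/
def inter : (comp M M').tensor (comp N N') ≅ comp (M.tensor N) (M'.tensor N') :=
  isoMk
    { hom := interHom M M' N N'
      l_comm := by
        apply tcancel ((C.X ⊗ C'.X) ◁ ι (M.tensor N) (M'.tensor N'))
        have a := associator_monoidal C.X M.X M'.X C'.X N.X N'.X
        have h := interHom_ι M M' N N'
        dsimp only [tensor] at h ⊢
        have hl := l_ι (M.tensor N) (M'.tensor N')
        dsimp only [tensor] at hl
        rw [Category.assoc, Category.assoc, Category.assoc, hl, ← MonoidalCategory.whiskerLeft_comp,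
          reassoc_of% h, h, MonoidalCategory.whiskerLeft_comp, tensorμ_wl_assoc,
          MonoidalCategory.comp_whiskerRight, Category.assoc, tensorμ_wr_assoc, a,
          tensorHom_comp_tensorHom_assoc, tensorHom_comp_tensorHom_assoc,
          tensorHom_comp_tensorHom_assoc, l_ι, l_ι]
        simp only [Category.assoc]
      r_comm := by
        apply tcancel (ι (M.tensor N) (M'.tensor N') ▷ (E.X ⊗ E'.X))
        have a := associator_monoidal M.X M'.X E.X N.X N'.X E'.X
        have h := interHom_ι M M' N N'
        have hr := r_ι (M.tensor N) (M'.tensor N')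
        dsimp only [tensor] at h hr ⊢
        rw [Category.assoc, Category.assoc, Category.assoc, hr,
          ← MonoidalCategory.comp_whiskerRight, ← cancel_mono (α_ _ _ _).hom]
        simp only [Category.assoc, Iso.inv_hom_id, Category.comp_id]
        rw [
          reassoc_of% h, h, MonoidalCategory.comp_whiskerRight, Category.assoc, tensorμ_wr_assoc,
          MonoidalCategory.whiskerLeft_comp, tensorμ_wl_assoc, a,
          tensorHom_comp_tensorHom_assoc, tensorHom_comp_tensorHom_assoc,
          tensorHom_comp_tensorHom_assoc, r_ι, r_ι]
        simp only [Category.assoc, Iso.inv_hom_id, Category.comp_id] }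
    (interInv M M' N N')
    (by
      apply tcancel (ι M M' ⊗ₘ ι N N')
      have h := interHom_ι M M' N N'
      dsimp only
      rw [Category.assoc, interInv_ι, reassoc_of% h, tensorμ_tensorδ, Category.comp_id]
      exact (Category.id_comp _).symm)
    (by
      apply tcancel (ι (M.tensor N) (M'.tensor N'))
      have h := interInv_ι M M' N N'
      dsimp only
      rw [Category.assoc, interHom_ι, reassoc_of% h, tensorδ_tensorμ, Category.comp_id,
        Category.id_comp])

end Bicomod
end Interchange

section Lower

variable {V : Type u} [Category.{v} V] [MonoidalCategory V] [BraidedCategory V]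

attribute [local instance] ComonObj.instTensorUnit

/-- The associativity isomorphism as a comonoid map. -/
@[reducible] def CategoryTheory.Comon.assocMap (C D E : Comon V) :
    (C.tens D).tens E ⟶ C.tens (D.tens E) where
  hom := (α_ C.X D.X E.X).hom
  isComonHom_hom :=
    { hom_counit := by
        rw [Comon.tensorObj_counit, Comon.tensorObj_counit, Comon.tensorObj_counit,
          Comon.tensorObj_counit]
        simp [MonoidalCategory.tensorHom_def]
      hom_comul := by
        have a := tensor_associativity C.X C.X D.X D.X E.X E.X
        rw [Comon.tensorObj_comul, Comon.tensorObj_comul, Comon.tensorObj_comul,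
          Comon.tensorObj_comul, Category.assoc]
        calc
          _ = (α_ C.X D.X E.X).hom ≫ (Δ[C.X] ⊗ₘ Δ[D.X] ⊗ₘ Δ[E.X]) ≫
              ((C.X ⊗ C.X) ◁ tensorμ D.X D.X E.X E.X) ≫ tensorμ C.X C.X _ _ := by
            rw [← id_tensorHom, tensorHom_comp_tensorHom_assoc, Category.comp_id]
          _ = ((Δ[C.X] ⊗ₘ Δ[D.X]) ⊗ₘ Δ[E.X]) ≫ (tensorμ C.X C.X D.X D.X ▷ (E.X ⊗ E.X)) ≫
              tensorμ _ _ E.X E.X ≫ ((α_ C.X D.X E.X).hom ⊗ₘ (α_ C.X D.X E.X).hom) := by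
            rw [a, MonoidalCategory.associator_naturality_assoc]
          _ = _ := by rw [← tensorHom_id, tensorHom_comp_tensorHom_assoc, Category.comp_id] }

/-- The inverse of the associativity isomorphism as a comonoid map. -/
@[reducible] def CategoryTheory.Comon.assocInvMap (C D E : Comon V) :
    C.tens (D.tens E) ⟶ (C.tens D).tens E where
  hom := (α_ C.X D.X E.X).inv
  isComonHom_hom :=
    { hom_counit := by
        have h := (Comon.assocMap C D E).isComonHom_hom.hom_counit
        dsimp only [Comon.assocMap] at h
        rw [← h, Iso.inv_hom_id_assoc]
      hom_comul := by
        have h := (Comon.assocMap C D E).isComonHom_hom.hom_comul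
        dsimp only [Comon.assocMap] at h
        rw [Iso.inv_comp_eq, reassoc_of% h]
        simp  }

/-- The right unit isomorphism as a comonoid map. -/
@[reducible] def CategoryTheory.Comon.runitMap (C : Comon V) :
    C.tens (Comon.one V) ⟶ C where
  hom := (ρ_ C.X).hom
  isComonHom_hom :=
    { hom_counit := by
        rw [Comon.tensorObj_counit]
        simp [MonoidalCategory.tensorHom_def, unitors_equal]
      hom_comul := by
        have a := tensor_right_unitality C.X C.X
        rw [Comon.tensorObj_comul, Category.assoc, ← MonoidalCategory.rightUnitor_naturality, a,
          ← Category.assoc, ← Category.assoc, ← MonoidalCategory.tensorHom_def, Category.assoc]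
        rfl }

namespace Bicomod

variable {C D C' D' : Comon V}

/-- The comodule `f_* : C ⇸ D` determined by a comonoid map `f : C ⟶ D`. -/
@[reducible] def lower (f : C ⟶ D) : Bicomod C D where
  X := C.X
  l := Δ[C.X]
  r := Δ[C.X] ≫ C.X ◁ f.hom
  l_counit := by simp
  l_coassoc := by simp
  r_counit := by
    rw [Category.assoc, ← MonoidalCategory.whiskerLeft_comp, IsComonHom.hom_counit]; simp
  r_coassoc := (corestrict (𝟙 C) f (reg C)).r_coassoc
  lr := by
    have h := ComonObj.comul_assoc C.X =≫ C.X ◁ C.X ◁ f.hom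
    simp only [Category.assoc] at h
    rw [Category.assoc, MonoidalCategory.whiskerLeft_comp, h, whisker_exchange_assoc]
    simp

/-- A right coaction turned into a left coaction of the opposite comonoid. -/
theorem turnL {M D : V} (d : D ⟶ D ⊗ D) (r : M ⟶ M ⊗ D)
    (h : r ≫ r ▷ D = r ≫ M ◁ d ≫ (α_ M D D).inv) :
    (r ≫ (β_ M D).hom) ≫ D ◁ (r ≫ (β_ M D).hom) =
      (r ≫ (β_ M D).hom) ≫ (d ≫ (β_ D D).hom) ▷ M ≫ (α_ D D M).hom := by
  have h' := h =≫ ((β_ (M ⊗ D) D).hom ≫ D ◁ (β_ M D).hom)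
  simp only [Category.assoc] at h'
  rw [MonoidalCategory.whiskerLeft_comp, Category.assoc, Category.assoc,
    ← BraidedCategory.braiding_naturality_left_assoc, h',
    ← BraidedCategory.braiding_naturality_right_assoc, BraidedCategory.braiding_tensor_left_hom,
    BraidedCategory.braiding_tensor_right_hom]
  simp

/-- A left coaction turned into a right coaction of the opposite comonoid. -/
theorem turnR {M D : V} (d : D ⟶ D ⊗ D) (l : M ⟶ D ⊗ M)
    (h : l ≫ D ◁ l = l ≫ d ▷ M ≫ (α_ D D M).hom) :
    (l ≫ (β_ D M).hom) ≫ (l ≫ (β_ D M).hom) ▷ D =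
      (l ≫ (β_ D M).hom) ≫ M ◁ (d ≫ (β_ D D).hom) ≫ (α_ M D D).inv := by
  have h' := h =≫ ((β_ D (D ⊗ M)).hom ≫ (β_ D M).hom ▷ D)
  simp only [Category.assoc] at h'
  rw [MonoidalCategory.comp_whiskerRight, Category.assoc, Category.assoc,
    ← BraidedCategory.braiding_naturality_right_assoc, h',
    ← BraidedCategory.braiding_naturality_left_assoc, BraidedCategory.braiding_tensor_left_hom,
    BraidedCategory.braiding_tensor_right_hom]
  simp

/-- A right coaction of the opposite comonoid turned into a left coaction. -/
theorem unturnL {M D : V} (d : D ⟶ D ⊗ D) (r : M ⟶ M ⊗ D)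
    (h : r ≫ r ▷ D = r ≫ M ◁ (d ≫ (β_ D D).hom) ≫ (α_ M D D).inv) :
    (r ≫ (β_ D M).inv) ≫ D ◁ (r ≫ (β_ D M).inv) =
      (r ≫ (β_ D M).inv) ≫ d ▷ M ≫ (α_ D D M).hom := by
  have h' := h =≫ ((β_ D (M ⊗ D)).inv ≫ D ◁ (β_ D M).inv)
  simp only [Category.assoc] at h'
  rw [MonoidalCategory.whiskerLeft_comp, Category.assoc, Category.assoc,
    ← BraidedCategory.braiding_inv_naturality_left_assoc, h',
    ← BraidedCategory.braiding_inv_naturality_right_assoc, 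
    BraidedCategory.braiding_tensor_left_inv, BraidedCategory.braiding_tensor_right_inv]
  simp

/-- Two left coactions which commute give a coaction of the tensor product. -/
theorem pairL_coassoc {C D M : V} [ComonObj C] [ComonObj D] (l : M ⟶ C ⊗ M) (l' : M ⟶ D ⊗ M)
    (h : l ≫ C ◁ l = l ≫ Δ[C] ▷ M ≫ (α_ C C M).hom)
    (h' : l' ≫ D ◁ l' = l' ≫ Δ[D] ▷ M ≫ (α_ D D M).hom)
    (c : l' ≫ D ◁ l = l ≫ C ◁ l' ≫ (α_ C D M).inv ≫ (β_ C D).hom ▷ M ≫ (α_ D C M).hom) :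
    (l ≫ C ◁ l' ≫ (α_ C D M).inv) ≫ (C ⊗ D) ◁ (l ≫ C ◁ l' ≫ (α_ C D M).inv) =
      (l ≫ C ◁ l' ≫ (α_ C D M).inv) ≫ Δ[C ⊗ D] ▷ M ≫ (α_ (C ⊗ D) (C ⊗ D) M).hom := by
  rw [Comon.tensorObj_comul]
  calc
    _ = l ≫ C ◁ (l' ≫ D ◁ l) ≫ C ◁ D ◁ C ◁ l' ⊗≫ 𝟙 _ := by monoidal
    _ = (l ≫ C ◁ l) ≫ C ◁ C ◁ l' ≫ C ◁ ((α_ C D M).inv ≫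
        ((β_ C D).hom ▷ M ≫ (D ⊗ C) ◁ l')) ⊗≫ 𝟙 _ := by rw [c]; monoidal
    _ = l ≫ Δ[C] ▷ M ⊗≫ C ◁ C ◁ (l' ≫ D ◁ l') ⊗≫ C ◁ (β_ C D).hom ▷ D ▷ M ⊗≫ 𝟙 _ := by
      rw [h, ← whisker_exchange]; monoidal
    _ = l ≫ (Δ[C] ▷ M ≫ (C ⊗ C) ◁ l') ⊗≫ C ◁ C ◁ (Δ[D] ▷ M) ⊗≫
        C ◁ (β_ C D).hom ▷ D ▷ M ⊗≫ 𝟙 _ := by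
      rw [h']; monoidal
    _ = l ≫ C ◁ l' ⊗≫ (Δ[C] ▷ D ≫ (C ⊗ C) ◁ Δ[D]) ▷ M ⊗≫
        C ◁ (β_ C D).hom ▷ D ▷ M ⊗≫ 𝟙 _ := by
      rw [← whisker_exchange]; monoidal
    _ = _ := by rw [← MonoidalCategory.tensorHom_def, tensorμ]; monoidal

/-- Two right coactions which commute give a coaction of the tensor product. -/
theorem pairR_coassoc {C D M : V} [ComonObj C] [ComonObj D] (r : M ⟶ M ⊗ C) (r' : M ⟶ M ⊗ D)
    (h : r ≫ r ▷ C = r ≫ M ◁ Δ[C] ≫ (α_ M C C).inv)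
    (h' : r' ≫ r' ▷ D = r' ≫ M ◁ Δ[D] ≫ (α_ M D D).inv)
    (c : r ≫ r' ▷ C = r' ≫ r ▷ D ≫ (α_ M C D).hom ≫ M ◁ (β_ C D).hom ≫ (α_ M D C).inv) :
    (r' ≫ r ▷ D ≫ (α_ M C D).hom) ≫ (r' ≫ r ▷ D ≫ (α_ M C D).hom) ▷ (C ⊗ D) =
      (r' ≫ r ▷ D ≫ (α_ M C D).hom) ≫ M ◁ Δ[C ⊗ D] ≫ (α_ M (C ⊗ D) (C ⊗ D)).inv := by
  rw [Comon.tensorObj_comul]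
  calc
    _ = r' ≫ (r ≫ r' ▷ C) ▷ D ≫ r ▷ D ▷ C ▷ D ⊗≫ 𝟙 _ := by monoidal
    _ = (r' ≫ r' ▷ D) ≫ r ▷ D ▷ D ⊗≫ (M ◁ (β_ C D).hom ≫ r ▷ (D ⊗ C)) ▷ D ⊗≫ 𝟙 _ := by
      rw [c]; monoidal
    _ = r' ≫ M ◁ Δ[D] ⊗≫ (r ≫ r ▷ C) ▷ D ▷ D ⊗≫ M ◁ C ◁ (β_ C D).hom ▷ D ⊗≫ 𝟙 _ := by
      rw [h', whisker_exchange]; monoidal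
    _ = r' ≫ (M ◁ Δ[D] ≫ r ▷ (D ⊗ D)) ⊗≫ M ◁ Δ[C] ▷ D ▷ D ⊗≫
        M ◁ C ◁ (β_ C D).hom ▷ D ⊗≫ 𝟙 _ := by
      rw [h]; monoidal
    _ = r' ≫ r ▷ D ⊗≫ M ◁ (C ◁ Δ[D] ≫ Δ[C] ▷ (D ⊗ D)) ⊗≫
        M ◁ C ◁ (β_ C D).hom ▷ D ⊗≫ 𝟙 _ := by
      rw [whisker_exchange]; monoidal
    _ = _ := by rw [whisker_exchange, ← MonoidalCategory.tensorHom_def, tensorμ]; monoidal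

/-- The counit of the biduality between `C` and `C^o`: the object `C` with left coaction
`(1 ⊗ c) δ₃`. -/
@[reducible] def ev (C : Comon V) : Bicomod (C.tens C.opp) (Comon.one V) where
  X := C.X
  l := Δ[C.X] ≫ C.X ◁ (Δ[C.X] ≫ (β_ C.X C.X).hom) ≫ (α_ C.X C.X C.X).inv
  r := (ρ_ C.X).inv
  l_counit := by
    rw [Comon.tensorObj_counit, Comon.opp_counit]
    calc
      _ = Δ[C.X] ≫ C.X ◁ (Δ[C.X] ≫ (β_ C.X C.X).hom ≫ ε[C.X] ▷ C.X) ⊗≫ ε[C.X] ▷ C.X ⊗≫ 𝟙 _ := by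
        rw [MonoidalCategory.tensorHom_def']; monoidal
      _ = (Δ[C.X] ≫ ε[C.X] ▷ C.X) ⊗≫ 𝟙 _ := by
        rw [← BraidedCategory.braiding_naturality_right, ComonObj.comul_counit_assoc,
          rightUnitor_inv_braiding]
        monoidal
      _ = _ := by rw [ComonObj.counit_comul]; monoidal
  l_coassoc := by
    have h := turnL Δ[C.X] Δ[C.X] (by simp)
    exact @pairL_coassoc _ _ _ _ C.X C.opp.X C.X C.comon C.opp.comon Δ[C.X] _ (by simp) h (by
      rw [Category.assoc, ← BraidedCategory.braiding_naturality_left,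
        BraidedCategory.braiding_tensor_left_hom]
      simp)
  r_counit := by
    change (ρ_ C.X).inv ≫ C.X ◁ 𝟙 (𝟙_ V) = _
    simp
  r_coassoc := by
    change (ρ_ C.X).inv ≫ (ρ_ C.X).inv ▷ 𝟙_ V =
      (ρ_ C.X).inv ≫ C.X ◁ (λ_ (𝟙_ V)).inv ≫ (α_ C.X (𝟙_ V) (𝟙_ V)).inv
    monoidal
  lr := by simp

/-- The unit of the biduality between `C` and `C^o`: the object `C` with right coaction
`(c ⊗ 1) δ₃`. -/
@[reducible] def coev (C : Comon V) : Bicomod (Comon.one V) (C.opp.tens C) where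
  X := C.X
  l := (λ_ C.X).inv
  r := Δ[C.X] ≫ (Δ[C.X] ≫ (β_ C.X C.X).hom) ▷ C.X ≫ (α_ C.X C.X C.X).hom
  l_counit := by
    change (λ_ C.X).inv ≫ 𝟙 (𝟙_ V) ▷ C.X = _
    simp
  l_coassoc := by
    change (λ_ C.X).inv ≫ 𝟙_ V ◁ (λ_ C.X).inv =
      (λ_ C.X).inv ≫ (λ_ (𝟙_ V)).inv ▷ C.X ≫ (α_ (𝟙_ V) (𝟙_ V) C.X).hom
    monoidal
  r_counit := by
    rw [Comon.tensorObj_counit, Comon.opp_counit]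
    calc
      _ = Δ[C.X] ≫ (Δ[C.X] ≫ (β_ C.X C.X).hom ≫ C.X ◁ ε[C.X]) ▷ C.X ⊗≫ C.X ◁ ε[C.X] ⊗≫ 𝟙 _ := by
        rw [MonoidalCategory.tensorHom_def]; monoidal
      _ = (Δ[C.X] ≫ C.X ◁ ε[C.X]) ⊗≫ 𝟙 _ := by
        rw [← BraidedCategory.braiding_naturality_left, ComonObj.counit_comul_assoc,
          leftUnitor_inv_braiding]
        monoidal
      _ = _ := by rw [ComonObj.comul_counit]; monoidal
  r_coassoc := by
    have h := turnR Δ[C.X] Δ[C.X] (by simp)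
    exact @pairR_coassoc _ _ _ _ C.opp.X C.X C.X C.opp.comon C.comon _ Δ[C.X] h (by simp) (by
      rw [Category.assoc, ← BraidedCategory.braiding_naturality_right,
        BraidedCategory.braiding_tensor_right_hom]
      simp)
  lr := by simp

end Bicomod
end Lower

section Cells

variable {V : Type u} [Category.{v} V] [MonoidalCategory V] [BraidedCategory V]

namespace Bicomod

variable {C D C' D' : Comon V}

/-- A map between comodules over different comonoids, compatible with the coactions along comonoid
maps. -/
structure Cell (g : C ⟶ C') (h : D ⟶ D') (M : Bicomod C D) (M' : Bicomod C' D') where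
  hom : M.X ⟶ M'.X
  l_comm : hom ≫ M'.l = M.l ≫ (g.hom ⊗ₘ hom)
  r_comm : hom ≫ M'.r = M.r ≫ (hom ⊗ₘ h.hom)

/-- The tensor product of cells. -/
@[reducible] def Cell.tensor {C₁ D₁ C₁' D₁' : Comon V} {g : C ⟶ C'} {h : D ⟶ D'} {g₁ : C₁ ⟶ C₁'}
    {h₁ : D₁ ⟶ D₁'} {M : Bicomod C D} {M' : Bicomod C' D'} {N : Bicomod C₁ D₁} {N' : Bicomod C₁' D₁'}
    (u : Cell g h M M') (u₁ : Cell g₁ h₁ N N') :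
    Cell (Comon.tensMap g g₁) (Comon.tensMap h h₁) (M.tensor N) (M'.tensor N') where
  hom := u.hom ⊗ₘ u₁.hom
  l_comm := by
    have h := tensorμ_natural g.hom u.hom g₁.hom u₁.hom
    dsimp only [Bicomod.tensor]
    rw [tensorHom_comp_tensorHom_assoc, u.l_comm, u₁.l_comm, ← tensorHom_comp_tensorHom,
      Category.assoc, h, Category.assoc]
  r_comm := by
    have h := tensorμ_natural u.hom h.hom u₁.hom h₁.hom
    dsimp only [Bicomod.tensor]
    rw [tensorHom_comp_tensorHom_assoc, u.r_comm, u₁.r_comm, ← tensorHom_comp_tensorHom,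
      Category.assoc, h, Category.assoc]

/-- A comonoid map is a cell between identity 1-cells. -/
@[reducible] def Cell.reg (f : C ⟶ D) : Cell f f (reg C) (reg D) where
  hom := f.hom
  l_comm := IsComonHom.hom_comul f.hom
  r_comm := IsComonHom.hom_comul f.hom

/-- Corestriction of cells. -/
@[reducible] def Cell.corestrict {C₁ D₁ C₁' D₁' : Comon V} {g : C ⟶ C'} {h : D ⟶ D'}
    {M : Bicomod C D} {M' : Bicomod C' D'} (u : Cell g h M M') (k : C ⟶ C₁) (k' : C' ⟶ C₁')
    (m : D ⟶ D₁) (m' : D' ⟶ D₁') (g₁ : C₁ ⟶ C₁') (h₁ : D₁ ⟶ D₁')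
    (e : g.hom ≫ k'.hom = k.hom ≫ g₁.hom) (e' : h.hom ≫ m'.hom = m.hom ≫ h₁.hom) :
    Cell g₁ h₁ (M.corestrict k m) (M'.corestrict k' m') where
  hom := u.hom
  l_comm := by
    dsimp only [Bicomod.corestrict]
    rw [reassoc_of% u.l_comm, Category.assoc, ← tensorHom_id, ← tensorHom_id,
      tensorHom_comp_tensorHom, tensorHom_comp_tensorHom, e, Category.comp_id, Category.id_comp]
  r_comm := by
    dsimp only [Bicomod.corestrict]
    rw [reassoc_of% u.r_comm, Category.assoc, ← id_tensorHom, ← id_tensorHom,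
      tensorHom_comp_tensorHom, tensorHom_comp_tensorHom, e', Category.comp_id, Category.id_comp]

/-- A comonoid map as a cell between the counits of the biduality. -/
@[reducible] def Cell.ev (f : C ⟶ D) :
    Cell (Comon.tensMap f (Comon.oppMap f)) (𝟙 (Comon.one V)) (ev C) (ev D) where
  hom := f.hom
  l_comm := by
    have e := IsComonHom.hom_comul f.hom
    have e' : f.hom ≫ Δ[D.X] ≫ (β_ D.X D.X).hom = Δ[C.X] ≫ (β_ C.X C.X).hom ≫ (f.hom ⊗ₘ f.hom) := by
      rw [reassoc_of% e, BraidedCategory.braiding_naturality]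
    dsimp only [Bicomod.ev]
    rw [reassoc_of% e, ← id_tensorHom, tensorHom_comp_tensorHom_assoc, e', Category.comp_id,
      Category.assoc, Category.assoc, ← associator_inv_naturality, ← id_tensorHom,
      tensorHom_comp_tensorHom_assoc, Category.id_comp, Category.assoc]
  r_comm := by
    dsimp only [Bicomod.ev]
    simp

/-- A comonoid map as a cell between the units of the biduality. -/
@[reducible] def Cell.coev (f : C ⟶ D) :
    Cell (𝟙 (Comon.one V)) (Comon.tensMap (Comon.oppMap f) f) (coev C) (coev D) where
  hom := f.hom
  l_comm := by
    dsimp only [Bicomod.coev]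
    simp
  r_comm := by
    have e := IsComonHom.hom_comul f.hom
    have e' : f.hom ≫ Δ[D.X] ≫ (β_ D.X D.X).hom = Δ[C.X] ≫ (β_ C.X C.X).hom ≫ (f.hom ⊗ₘ f.hom) := by
      rw [reassoc_of% e, BraidedCategory.braiding_naturality]
    dsimp only [Bicomod.coev]
    rw [reassoc_of% e, ← tensorHom_id, tensorHom_comp_tensorHom_assoc, e', Category.comp_id,
      Category.assoc, Category.assoc, ← MonoidalCategory.associator_naturality, ← tensorHom_id,
      tensorHom_comp_tensorHom_assoc, Category.id_comp, Category.assoc]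

variable [CoreflexiveTensor V]

/-- The canonical map `M ⊗_D D ⟶ M`, for `D` with right coaction along `h`. -/
def collapse (M : Bicomod C D) (h : D ⟶ D') : (comp M (lower h)).X ⟶ M.X :=
  ι M (lower h) ≫ M.X ◁ ε[D.X] ≫ (ρ_ M.X).hom

theorem collapse_l (M : Bicomod C D) (h : D ⟶ D') :
    collapse M h ≫ M.l = (comp M (lower h)).l ≫ C.X ◁ collapse M h := by
  calc
    _ = ι M (lower h) ≫ (M.X ◁ ε[D.X] ≫ M.l ▷ 𝟙_ V) ⊗≫ 𝟙 _ := by rw [collapse]; monoidal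
    _ = (ι M (lower h) ≫ M.l ▷ (lower h).X ≫ (α_ _ _ _).hom) ≫ C.X ◁ (M.X ◁ ε[D.X]) ⊗≫ 𝟙 _ := by
      rw [whisker_exchange]; monoidal
    _ = (comp M (lower h)).l ≫ C.X ◁ (ι M (lower h) ≫ M.X ◁ ε[D.X]) ⊗≫ 𝟙 _ := by
      rw [← l_ι]; monoidal
    _ = _ := by rw [collapse]; monoidal

theorem collapse_coaction (M : Bicomod C D) (h : D ⟶ D') :
    collapse M h ≫ M.r = ι M (lower h) := by
  have i := ι_cond M (lower h)
  calc
    _ = ι M (lower h) ≫ (M.X ◁ ε[D.X] ≫ M.r ▷ 𝟙_ V) ⊗≫ 𝟙 _ := by rw [collapse]; monoidal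
    _ = (ι M (lower h) ≫ M.r ▷ (lower h).X ≫ (α_ _ _ _).hom) ≫ M.X ◁ (D.X ◁ ε[D.X]) ⊗≫ 𝟙 _ := by
      rw [whisker_exchange]; monoidal
    _ = ι M (lower h) ≫ M.X ◁ (Δ[D.X] ≫ D.X ◁ ε[D.X]) ⊗≫ 𝟙 _ := by
      rw [← i]; monoidal
    _ = _ := by rw [ComonObj.comul_counit]; monoidal

theorem collapse_r (M : Bicomod C D) (h : D ⟶ D') :
    (comp M (lower h)).r ≫ collapse M h ▷ D'.X = ι M (lower h) ≫ M.X ◁ h.hom := by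
  calc
    _ = ((comp M (lower h)).r ≫ ι M (lower h) ▷ D'.X) ≫ (M.X ◁ ε[D.X]) ▷ D'.X ⊗≫ 𝟙 _ := by
      rw [collapse]; monoidal
    _ = ι M (lower h) ≫ M.X ◁ (Δ[D.X] ≫ (D.X ◁ h.hom ≫ ε[D.X] ▷ D'.X)) ⊗≫ 𝟙 _ := by
      rw [r_ι]; monoidal
    _ = ι M (lower h) ≫ M.X ◁ ((Δ[D.X] ≫ ε[D.X] ▷ D.X) ≫ 𝟙_ V ◁ h.hom) ⊗≫ 𝟙 _ := by
      rw [whisker_exchange]; monoidal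
    _ = _ := by rw [ComonObj.counit_comul]; monoidal

/-- A cell over an identity as a 2-cell `h_* ∘ M ⇒ M'`. -/
def Cell.push {h : D ⟶ D'} {M : Bicomod C D} {M' : Bicomod C D'} (u : Cell (𝟙 C) h M M') :
    comp M (lower h) ⟶ M' where
  hom := collapse M h ≫ u.hom
  l_comm := by
    rw [Category.assoc, u.l_comm, ← Category.assoc, collapse_l]
    simp
  r_comm := by
    have e := collapse_coaction M h
    rw [Category.assoc, u.r_comm, reassoc_of% e, MonoidalCategory.comp_whiskerRight,
      ← Category.assoc, collapse_r, MonoidalCategory.tensorHom_def', Category.assoc]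

/-- The map underlying `Cell.pull`. -/
def Cell.pullHom {g : C ⟶ C'} {h : D ⟶ D'} {M : Bicomod C D} {M' : Bicomod C' D'}
    (u : Cell g h M M') : M.X ⟶ (comp (lower g) M').X :=
  lift (M := lower g) (N := M') (M.l ≫ C.X ◁ u.hom) (by
    have e := u.l_comm
    dsimp only [lower]
    calc
      _ = M.l ≫ (C.X ◁ u.hom ≫ Δ[C.X] ▷ M'.X) ≫ (C.X ◁ g.hom) ▷ M'.X ⊗≫ 𝟙 _ := by monoidal
      _ = (M.l ≫ Δ[C.X] ▷ M.X ≫ (α_ _ _ _).hom) ≫ C.X ◁ (C.X ◁ u.hom ≫ g.hom ▷ M'.X) := by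
        rw [whisker_exchange]; monoidal
      _ = M.l ≫ C.X ◁ (M.l ≫ (g.hom ⊗ₘ u.hom)) := by
        rw [← l_coassoc, ← MonoidalCategory.tensorHom_def']; monoidal
      _ = _ := by rw [← e]; monoidal)

theorem Cell.pullHom_ι {g : C ⟶ C'} {h : D ⟶ D'} {M : Bicomod C D} {M' : Bicomod C' D'}
    (u : Cell g h M M') : u.pullHom ≫ ι (lower g) M' = M.l ≫ C.X ◁ u.hom := lift_ι _ _

/-- A cell over `g` as a cell into the composite with `g_*`. -/
def Cell.pull {g : C ⟶ C'} {h : D ⟶ D'} {M : Bicomod C D} {M' : Bicomod C' D'}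
    (u : Cell g h M M') : Cell (𝟙 C) h M (comp (lower g) M') where
  hom := u.pullHom
  l_comm := by
    apply tcancel (C.X ◁ ι (lower g) M')
    have e := u.pullHom_ι
    calc
      _ = u.pullHom ≫ ι (lower g) M' ≫ Δ[C.X] ▷ M'.X ≫ (α_ _ _ _).hom := by
        rw [Category.assoc, l_ι]
      _ = M.l ≫ (C.X ◁ u.hom ≫ Δ[C.X] ▷ M'.X) ≫ (α_ _ _ _).hom := by
        rw [reassoc_of% e]; monoidal
      _ = (M.l ≫ Δ[C.X] ▷ M.X ≫ (α_ _ _ _).hom) ≫ C.X ◁ C.X ◁ u.hom := by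
        rw [whisker_exchange]; monoidal
      _ = M.l ≫ C.X ◁ (M.l ≫ C.X ◁ u.hom) := by rw [← l_coassoc]; monoidal
      _ = _ := by rw [← e]; simp
  r_comm := by
    apply tcancel (ι (lower g) M' ▷ D'.X)
    have e := u.pullHom_ι
    calc
      _ = u.pullHom ≫ ι (lower g) M' ≫ C.X ◁ M'.r ≫ (α_ _ _ _).inv := by
        rw [Category.assoc, r_ι]
      _ = M.l ≫ C.X ◁ (u.hom ≫ M'.r) ≫ (α_ _ _ _).inv := by
        rw [reassoc_of% e]; monoidal
      _ = (M.l ≫ C.X ◁ M.r) ≫ C.X ◁ (M.X ◁ h.hom ≫ u.hom ▷ D'.X) ≫ (α_ _ _ _).inv := by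
        rw [u.r_comm, MonoidalCategory.tensorHom_def']; monoidal
      _ = M.r ≫ (M.l ▷ D.X ≫ (C.X ⊗ M.X) ◁ h.hom) ≫ (C.X ◁ u.hom) ▷ D'.X := by
        rw [← lr]; monoidal
      _ = M.r ≫ M.X ◁ h.hom ≫ (M.l ≫ C.X ◁ u.hom) ▷ D'.X := by
        rw [← whisker_exchange]; monoidal
      _ = _ := by rw [← e, MonoidalCategory.tensorHom_def']; simp

/-- The 2-cell `h_* ∘ M ⇒ M' ∘ g_*` determined by a cell. -/
def Cell.mate {g : C ⟶ C'} {h : D ⟶ D'} {M : Bicomod C D} {M' : Bicomod C' D'}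
    (u : Cell g h M M') : comp M (lower h) ⟶ comp (lower g) M' := u.pull.push

end Bicomod
end Cells

section Monoidale

variable {V : Type u} [Category.{v} V] [MonoidalCategory V] [BraidedCategory V]

namespace Bicomod

/-- The comonoid `C^o ⊗ C`. -/
@[reducible] def env (C : Comon V) : Comon V := C.opp.tens C

/-- The associativity isomorphism `(C^o ⊗ (C ⊗ C^o)) ⊗ C ≅ (C^o ⊗ C) ⊗ (C^o ⊗ C)`. -/
@[reducible] def mid (C : Comon V) :
    (C.opp.tens (C.tens C.opp)).tens C ⟶ (env C).tens (env C) :=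
  Comon.tensMap (Comon.assocInvMap C.opp C C.opp) (𝟙 C) ≫ Comon.assocMap (C.opp.tens C) C.opp C

/-- The multiplication `p = 1 ⊗ e ⊗ 1` of the monoidale `C^o ⊗ C`. -/
@[reducible] def mul (C : Comon V) : Bicomod ((env C).tens (env C)) (env C) :=
  (((reg C.opp).tensor (ev C)).tensor (reg C)).corestrict (mid C)
    (Comon.tensMap (Comon.runitMap C.opp) (𝟙 C))

/-- The unit `j` of the monoidale `C^o ⊗ C`. -/
@[reducible] def one (C : Comon V) : Bicomod (Comon.one V) (env C) := coev C

variable {C D : Comon V} 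

/-- The comonoid map `f^o ⊗ f`. -/
@[reducible] def envMap (f : C ⟶ D) : env C ⟶ env D := Comon.tensMap (Comon.oppMap f) f

/-- The map `f ⊗ f ⊗ f` as a cell between the multiplications. -/
def mulCell (f : C ⟶ D) :
    Cell (Comon.tensMap (envMap f) (envMap f)) (envMap f) (mul C) (mul D) :=
  (((Cell.reg (Comon.oppMap f)).tensor (Cell.ev f)).tensor (Cell.reg f)).corestrict _ _ _ _ _ _
    (by
      simp only [Comon.comp_hom', Comon.id_hom']
      rw [tensorHom_comp_tensorHom_assoc, associator_inv_naturality, Category.comp_id,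
        Category.assoc, ← MonoidalCategory.associator_naturality, tensorHom_comp_tensorHom_assoc,
        Category.id_comp])
    (by
      simp only [Comon.id_hom']
      rw [tensorHom_comp_tensorHom, tensorHom_comp_tensorHom, Category.comp_id, Category.id_comp,
        tensorHom_id, MonoidalCategory.rightUnitor_naturality])

/-- The 1-cell `f^{*o} ⊗ f_* : C^o ⊗ C ⇸ D^o ⊗ D`. The dual `f^{*o}` of the comodule `f^*` from `D`
to `C` (the object `C` with left coaction along `f`) is the comodule `(f^o)_*` from `C^o` to `D^o`. -/
@[reducible] def base (f : C ⟶ D) : Bicomod (env C) (env D) :=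
  (lower (Comon.oppMap f)).tensor (lower f)

/-- The tensor product of `f_*` and `g_*` is `(f ⊗ g)_*`. -/
@[reducible] def lowerTens {C D C' D' : Comon V} (f : C ⟶ C') (g : D ⟶ D') :
    (lower f).tensor (lower g) ≅ lower (Comon.tensMap f g) :=
  isoMk { hom := 𝟙 (C.X ⊗ D.X)
          l_comm := by
            dsimp only [tensor, lower]
            rw [Comon.tensorObj_comul, MonoidalCategory.whiskerLeft_id, Category.id_comp,
              Category.comp_id]
          r_comm := by
            dsimp only [tensor, lower]
            rw [Comon.tensorObj_comul, MonoidalCategory.id_whiskerRight, Category.id_comp,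
              Category.comp_id, ← tensorHom_comp_tensorHom, Category.assoc, Category.assoc,
              tensorμ_wl] }
    (𝟙 (C.X ⊗ D.X)) (Category.comp_id _) (Category.comp_id _)

variable [CoreflexiveTensor V] (f : C ⟶ D)

/-- The 2-cell `ω₂ : (f^{*o} ⊗ f_*) p ⇒ p (f^{*o} ⊗ f_* ⊗ f^{*o} ⊗ f_*)`. Tensored with identities on
the outer factors, it is the unit of the adjunction between `f_*` and `f^*`, transposed along the
biduality of `C` and `C^o`; on carriers it is induced by `f ⊗ f ⊗ f`. -/
def omega₂ : comp (mul C) (base f) ⟶ comp ((base f).tensor (base f)) (mul D) :=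
  wl (mul C) (lowerTens (Comon.oppMap f) f).hom ≫ (mulCell f).mate ≫
    wr ((lowerTens (envMap f) (envMap f)).inv ≫
      tensorMap (lowerTens (Comon.oppMap f) f).inv (lowerTens (Comon.oppMap f) f).inv) (mul D)

/-- The 2-cell `ω₀ : (f^{*o} ⊗ f_*) j ⇒ j`, the transpose of the counit of the adjunction between
`f_*` and `f^*`; on carriers it is induced by `f`. -/
def omega₀ : comp (one C) (base f) ⟶ one D :=
  wl (one C) (lowerTens (Comon.oppMap f) f).hom ≫ (Cell.coev f).push

end Bicomod
end Monoidale

section Quantum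

variable {V : Type u} [Category.{v} V] [MonoidalCategory V] [BraidedCategory V]
  [CoreflexiveTensor V]

open Bicomod

namespace Bicomod

variable {C D : Comon V}

/-- The structure 2-cells of a comonad. -/
structure ComonadData (A : Bicomod C C) where
  comul : A ⟶ comp A A
  counit : A ⟶ reg C

/-- The comonad axioms. -/
structure ComonadData.IsComonad {A : Bicomod C C} (d : ComonadData A) : Prop where
  coassoc : d.comul ≫ wr d.comul A ≫ (assoc A A A).hom = d.comul ≫ wl A d.comul
  counit_comul : d.comul ≫ wr d.counit A ≫ (lunit A).hom = 𝟙 A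
  comul_counit : d.comul ≫ wl A d.counit ≫ (runit A).hom = 𝟙 A

/-- The identity comonad. -/
def ComonadData.id (C : Comon V) : ComonadData (reg C) where
  comul := (lunit (reg C)).inv
  counit := 𝟙 _

/-- The tensor product of comonads. -/
def ComonadData.tensor {A : Bicomod C C} {B : Bicomod D D} (d : ComonadData A)
    (d' : ComonadData B) : ComonadData (A.tensor B) where
  comul := tensorMap d.comul d'.comul ≫ (inter A A B B).hom
  counit := tensorMap d.counit d'.counit ≫ (unitIso C D).hom

/-- The pair `(k, κ)` is a map from the comonad `G` on `C` to the comonad `G'` on `D`: the 2-cell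
`κ : k ∘ G ⇒ G' ∘ k` is compatible with the comultiplications and the counits. Composites of 1-cells
are written in diagrammatic order, so that `comp G k` is `k ∘ G`. -/
structure IsComonadMap {G : Bicomod C C} {G' : Bicomod D D} (d : ComonadData G)
    (d' : ComonadData G') (k : Bicomod C D) (κ : comp G k ⟶ comp k G') : Prop where
  comul : wr d.comul k ≫ (assoc G G k).hom ≫ wl G κ ≫ (assoc G k G').inv ≫ wr κ G' ≫
    (assoc k G' G').hom = κ ≫ wl k d'.comul
  counit : wr d.counit k ≫ (lunit k).hom = κ ≫ wl k d'.counit ≫ (runit k).hom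

/-- The map `M ⊗_D N ⟶ N` determined by a map `M ⟶ I`. -/
def dropLeft {E : Comon V} (M : Bicomod C D) (N : Bicomod D E) (q : M.X ⟶ 𝟙_ V) :
    (comp M N).X ⟶ N.X := ι M N ≫ q ▷ N.X ≫ (λ_ N.X).hom

/-- The map `M ⊗_D N ⟶ M` determined by a map `N ⟶ I`. -/
def dropRight {E : Comon V} (M : Bicomod C D) (N : Bicomod D E) (q : N.X ⟶ 𝟙_ V) :
    (comp M N).X ⟶ M.X := ι M N ≫ M.X ◁ q ≫ (ρ_ M.X).hom

/-- The map `ε ⊗ ε ⊗ ε : p ⟶ I`. -/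
def mulCounit (C : Comon V) : (mul C).X ⟶ 𝟙_ V := ε[((C.opp.tens C).tens C).X]

/-- The map `(M ⊗ M') ≫ p ⟶ (k ⊗ k') ≫ (p ≫ A)` obtained from maps `M ⟶ k ≫ A` and `M' ⟶ k' ≫ A`
and from `μ₂`. -/
def pasteMul {A : Bicomod (env C) (env C)} (μ₂ : comp (A.tensor A) (mul C) ⟶ comp (mul C) A)
    {D' : Comon V} {M k : Bicomod D (env C)} {M' k' : Bicomod D' (env C)} (u : M ⟶ comp k A)
    (u' : M' ⟶ comp k' A) :
    comp (M.tensor M') (mul C) ⟶ comp (k.tensor k') (comp (mul C) A) :=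
  wr (tensorMap u u' ≫ (inter k A k' A).hom) (mul C) ≫
    (assoc (k.tensor k') (A.tensor A) (mul C)).hom ≫ wl (k.tensor k') μ₂

end Bicomod

variable (V) in
/-- A quantum graph: a comonoid `C` together with a comonad `A` on `C^o ⊗ C` in the bicategory of
comonoids and comodules. -/
structure QuantumGraph where
  C : Comon V
  A : Bicomod (env C) (env C)
  str : ComonadData A
  isComonad : str.IsComonad

variable (V) in
/-- A quantum category: a quantum graph `(C, A)` whose comonad `A` is a monoidal comonad on the
monoidale `C^o ⊗ C`, whose multiplication is `p = mul C` and whose unit is `j = one C`.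

The 2-cells `μ₂ : p ∘ (A ⊗ A) ⇒ A ∘ p` and `μ₀ : j ⇒ A ∘ j` make `A` a monoidal morphism, and
the comultiplication and the counit of `A` are monoidal 2-cells. The latter two conditions are the
comonad map conditions `μ₂_map` and `μ₀_map`.

The axioms of a monoidal morphism are equations between 2-cells into composites `k ≫ (p ≫ A)` with
`k` one of `j ⊗ 1`, `1 ⊗ j`, `p ⊗ 1`, `1 ⊗ p`. The carriers of `k` and of `p` are recovered from
their left coactions (the map `K ⟶ D ⊗ K ⟶ D` got from the left coaction and the counits is a
split monomorphism), so a map into `k ≫ (p ≫ A)` that respects the left coactions is determined by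
the map into `A` obtained by applying the counits to `k` and to `p`. The equations are stated for
these maps into `A`. The coherence isomorphisms of the monoidale act on the sources by identifying
elements with the same image in `A`, respectively in `A ⊗ A ⊗ A`. -/
structure QuantumCategory extends QuantumGraph V where
  /-- The 2-cell `μ₂ : p ∘ (A ⊗ A) ⇒ A ∘ p`. -/
  μ₂ : comp (A.tensor A) (mul C) ⟶ comp (mul C) A
  /-- The 2-cell `μ₀ : j ⇒ A ∘ j`. -/
  μ₀ : one C ⟶ comp (one C) A
  /-- The comultiplication and the counit of `A` are compatible with `μ₂`. -/
  μ₂_map : IsComonadMap (str.tensor str) str (mul C) μ₂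
  /-- The comultiplication and the counit of `A` are compatible with `μ₀`. -/
  μ₀_map : IsComonadMap (ComonadData.id (Comon.one V)) str (one C) ((lunit (one C)).hom ≫ μ₀)
  /-- Multiplying with the unit on the left is the canonical isomorphism
  `(j ⊗ A) ≫ p ≅ A`. -/
  left_unit : (pasteMul μ₂ μ₀ (lunit A).inv).hom ≫
      dropLeft ((one C).tensor (reg (env C))) (comp (mul C) A) ε[(C.tens (env C)).X] ≫
        dropLeft (mul C) A (mulCounit C) =
    dropRight ((one C).tensor A) (mul C) (mulCounit C) ≫ ε[C.X] ▷ A.X ≫ (λ_ A.X).hom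
  /-- Multiplying with the unit on the right is the canonical isomorphism
  `(A ⊗ j) ≫ p ≅ A`. -/
  right_unit : (pasteMul μ₂ (lunit A).inv μ₀).hom ≫
      dropLeft ((reg (env C)).tensor (one C)) (comp (mul C) A) ε[((env C).tens C).X] ≫
        dropLeft (mul C) A (mulCounit C) =
    dropRight (A.tensor (one C)) (mul C) (mulCounit C) ≫ A.X ◁ ε[C.X] ≫ (ρ_ A.X).hom
  /-- The two ways of multiplying three factors agree on elements `x` of
  `(((A ⊗ A) ≫ p) ⊗ A) ≫ p` and `y` of `(A ⊗ ((A ⊗ A) ≫ p)) ≫ p` that correspond to each other,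
  that is, have the same image in `A ⊗ A ⊗ A`. -/
  associativity : ∀ (T : V) (x : T ⟶ (comp ((comp (A.tensor A) (mul C)).tensor A) (mul C)).X)
    (y : T ⟶ (comp (A.tensor (comp (A.tensor A) (mul C))) (mul C)).X),
    x ≫ dropRight _ (mul C) (mulCounit C) ≫
        dropRight (A.tensor A) (mul C) (mulCounit C) ▷ A.X ≫ (α_ A.X A.X A.X).hom =
      y ≫ dropRight _ (mul C) (mulCounit C) ≫
        A.X ◁ dropRight (A.tensor A) (mul C) (mulCounit C) →
    x ≫ (pasteMul μ₂ μ₂ (lunit A).inv).hom ≫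
        dropLeft ((mul C).tensor (reg (env C))) (comp (mul C) A)
          ((mulCounit C ⊗ₘ ε[(env C).X]) ≫ (λ_ (𝟙_ V)).hom) ≫
        dropLeft (mul C) A (mulCounit C) =
      y ≫ (pasteMul μ₂ (lunit A).inv μ₂).hom ≫
        dropLeft ((reg (env C)).tensor (mul C)) (comp (mul C) A)
          ((ε[(env C).X] ⊗ₘ mulCounit C) ≫ (λ_ (𝟙_ V)).hom) ≫
        dropLeft (mul C) A (mulCounit C)

/-- A quantum functor from `(C, A)` to `(C', A')`: an opmorphism of monoidal comonads of the form
`(f^{*o} ⊗ f_*, σ)`, where the opmonoidal structure of `f^{*o} ⊗ f_*` is given by `omega₂ f` and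
`omega₀ f`. Thus `f` is a comonoid map, `(f^{*o} ⊗ f_*, σ)` is a comonad map, and `σ` satisfies the
two pasting equations of a square between (op)monoidal morphisms. -/
structure QuantumFunctor (X Y : QuantumCategory V) where
  /-- The comonoid map on objects. -/
  f : X.C ⟶ Y.C
  /-- The 2-cell `(f^{*o} ⊗ f_*) ∘ A ⇒ A' ∘ (f^{*o} ⊗ f_*)`. -/
  σ : comp X.A (base f) ⟶ comp (base f) Y.A
  comonadMap : IsComonadMap X.str Y.str (base f) σ
  square₂ : (assoc (X.A.tensor X.A) (mul X.C) (base f)).hom ≫ wl (X.A.tensor X.A) (omega₂ f) ≫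
      (assoc (X.A.tensor X.A) ((base f).tensor (base f)) (mul Y.C)).inv ≫
      wr ((inter X.A (base f) X.A (base f)).inv ≫ tensorMap σ σ ≫
        (inter (base f) Y.A (base f) Y.A).hom) (mul Y.C) ≫
      (assoc ((base f).tensor (base f)) (Y.A.tensor Y.A) (mul Y.C)).hom ≫
      wl ((base f).tensor (base f)) Y.μ₂ =
    wr X.μ₂ (base f) ≫ (assoc (mul X.C) X.A (base f)).hom ≫ wl (mul X.C) σ ≫
      (assoc (mul X.C) (base f) Y.A).inv ≫ wr (omega₂ f) Y.A ≫
      (assoc ((base f).tensor (base f)) (mul Y.C) Y.A).hom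
  square₀ : wr X.μ₀ (base f) ≫ (assoc (one X.C) X.A (base f)).hom ≫ wl (one X.C) σ ≫
      (assoc (one X.C) (base f) Y.A).inv ≫ wr (omega₀ f) Y.A = omega₀ f ≫ Y.μ₀

end Quantum

section Projections

variable {V : Type u} [Category.{v} V] [MonoidalCategory V] [BraidedCategory V]

attribute [local instance] ComonObj.instTensorUnit

/-- The left unit isomorphism as a comonoid map. -/
@[reducible] def CategoryTheory.Comon.lunitMap (C : Comon V) :
    (Comon.one V).tens C ⟶ C where
  hom := (λ_ C.X).hom
  isComonHom_hom :=
    { hom_counit := by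
        rw [Comon.tensorObj_counit]
        simp [MonoidalCategory.tensorHom_def]
      hom_comul := by
        have a := tensor_left_unitality C.X C.X
        rw [Comon.tensorObj_comul, Category.assoc, ← MonoidalCategory.leftUnitor_naturality, a,
          ← Category.assoc, ← Category.assoc, ← MonoidalCategory.tensorHom_def', Category.assoc]
        rfl }

/-- The counit as a comonoid map. -/
@[reducible] def CategoryTheory.Comon.counitMap (C : Comon V) : C ⟶ Comon.one V where
  hom := ε[C.X]
  isComonHom_hom :=
    { hom_counit := by
        change ε[C.X] ≫ 𝟙 (𝟙_ V) = _
        simp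
      hom_comul := by
        change ε[C.X] ≫ (λ_ (𝟙_ V)).inv = _
        rw [MonoidalCategory.tensorHom_def, ComonObj.counit_comul_assoc]
        simp }

/-- The first projection `C ⊗ D ⟶ C`. -/
@[reducible] def CategoryTheory.Comon.fst (C D : Comon V) : C.tens D ⟶ C where
  hom := C.X ◁ ε[D.X] ≫ (ρ_ C.X).hom
  isComonHom_hom := by
    have h := (Comon.tensMap (𝟙 C) D.counitMap ≫ C.runitMap).isComonHom_hom
    simpa only [Comon.comp_hom', Comon.id_hom', id_tensorHom] using h

/-- The second projection `C ⊗ D ⟶ D`. -/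
@[reducible] def CategoryTheory.Comon.snd (C D : Comon V) : C.tens D ⟶ D where
  hom := ε[C.X] ▷ D.X ≫ (λ_ D.X).hom
  isComonHom_hom := by
    have h := (Comon.tensMap C.counitMap (𝟙 D) ≫ D.lunitMap).isComonHom_hom
    simpa only [Comon.comp_hom', Comon.id_hom', tensorHom_id] using h

theorem CategoryTheory.Comon.comul_fst_snd (C D : Comon V) :
    Δ[(C.tens D).X] ≫ ((C.fst D).hom ⊗ₘ (C.snd D).hom) = 𝟙 _ := by
  have h := tensorμ_natural (𝟙 C.X) ε[C.X] ε[D.X] (𝟙 D.X)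
  rw [Comon.tensorObj_comul, ← tensorHom_comp_tensorHom, Category.assoc, ← id_tensorHom,
    ← tensorHom_id, ← reassoc_of% h, tensorHom_comp_tensorHom_assoc, id_tensorHom, tensorHom_id,
    ComonObj.comul_counit, ComonObj.counit_comul, tensorμ, braiding_tensorUnit_left]
  monoidal

theorem CategoryTheory.Comon.comul_snd_fst (C D : Comon V) :
    Δ[(C.tens D).X] ≫ ((C.snd D).hom ⊗ₘ (C.fst D).hom) = (β_ C.X D.X).hom := by
  have h := tensorμ_natural ε[C.X] (𝟙 C.X) (𝟙 D.X) ε[D.X]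
  rw [Comon.tensorObj_comul, ← tensorHom_comp_tensorHom, Category.assoc, ← id_tensorHom,
    ← tensorHom_id, ← reassoc_of% h, tensorHom_comp_tensorHom_assoc, id_tensorHom, tensorHom_id,
    ComonObj.comul_counit, ComonObj.counit_comul, tensorμ]
  monoidal

namespace Bicomod

variable {C D E : Comon V}

/-- A right coaction of `C^o ⊗ D` as a left coaction of `C` and a right coaction of `D`. -/
@[reducible] def unfold (A : Bicomod E (C.opp.tens D)) : Bicomod C D where
  X := A.X
  l := (A.r ≫ A.X ◁ (C.opp.fst D).hom) ≫ (β_ C.X A.X).inv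
  r := A.r ≫ A.X ◁ (C.opp.snd D).hom
  l_counit := by
    have h : (A.r ≫ A.X ◁ (C.opp.fst D).hom) ≫ A.X ◁ ε[C.X] = (ρ_ A.X).inv :=
      (A.corestrict (𝟙 E) (C.opp.fst D)).r_counit
    rw [Category.assoc, ← BraidedCategory.braiding_inv_naturality_right, ← Category.assoc, h,
      braiding_inv_tensorUnit_left]
    simp
  l_coassoc := unturnL Δ[C.X] _ (A.corestrict (𝟙 E) (C.opp.fst D)).r_coassoc
  r_counit := (A.corestrict (𝟙 E) (C.opp.snd D)).r_counit
  r_coassoc := (A.corestrict (𝟙 E) (C.opp.snd D)).r_coassoc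
  lr := by
    have h₁ := Comon.comul_fst_snd C.opp D
    have h₂ := Comon.comul_snd_fst C.opp D
    calc
      _ = A.r ≫ (A.X ◁ (C.opp.snd D).hom ≫ A.r ▷ D.X) ≫
          (A.X ◁ (C.opp.fst D).hom ≫ (β_ C.X A.X).inv) ▷ D.X ⊗≫ 𝟙 _ := by monoidal
      _ = (A.r ≫ A.r ▷ (C.opp.tens D).X) ≫ (A.X ⊗ (C.opp.tens D).X) ◁ (C.opp.snd D).hom ≫
          (A.X ◁ (C.opp.fst D).hom) ▷ D.X ≫ (β_ C.X A.X).inv ▷ D.X ⊗≫ 𝟙 _ := by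
        rw [whisker_exchange]; monoidal
      _ = A.r ≫ A.X ◁ (Δ[(C.opp.tens D).X] ≫ ((C.opp.fst D).hom ⊗ₘ (C.opp.snd D).hom)) ⊗≫
          (β_ C.X A.X).inv ▷ D.X ⊗≫ 𝟙 _ := by
        rw [r_coassoc, MonoidalCategory.tensorHom_def']; monoidal
      _ = A.r ⊗≫ (β_ C.X A.X).inv ▷ D.X ⊗≫ 𝟙 _ := by rw [h₁]; monoidal
      _ = A.r ≫ A.X ◁ ((β_ C.X D.X).hom ≫ (β_ C.X D.X).inv) ⊗≫
          (β_ C.X A.X).inv ▷ D.X ⊗≫ 𝟙 _ := by rw [Iso.hom_inv_id]; monoidal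
      _ = A.r ≫ A.X ◁ (Δ[(C.opp.tens D).X] ≫ ((C.opp.snd D).hom ⊗ₘ (C.opp.fst D).hom)) ≫
          (α_ _ _ _).inv ≫ (β_ C.X (A.X ⊗ D.X)).inv := by
        rw [h₂, BraidedCategory.braiding_tensor_right_inv]; monoidal
      _ = (A.r ≫ A.r ▷ (C.opp.tens D).X) ≫ (A.X ⊗ (C.opp.tens D).X) ◁ (C.opp.fst D).hom ≫
          (A.X ◁ (C.opp.snd D).hom) ▷ C.X ≫ (β_ C.X (A.X ⊗ D.X)).inv := by
        rw [r_coassoc, MonoidalCategory.tensorHom_def']; monoidal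
      _ = A.r ≫ (A.X ◁ (C.opp.fst D).hom ≫ A.r ▷ C.X) ≫
          (A.X ◁ (C.opp.snd D).hom) ▷ C.X ≫ (β_ C.X (A.X ⊗ D.X)).inv := by
        rw [whisker_exchange]; monoidal
      _ = A.r ≫ A.X ◁ (C.opp.fst D).hom ≫
          (A.r ≫ A.X ◁ (C.opp.snd D).hom) ▷ C.X ≫ (β_ C.X (A.X ⊗ D.X)).inv := by monoidal
      _ = _ := by
        rw [BraidedCategory.braiding_inv_naturality_left]; simp

end Bicomod
end Projections

section Splitting

variable {V : Type u} [Category.{v} V] [MonoidalCategory V] [BraidedCategory V]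

namespace Bicomod

variable {C D E : Comon V}

theorem comul_inner (X B : Comon V) {W T : V} (w : B.X ⟶ W) (θ : B.X ⟶ T) :
    Δ[(X.tens B).X] ≫ (X.X ◁ w ⊗ₘ (X.snd B).hom ≫ θ) =
      X.X ◁ (Δ[B.X] ≫ (w ⊗ₘ θ)) ≫ (α_ _ _ _).inv := by
  have h := tensorμ_natural (𝟙 X.X) ε[X.X] w θ
  have e : (X.X ◁ w ⊗ₘ (X.snd B).hom ≫ θ) =
      ((𝟙 X.X ⊗ₘ w) ⊗ₘ (ε[X.X] ⊗ₘ θ)) ≫ (X.X ⊗ W) ◁ (λ_ T).hom := by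
    rw [← id_tensorHom (X.X ⊗ W), tensorHom_comp_tensorHom, Category.comp_id, id_tensorHom,
      Category.assoc, ← MonoidalCategory.leftUnitor_naturality,
      MonoidalCategory.tensorHom_def ε[X.X], Category.assoc]
  rw [e, Comon.tensorObj_comul, Category.assoc, ← reassoc_of% h, tensorHom_comp_tensorHom_assoc,
    id_tensorHom, ComonObj.comul_counit, tensorμ, braiding_tensorUnit_left,
    MonoidalCategory.tensorHom_def' (ρ_ X.X).inv]
  monoidal

theorem comul_outer (P Y : Comon V) {W T : V} (w : P.X ⟶ W) (θ : P.X ⟶ T) :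
    Δ[(P.tens Y).X] ≫ (w ▷ Y.X ⊗ₘ (P.fst Y).hom ≫ θ) =
      (Δ[P.X] ≫ (w ⊗ₘ θ)) ▷ Y.X ≫ (α_ _ _ _).hom ≫ W ◁ (β_ T Y.X).hom ≫ (α_ _ _ _).inv := by
  have h := tensorμ_natural w θ (𝟙 Y.X) ε[Y.X]
  have e : (w ▷ Y.X ⊗ₘ (P.fst Y).hom ≫ θ) =
      ((w ⊗ₘ 𝟙 Y.X) ⊗ₘ (θ ⊗ₘ ε[Y.X])) ≫ (W ⊗ Y.X) ◁ (ρ_ T).hom := by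
    rw [← id_tensorHom (W ⊗ Y.X), tensorHom_comp_tensorHom, Category.comp_id, tensorHom_id,
      Category.assoc, ← MonoidalCategory.rightUnitor_naturality,
      MonoidalCategory.tensorHom_def' θ, Category.assoc]
  rw [e, Comon.tensorObj_comul, Category.assoc, ← reassoc_of% h, tensorHom_comp_tensorHom_assoc,
    id_tensorHom, ComonObj.comul_counit, tensorμ, MonoidalCategory.tensorHom_def (Δ[P.X] ≫ _)]
  monoidal

/-- A map into `M` lifts to `M ⊗_G K` as soon as it equalizes a suitable idempotent. -/
theorem split_cond (M : Bicomod E C) (K : Bicomod C D) {T : V} (t : T ⟶ M.X) (z : C.X ⟶ K.X)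
    (q : K.X ⟶ 𝟙_ V) (h₁ : (K.l ≫ C.X ◁ q ≫ (ρ_ C.X).hom) ≫ z = 𝟙 K.X)
    (h₂ : t ≫ M.r ≫ M.X ◁ (z ≫ K.l ≫ C.X ◁ q ≫ (ρ_ C.X).hom) = t ≫ M.r) :
    (t ≫ M.r ≫ M.X ◁ z) ≫ M.r ▷ K.X ≫ (α_ M.X C.X K.X).hom =
      (t ≫ M.r ≫ M.X ◁ z) ≫ M.X ◁ K.l := by
  obtain ⟨e, he⟩ : ∃ e, e = K.l ≫ C.X ◁ q ≫ (ρ_ C.X).hom := ⟨_, rfl⟩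
  rw [← he] at h₁ h₂
  have h₃ : K.l ≫ C.X ◁ e = e ≫ Δ[C.X] := by
    calc
      _ = (K.l ≫ C.X ◁ K.l) ≫ C.X ◁ C.X ◁ q ⊗≫ 𝟙 _ := by rw [he]; monoidal
      _ = K.l ≫ (Δ[C.X] ▷ K.X ≫ (C.X ⊗ C.X) ◁ q) ⊗≫ 𝟙 _ := by rw [l_coassoc]; monoidal
      _ = _ := by rw [← whisker_exchange, he]; monoidal
  have h₄ : t ≫ M.r ≫ M.X ◁ (Δ[C.X] ≫ C.X ◁ (z ≫ e)) = t ≫ M.r ≫ M.X ◁ Δ[C.X] := by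
    calc
      _ = t ≫ (M.r ≫ M.X ◁ Δ[C.X] ≫ (α_ _ _ _).inv) ≫ (M.X ⊗ C.X) ◁ (z ≫ e) ⊗≫ 𝟙 _ := by monoidal
      _ = t ≫ M.r ≫ (M.r ▷ C.X ≫ (M.X ⊗ C.X) ◁ (z ≫ e)) ⊗≫ 𝟙 _ := by
        rw [← r_coassoc]; monoidal
      _ = (t ≫ M.r ≫ M.X ◁ (z ≫ e)) ≫ M.r ▷ C.X ⊗≫ 𝟙 _ := by
        rw [← whisker_exchange]; monoidal
      _ = t ≫ (M.r ≫ M.r ▷ C.X) ⊗≫ 𝟙 _ := by rw [h₂]; monoidal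
      _ = _ := by rw [r_coassoc]; monoidal
  calc
    _ = t ≫ M.r ≫ (M.X ◁ z ≫ M.r ▷ K.X) ⊗≫ 𝟙 _ := by monoidal
    _ = t ≫ (M.r ≫ M.r ▷ C.X) ≫ (M.X ⊗ C.X) ◁ z ⊗≫ 𝟙 _ := by rw [whisker_exchange]; monoidal
    _ = t ≫ M.r ≫ M.X ◁ (Δ[C.X] ≫ C.X ◁ (z ≫ 𝟙 _)) := by rw [r_coassoc]; monoidal
    _ = (t ≫ M.r ≫ M.X ◁ (Δ[C.X] ≫ C.X ◁ (z ≫ e))) ≫ M.X ◁ C.X ◁ z := by rw [← h₁]; monoidal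
    _ = (t ≫ M.r ≫ M.X ◁ (z ≫ e)) ≫ M.X ◁ (Δ[C.X] ≫ C.X ◁ z) := by rw [h₄, h₂]; monoidal
    _ = t ≫ M.r ≫ M.X ◁ (z ≫ (K.l ≫ C.X ◁ e) ≫ C.X ◁ z) := by rw [h₃]; monoidal
    _ = t ≫ M.r ≫ M.X ◁ (z ≫ K.l ≫ C.X ◁ (e ≫ z)) := by monoidal
    _ = _ := by rw [h₁]; monoidal

theorem tensor_l_counit {C' D' : Comon V} (M : Bicomod C D) (N : Bicomod C' D')
    (q : M.X ⟶ 𝟙_ V) (q' : N.X ⟶ 𝟙_ V) :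
    (M.tensor N).l ≫ (C.X ⊗ C'.X) ◁ ((q ⊗ₘ q') ≫ (λ_ (𝟙_ V)).hom) ≫ (ρ_ _).hom =
      (M.l ≫ C.X ◁ q ≫ (ρ_ C.X).hom) ⊗ₘ (N.l ≫ C'.X ◁ q' ≫ (ρ_ C'.X).hom) := by
  have h := tensorμ_wl q q' C.X C'.X
  dsimp only [tensor]
  rw [MonoidalCategory.whiskerLeft_comp, Category.assoc, Category.assoc, reassoc_of% h,
    tensorHom_comp_tensorHom_assoc, ← rightUnitor_monoidal C.X C'.X, tensorHom_comp_tensorHom,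
    Category.assoc, Category.assoc]

theorem ev_l_counit (C : Comon V) :
    (ev C).l ≫ (C.X ⊗ C.X) ◁ ε[C.X] ≫ (ρ_ _).hom = Δ[C.X] := by
  dsimp only [ev]
  calc
    _ = Δ[C.X] ≫ C.X ◁ (Δ[C.X] ≫ (β_ C.X C.X).hom ≫ C.X ◁ ε[C.X]) ⊗≫ 𝟙 _ := by monoidal
    _ = Δ[C.X] ≫ C.X ◁ (Δ[C.X] ≫ ε[C.X] ▷ C.X ≫ (β_ (𝟙_ V) C.X).hom) ⊗≫ 𝟙 _ := by
      rw [BraidedCategory.braiding_naturality_left]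
    _ = _ := by rw [ComonObj.counit_comul_assoc, braiding_tensorUnit_left]; monoidal

end Bicomod
end Splitting

section Arrows

variable {V : Type u} [Category.{v} V] [MonoidalCategory V] [BraidedCategory V]

namespace Bicomod

/-- The inverse of `mid`. -/
def midInv (C : Comon V) :
    (C.X ⊗ C.X) ⊗ (C.X ⊗ C.X) ⟶ (C.X ⊗ (C.X ⊗ C.X)) ⊗ C.X :=
  (α_ (C.X ⊗ C.X) C.X C.X).inv ≫ (α_ C.X C.X C.X).hom ▷ C.X

theorem mid_midInv (C : Comon V) : (mid C).hom ≫ midInv C = 𝟙 _ := by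
  simp only [Comon.comp_hom', Comon.id_hom', midInv, tensorHom_id, Category.assoc]
  simp

theorem midInv_mid (C : Comon V) : midInv C ≫ (mid C).hom = 𝟙 _ := by
  simp only [Comon.comp_hom', Comon.id_hom', midInv, tensorHom_id, Category.assoc]
  simp

/-- The map `1 ⊗ 1 ⊗ ε ⊗ 1`. -/
def midFst (C : Comon V) : (C.X ⊗ C.X) ⊗ (C.X ⊗ C.X) ⟶ (mul C).X :=
  midInv C ≫ (C.X ◁ (C.fst C.opp).hom) ▷ C.X

theorem corestrict_l_counit {C D C' D' : Comon V} (M : Bicomod C D) (g : C ⟶ C') (h : D ⟶ D')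
    (q : M.X ⟶ 𝟙_ V) : (M.corestrict g h).l ≫ C'.X ◁ q ≫ (ρ_ _).hom =
      (M.l ≫ C.X ◁ q ≫ (ρ_ _).hom) ≫ g.hom := by
  dsimp only [corestrict]
  rw [Category.assoc, ← whisker_exchange_assoc, MonoidalCategory.rightUnitor_naturality,
    Category.assoc, Category.assoc]

theorem mul_l_counit (C : Comon V) :
    (mul C).l ≫ ((C.X ⊗ C.X) ⊗ (C.X ⊗ C.X)) ◁ mulCounit C ≫ (ρ_ _).hom =
      (C.X ◁ Δ[C.X]) ▷ C.X ≫ (mid C).hom := by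
  have e : mulCounit C = (((ε[C.X] ⊗ₘ ε[C.X]) ≫ (λ_ (𝟙_ V)).hom) ⊗ₘ ε[C.X]) ≫ (λ_ (𝟙_ V)).hom := by
    rw [mulCounit, Comon.tensorObj_counit, Comon.tensorObj_counit]; rfl
  have h := tensor_l_counit ((reg C.opp).tensor (ev C)) (reg C)
    ((ε[C.X] ⊗ₘ ε[C.X]) ≫ (λ_ (𝟙_ V)).hom) ε[C.X]
  have h' := tensor_l_counit (reg C.opp) (ev C) ε[C.X] ε[C.X]
  have b : ∀ C : Comon V, (reg C).l ≫ C.X ◁ ε[C.X] ≫ (ρ_ C.X).hom = 𝟙 C.X := by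
    intro C
    dsimp only [reg]
    rw [ComonObj.comul_counit_assoc, Iso.inv_hom_id]
  have a := b C.opp
  rw [Comon.opp_counit] at a
  rw [a, ev_l_counit] at h'
  rw [h', b C, id_tensorHom, tensorHom_id] at h
  rw [e]
  exact (corestrict_l_counit _ _ _ _).trans (congrArg (· ≫ (mid C).hom) h)

theorem mul_retract (C : Comon V) :
    ((mul C).l ≫ ((C.X ⊗ C.X) ⊗ (C.X ⊗ C.X)) ◁ mulCounit C ≫ (ρ_ _).hom) ≫ midFst C = 𝟙 _ := by
  have h := mid_midInv C
  have e : Δ[C.X] ≫ (C.fst C.opp).hom = 𝟙 C.X := by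
    dsimp only [Comon.fst]
    rw [Comon.opp_counit, ComonObj.comul_counit_assoc, Iso.inv_hom_id]
  rw [mul_l_counit, midFst, Category.assoc, reassoc_of% h, ← MonoidalCategory.comp_whiskerRight,
    ← MonoidalCategory.whiskerLeft_comp, e, MonoidalCategory.whiskerLeft_id,
    MonoidalCategory.id_whiskerRight]

theorem comul_mid (C : Comon V) {W T : V} (w : (C.X ⊗ (C.X ⊗ C.X)) ⊗ C.X ⟶ W)
    (θ : (C.X ⊗ (C.X ⊗ C.X)) ⊗ C.X ⟶ T) :
    Δ[((env C).tens (env C)).X] ≫ (midInv C ≫ w ⊗ₘ midInv C ≫ θ) =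
      midInv C ≫ Δ[((C.opp.tens (C.tens C.opp)).tens C).X] ≫ (w ⊗ₘ θ) := by
  have h := (mid C).isComonHom_hom.hom_comul
  have h₁ := midInv_mid C
  have h₂ := mid_midInv C
  have h₃ : Δ[((env C).tens (env C)).X] =
      midInv C ≫ Δ[((C.opp.tens (C.tens C.opp)).tens C).X] ≫ ((mid C).hom ⊗ₘ (mid C).hom) := by
    rw [← h, reassoc_of% h₁]
  rw [h₃, Category.assoc, Category.assoc, tensorHom_comp_tensorHom, reassoc_of% h₂,
    reassoc_of% h₂]

/-- The map which moves the last factor to the third place. -/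
def midIns (C : Comon V) :
    ((C.X ⊗ C.X) ⊗ C.X) ⊗ C.X ⟶ (C.X ⊗ (C.X ⊗ C.X)) ⊗ C.X :=
  (α_ _ _ _).hom ≫ (C.X ⊗ C.X) ◁ (β_ C.X C.X).inv ≫ (α_ _ _ _).inv ≫ (α_ _ _ _).hom ▷ C.X

theorem comul_midIns (C : Comon V) (x : (C.tens C.opp).X ⟶ C.X) :
    Δ[((C.opp.tens (C.tens C.opp)).tens C).X] ≫ ((C.X ◁ (C.fst C.opp).hom) ▷ C.X ⊗ₘ
        ((C.opp.tens (C.tens C.opp)).fst C).hom ≫ (C.opp.snd (C.tens C.opp)).hom ≫ x) ≫ midIns C =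
      (C.X ◁ (Δ[(C.tens C.opp).X] ≫ ((C.fst C.opp).hom ⊗ₘ x))) ▷ C.X := by
  have h₁ := comul_outer (C.opp.tens (C.tens C.opp)) C (C.X ◁ (C.fst C.opp).hom)
    ((C.opp.snd (C.tens C.opp)).hom ≫ x)
  have h₂ := comul_inner C.opp (C.tens C.opp) (C.fst C.opp).hom x
  rw [h₂] at h₁
  rw [← Category.assoc]
  refine (congrArg (· ≫ midIns C) h₁).trans ?_
  simp only [midIns, Category.assoc]
  rw [Iso.inv_hom_id_assoc, whiskerLeft_hom_inv_assoc, Iso.hom_inv_id_assoc,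
    ← MonoidalCategory.comp_whiskerRight, Category.assoc, Iso.inv_hom_id, Category.comp_id]

theorem midFst_comul (C : Comon V) :
    midFst C ≫ (mul C).l ≫ ((C.X ⊗ C.X) ⊗ (C.X ⊗ C.X)) ◁ mulCounit C ≫ (ρ_ _).hom =
      Δ[((env C).tens (env C)).X] ≫
        (midFst C ⊗ₘ midInv C ≫ ((C.opp.tens (C.tens C.opp)).fst C).hom ≫
          (C.opp.snd (C.tens C.opp)).hom ≫ (C.fst C.opp).hom) ≫ midIns C ≫ (mid C).hom := by
  have h := comul_mid C ((C.X ◁ (C.fst C.opp).hom) ▷ C.X)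
    (((C.opp.tens (C.tens C.opp)).fst C).hom ≫ (C.opp.snd (C.tens C.opp)).hom ≫ (C.fst C.opp).hom)
  have h' := comul_midIns C (C.fst C.opp).hom
  have e := (C.fst C.opp).isComonHom_hom.hom_comul
  rw [← e] at h'
  rw [mul_l_counit]
  refine Eq.trans ?_ (congrArg (· ≫ midIns C ≫ (mid C).hom) h).symm |>.trans (Category.assoc _ _ _)
  refine Eq.trans ?_ (congrArg (fun t => midInv C ≫ t ≫ (mid C).hom) h').symm |>.trans ?_
  · simp only [midFst, MonoidalCategory.whiskerLeft_comp, MonoidalCategory.comp_whiskerRight,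
      Category.assoc]
  · simp only [Category.assoc]

theorem midSnd_comul (C : Comon V) :
    Δ[((env C).tens (env C)).X] ≫
        (midFst C ⊗ₘ midInv C ≫ ((C.opp.tens (C.tens C.opp)).fst C).hom ≫
          (C.opp.snd (C.tens C.opp)).hom ≫ (C.snd C.opp).hom) ≫ midIns C ≫ (mid C).hom = 𝟙 _ := by
  have h := comul_mid C ((C.X ◁ (C.fst C.opp).hom) ▷ C.X)
    (((C.opp.tens (C.tens C.opp)).fst C).hom ≫ (C.opp.snd (C.tens C.opp)).hom ≫ (C.snd C.opp).hom)
  have h' := comul_midIns C (C.snd C.opp).hom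
  have e := Comon.comul_fst_snd C C.opp
  have i := midInv_mid C
  rw [e, MonoidalCategory.whiskerLeft_id, MonoidalCategory.id_whiskerRight] at h'
  refine (Category.assoc _ _ _).symm.trans <|
    (congrArg (· ≫ midIns C ≫ (mid C).hom) h).trans ?_
  refine Eq.trans ?_ (congrArg (fun t => midInv C ≫ t ≫ (mid C).hom) h') |>.trans ?_
  · simp only [Category.assoc]
  · simpa using i

theorem midInv_fst (C : Comon V) :
    midInv C ≫ ((C.opp.tens (C.tens C.opp)).fst C).hom ≫ (C.opp.snd (C.tens C.opp)).hom ≫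
      (C.fst C.opp).hom = ((env C).fst (env C)).hom ≫ (C.opp.snd C).hom := by
  dsimp only [midInv, Comon.fst, Comon.snd]
  rw [Comon.tensorObj_counit, Comon.opp_counit]
  symm
  calc
    _ = 𝟙 _ ⊗≫ (C.X ⊗ C.X) ◁ (ε[C.X] ▷ C.X ≫ 𝟙_ V ◁ ε[C.X]) ⊗≫ ε[C.X] ▷ C.X ⊗≫ 𝟙 _ := by
      rw [MonoidalCategory.tensorHom_def]; monoidal
    _ = 𝟙 _ ⊗≫ (C.X ⊗ C.X) ◁ C.X ◁ ε[C.X] ⊗≫ (C.X ◁ (C.X ◁ ε[C.X]) ≫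
        ε[C.X] ▷ (C.X ⊗ 𝟙_ V)) ⊗≫ 𝟙 _ := by
      rw [← whisker_exchange]; monoidal
    _ = _ := by rw [whisker_exchange]; monoidal

theorem midInv_snd (C : Comon V) :
    midInv C ≫ ((C.opp.tens (C.tens C.opp)).fst C).hom ≫ (C.opp.snd (C.tens C.opp)).hom ≫
      (C.snd C.opp).hom = ((env C).snd (env C)).hom ≫ (C.opp.fst C).hom := by
  dsimp only [midInv, Comon.fst, Comon.snd]
  rw [Comon.tensorObj_counit, Comon.opp_counit]
  symm
  calc
    _ = 𝟙 _ ⊗≫ ε[C.X] ▷ (C.X ⊗ C.X ⊗ C.X) ⊗≫ (ε[C.X] ▷ (C.X ⊗ C.X) ≫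
        𝟙_ V ◁ (C.X ◁ ε[C.X])) ⊗≫ 𝟙 _ := by
      rw [MonoidalCategory.tensorHom_def]; monoidal
    _ = 𝟙 _ ⊗≫ (ε[C.X] ▷ (C.X ⊗ C.X ⊗ C.X) ≫ 𝟙_ V ◁ (C.X ◁ C.X ◁ ε[C.X])) ⊗≫
        ε[C.X] ▷ (C.X ⊗ 𝟙_ V) ⊗≫ 𝟙 _ := by
      rw [← whisker_exchange]; monoidal
    _ = _ := by rw [← whisker_exchange]; monoidal

end Bicomod
end Arrows

section Composables

variable {V : Type u} [Category.{v} V] [MonoidalCategory V] [BraidedCategory V]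

namespace Bicomod

variable {C : Comon V}

theorem tensor_r_fst {C D C' D' : Comon V} (M : Bicomod C D) (N : Bicomod C' D') {T : V}
    (x : D.X ⟶ T) : (M.tensor N).r ≫ (M.X ⊗ N.X) ◁ ((D.fst D').hom ≫ x) =
      (M.r ≫ M.X ◁ x) ▷ N.X ≫ (α_ _ _ _).hom ≫ M.X ◁ (β_ T N.X).hom ≫ (α_ _ _ _).inv := by
  have h := tensorμ_wl x ε[D'.X] M.X N.X
  have e : (D.fst D').hom ≫ x = (x ⊗ₘ ε[D'.X]) ≫ (ρ_ T).hom := by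
    rw [MonoidalCategory.tensorHom_def', Category.assoc, Category.assoc,
      MonoidalCategory.rightUnitor_naturality]
  rw [e, MonoidalCategory.whiskerLeft_comp]
  dsimp only [tensor]
  rw [Category.assoc, reassoc_of% h, tensorHom_comp_tensorHom_assoc, r_counit, tensorμ,
    MonoidalCategory.tensorHom_def]
  monoidal

theorem tensor_r_snd {C D C' D' : Comon V} (M : Bicomod C D) (N : Bicomod C' D') {T : V}
    (x : D'.X ⟶ T) : (M.tensor N).r ≫ (M.X ⊗ N.X) ◁ ((D.snd D').hom ≫ x) =
      M.X ◁ (N.r ≫ N.X ◁ x) ≫ (α_ _ _ _).inv := by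
  have h := tensorμ_wl ε[D.X] x M.X N.X
  have e : (D.snd D').hom ≫ x = (ε[D.X] ⊗ₘ x) ≫ (λ_ T).hom := by
    rw [MonoidalCategory.tensorHom_def, Category.assoc, Category.assoc,
      MonoidalCategory.leftUnitor_naturality]
  rw [e, MonoidalCategory.whiskerLeft_comp]
  dsimp only [tensor]
  rw [Category.assoc, reassoc_of% h, tensorHom_comp_tensorHom_assoc, r_counit, tensorμ,
    braiding_tensorUnit_left, MonoidalCategory.tensorHom_def' (ρ_ M.X).inv]
  monoidal

theorem split_swap {E D : Comon V} (M : Bicomod E D) {T W B : V} (t : T ⟶ M.X) (z : D.X ⟶ W)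
    (x y : D.X ⟶ B) (S : W ⊗ B ⟶ D.X) (h : Δ[D.X] ≫ (z ⊗ₘ y) ≫ S = 𝟙 _)
    (e : t ≫ M.r ≫ M.X ◁ y = t ≫ M.r ≫ M.X ◁ x) :
    t ≫ M.r ≫ M.X ◁ (Δ[D.X] ≫ (z ⊗ₘ x) ≫ S) = t ≫ M.r := by
  have key : ∀ x : D.X ⟶ B, t ≫ M.r ≫ M.X ◁ (Δ[D.X] ≫ (z ⊗ₘ x) ≫ S) =
      (t ≫ M.r ≫ M.X ◁ x) ≫ (M.r ≫ M.X ◁ z) ▷ B ⊗≫ M.X ◁ S := by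
    intro x
    calc
      _ = t ≫ (M.r ≫ M.X ◁ Δ[D.X] ≫ (α_ _ _ _).inv) ≫ (M.X ⊗ D.X) ◁ x ⊗≫ M.X ◁ (z ▷ B ≫ S) := by
        rw [MonoidalCategory.tensorHom_def']; monoidal
      _ = t ≫ M.r ≫ (M.r ▷ D.X ≫ (M.X ⊗ D.X) ◁ x) ⊗≫ M.X ◁ (z ▷ B ≫ S) := by
        rw [← r_coassoc]; monoidal
      _ = _ := by rw [← whisker_exchange]; monoidal
  rw [key, ← e, ← key, h]
  simp

variable [CoreflexiveTensor V]

/-- On composable pairs the coactions of the second and of the third factor of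
`C^o ⊗ C ⊗ C^o ⊗ C` agree. -/
theorem composable_cond {E : Comon V} (A : Bicomod E (env C)) :
    ι A.unfold A.unfold ≫ (A.tensor A).r ≫ (A.X ⊗ A.X) ◁
        (midInv C ≫ ((C.opp.tens (C.tens C.opp)).fst C).hom ≫ (C.opp.snd (C.tens C.opp)).hom ≫
          (C.snd C.opp).hom) =
      ι A.unfold A.unfold ≫ (A.tensor A).r ≫ (A.X ⊗ A.X) ◁
        (midInv C ≫ ((C.opp.tens (C.tens C.opp)).fst C).hom ≫ (C.opp.snd (C.tens C.opp)).hom ≫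
          (C.fst C.opp).hom) := by
  have h₁ := tensor_r_fst A A (C.opp.snd C).hom
  have h₂ := tensor_r_snd A A (C.opp.fst C).hom
  have i := ι_cond A.unfold A.unfold
  have e₁ := midInv_fst C
  have e₂ := midInv_snd C
  refine ((congrArg (fun t => ι A.unfold A.unfold ≫ (A.tensor A).r ≫ (A.X ⊗ A.X) ◁ t) e₂).trans
    (congrArg (ι A.unfold A.unfold ≫ ·) h₂)).trans <|
    .trans ?_ ((congrArg (fun t => ι A.unfold A.unfold ≫ (A.tensor A).r ≫ (A.X ⊗ A.X) ◁ t)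
      e₁).trans (congrArg (ι A.unfold A.unfold ≫ ·) h₁)).symm
  have i' := congrArg (· ≫ A.X ◁ (β_ C.X A.X).hom ≫ (α_ _ _ _).inv) i
  dsimp only [unfold] at i'
  simp only [Category.assoc, MonoidalCategory.whiskerLeft_comp, whiskerLeft_inv_hom_assoc] at i'
  simpa only [Category.assoc, MonoidalCategory.whiskerLeft_comp] using i'

theorem composable_split {E : Comon V} (A : Bicomod E (env C)) :
    ι A.unfold A.unfold ≫ (A.tensor A).r ≫ (A.X ⊗ A.X) ◁
      (midFst C ≫ (mul C).l ≫ ((C.X ⊗ C.X) ⊗ (C.X ⊗ C.X)) ◁ mulCounit C ≫ (ρ_ _).hom) =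
      ι A.unfold A.unfold ≫ (A.tensor A).r := by
  rw [midFst_comul]
  exact split_swap (A.tensor A) _ _ _ _ _ (midSnd_comul C) (composable_cond A)

/-- The canonical map from the object of composable pairs `H = A ⊗_C A` to the carrier of
`p ∘ (A ⊗ A)`. It is the map over `A ⊗ A`, see `composable_dropRight`. -/
def composable {E : Comon V} (A : Bicomod E (env C)) :
    (comp A.unfold A.unfold).X ⟶ (comp (A.tensor A) (mul C)).X :=
  lift (M := A.tensor A) (N := mul C)
    (ι A.unfold A.unfold ≫ (A.tensor A).r ≫ (A.X ⊗ A.X) ◁ midFst C)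
    (split_cond (A.tensor A) (mul C) _ _ (mulCounit C) (mul_retract C) (composable_split A))

/-- The map `composable A` lies over `A ⊗ A`. -/
theorem composable_dropRight {E : Comon V} (A : Bicomod E (env C)) :
    composable A ≫ dropRight (A.tensor A) (mul C) (mulCounit C) = ι A.unfold A.unfold := by
  have h : midFst C ≫ mulCounit C = ε[((env C).tens (env C)).X] := by
    have h₁ := (Comon.tensMap (Comon.tensMap (𝟙 C.opp) (C.fst C.opp)) (𝟙 C)).isComonHom_hom.hom_counit
    have h₂ := (mid C).isComonHom_hom.hom_counit
    have h₃ := midInv_mid C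
    simp only [Comon.id_hom', id_tensorHom, tensorHom_id] at h₁
    rw [midFst, mulCounit, Category.assoc]
    refine (congrArg (midInv C ≫ ·) (h₁.trans h₂.symm)).trans ?_
    exact (reassoc_of% h₃) _
  have e := (A.tensor A).r_counit
  rw [composable, dropRight, lift_ι_assoc, Category.assoc, Category.assoc,
    ← MonoidalCategory.whiskerLeft_comp_assoc, h, ← Category.assoc (A.tensor A).r]
  refine (congrArg (fun t => ι A.unfold A.unfold ≫ t ≫ (ρ_ (A.X ⊗ A.X)).hom) e).trans ?_
  rw [Iso.inv_hom_id, Category.comp_id]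

/-- The map between objects of composable pairs induced by cells. -/
def Cell.pair {C D E C' D' E' : Comon V} {g : C ⟶ C'} {h : D ⟶ D'} {k : E ⟶ E'}
    {M : Bicomod C D} {M' : Bicomod C' D'} {N : Bicomod D E} {N' : Bicomod D' E'}
    (u : Cell g h M M') (w : Cell h k N N') : (comp M N).X ⟶ (comp M' N').X :=
  lift (ι M N ≫ (u.hom ⊗ₘ w.hom)) (by
    have i := ι_cond M N
    calc
      _ = ι M N ≫ ((u.hom ≫ M'.r) ⊗ₘ w.hom) ≫ (α_ _ _ _).hom := by
        rw [Category.assoc, ← tensorHom_id, tensorHom_comp_tensorHom_assoc, Category.comp_id]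
      _ = ι M N ≫ M.r ▷ N.X ≫ (((u.hom ⊗ₘ h.hom) ⊗ₘ w.hom)) ≫ (α_ _ _ _).hom := by
        rw [u.r_comm, ← tensorHom_id, tensorHom_comp_tensorHom_assoc, Category.id_comp]
      _ = (ι M N ≫ M.r ▷ N.X ≫ (α_ _ _ _).hom) ≫ (u.hom ⊗ₘ (h.hom ⊗ₘ w.hom)) := by
        rw [MonoidalCategory.associator_naturality]; simp
      _ = _ := by
        rw [← i, Category.assoc, Category.assoc, ← id_tensorHom, ← id_tensorHom,
          tensorHom_comp_tensorHom, tensorHom_comp_tensorHom, w.l_comm]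
        simp)

end Bicomod
end Composables

section Concrete

variable {V : Type u} [Category.{v} V] [MonoidalCategory V] [BraidedCategory V]
  [CoreflexiveTensor V]

open Bicomod

namespace QuantumGraph

variable (X Y Z : QuantumGraph V)

/-- The comultiplication of the object of arrows. -/
def comul : X.A.X ⟶ X.A.X ⊗ X.A.X := X.str.comul.hom ≫ ι X.A X.A

/-- The counit of the object of arrows. -/
def counit : X.A.X ⟶ 𝟙_ V := X.str.counit.hom ≫ ε[(env X.C).X]

theorem comul_r : X.comul ≫ X.A.X ◁ X.str.counit.hom = X.A.r := by
  have h := X.isComonad.comul_counit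
  have h' : X.str.comul ≫ wl X.A X.str.counit = (runit X.A).inv := by
    rw [← Category.assoc] at h
    rw [← Category.id_comp (runit X.A).inv, ← h, Category.assoc, Iso.hom_inv_id, Category.comp_id]
  have e := congrArg (fun t => Hom.hom t ≫ ι _ _) h'
  simpa [comul] using e

theorem comul_l : X.comul ≫ X.str.counit.hom ▷ X.A.X = X.A.l := by
  have h := X.isComonad.counit_comul
  have h' : X.str.comul ≫ wr X.str.counit X.A = (lunit X.A).inv := by
    rw [← Category.assoc] at h
    rw [← Category.id_comp (lunit X.A).inv, ← h, Category.assoc, Iso.hom_inv_id, Category.comp_id]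
  have e := congrArg (fun t => Hom.hom t ≫ ι _ _) h'
  simpa [comul] using e

/-- The object of arrows as a comonoid. -/
@[reducible] def arrowComon : Comon V where
  X := X.A.X
  comon :=
    { counit := X.counit
      comul := X.comul
      counit_comul := by
        have h := X.comul_l
        have e := X.A.l_counit
        rw [counit, MonoidalCategory.comp_whiskerRight, reassoc_of% h, e]
      comul_counit := by
        have h := X.comul_r
        have e := X.A.r_counit
        rw [counit, MonoidalCategory.whiskerLeft_comp, reassoc_of% h, e]
      comul_assoc := by
        have h := congrArg (fun t => Hom.hom t ≫ ι _ _ ≫ X.A.X ◁ ι X.A X.A) X.isComonad.coassoc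
        have k := assocHom_ι_ι X.A X.A X.A
        simp only [comp_hom, wr_hom, wl_hom, assoc_hom_hom, Category.assoc] at h
        rw [k, wrHom_ι_assoc, wlHom_ι_assoc] at h
        simp only [comul, MonoidalCategory.whiskerLeft_comp, MonoidalCategory.comp_whiskerRight,
          Category.assoc]
        exact h.symm }

/-- The source map. -/
def src : X.A.X ⟶ X.C.X := X.str.counit.hom ≫ (X.C.opp.fst X.C).hom

/-- The target map. -/
def tgt : X.A.X ⟶ X.C.X := X.str.counit.hom ≫ (X.C.opp.snd X.C).hom

/-- The object of arrows as a comodule from `C` to `C`, by the coactions along source and target. -/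
@[reducible] def arrows : Bicomod X.C X.C := X.A.unfold

theorem arrows_r : X.arrows.r = X.comul ≫ X.A.X ◁ X.tgt := by
  have h := X.comul_r
  dsimp only [arrows, unfold]
  rw [← h, tgt, Category.assoc, ← MonoidalCategory.whiskerLeft_comp]

theorem arrows_l : X.arrows.l = X.comul ≫ X.A.X ◁ X.src ≫ (β_ X.C.X X.A.X).inv := by
  have h := X.comul_r
  dsimp only [arrows, unfold]
  rw [← h, src, Category.assoc, Category.assoc, ← MonoidalCategory.whiskerLeft_comp_assoc]

/-- A map of quantum graphs in concrete terms: comonoid maps `f` on objects and `φ` on arrows,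
compatible with source and target. -/
structure IsGraphMap {X Y : QuantumGraph V} (f : X.C ⟶ Y.C) (φ : X.A.X ⟶ Y.A.X) : Prop where
  comul : φ ≫ Y.comul = X.comul ≫ (φ ⊗ₘ φ)
  counit : φ ≫ Y.counit = X.counit
  src : φ ≫ Y.src = X.src ≫ f.hom
  tgt : φ ≫ Y.tgt = X.tgt ≫ f.hom

variable {X Y}

/-- A map of quantum graphs as a cell. -/
def IsGraphMap.cell {f : X.C ⟶ Y.C} {φ : X.A.X ⟶ Y.A.X} (h : IsGraphMap f φ) :
    Cell f f X.arrows Y.arrows where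
  hom := φ
  l_comm := by
    have e := h.comul
    rw [arrows_l, arrows_l, reassoc_of% e, Category.assoc, Category.assoc,
      ← BraidedCategory.braiding_inv_naturality, ← id_tensorHom, ← id_tensorHom,
      tensorHom_comp_tensorHom_assoc, tensorHom_comp_tensorHom_assoc, h.src]
    simp
  r_comm := by
    have e := h.comul
    rw [arrows_r, arrows_r, reassoc_of% e, Category.assoc, ← id_tensorHom, ← id_tensorHom,
      tensorHom_comp_tensorHom, tensorHom_comp_tensorHom, h.tgt]
    simp

/-- The map `A ⊗_C A ⟶ A' ⊗_{C'} A'` between the objects of composable pairs, the restriction of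
`φ ⊗ φ`. -/
def IsGraphMap.pair {f : X.C ⟶ Y.C} {φ : X.A.X ⟶ Y.A.X} (h : IsGraphMap f φ) :
    (comp X.arrows X.arrows).X ⟶ (comp Y.arrows Y.arrows).X := h.cell.pair h.cell

end QuantumGraph

namespace QuantumCategory

variable (X Y : QuantumCategory V)

/-- The composition map `ν₂ : A ⊗_C A ⟶ A` determined by `μ₂`. -/
def ν₂ : (comp X.arrows X.arrows).X ⟶ X.A.X :=
  composable X.A ≫ X.μ₂.hom ≫ dropLeft (mul X.C) X.A (mulCounit X.C)

/-- The identity map `ν₀ : C ⟶ A` determined by `μ₀`. -/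
def ν₀ : X.C.X ⟶ X.A.X := X.μ₀.hom ≫ dropLeft (one X.C) X.A ε[X.C.X]

/-- A quantum functor in concrete terms: comonoid maps `f` and `φ` compatible with the source, the
target, the composition and the identities. -/
structure IsFunctorPair {X Y : QuantumCategory V} (f : X.C ⟶ Y.C) (φ : X.A.X ⟶ Y.A.X) : Prop where
  graph : QuantumGraph.IsGraphMap (X := X.toQuantumGraph) (Y := Y.toQuantumGraph) f φ
  ν₂ : X.ν₂ ≫ φ = graph.pair ≫ Y.ν₂
  ν₀ : X.ν₀ ≫ φ = f.hom ≫ Y.ν₀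

end QuantumCategory

namespace QuantumFunctor

variable {X Y : QuantumCategory V} (F : QuantumFunctor X Y)

/-- The canonical map `A ⟶ A ⊗_E E` into the composite with the 1-cell `f^{*o} ⊗ f_*`, whose
underlying object is `E = C^o ⊗ C`. -/
def intoBase : X.A.X ⟶ (comp X.A (base F.f)).X :=
  lift (M := X.A) (N := base F.f) X.A.r (by
    have h := X.A.r_coassoc
    rw [reassoc_of% h, Comon.tensorObj_comul]
    simp)

/-- The map `φ : A ⟶ A'` on arrows determined by `σ`: the counit of `f^{*o} ⊗ f_*` applied to `σ`. -/
def φ : X.A.X ⟶ Y.A.X :=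
  F.intoBase ≫ F.σ.hom ≫ dropLeft (base F.f) Y.A ε[(env X.C).X]

end QuantumFunctor

end Concrete

end

/-!
Take 1-cells `K` and `K'` with maps of carriers to the unit object, called counits. A 2-cell
`κ : K ∘ G ⇒ G' ∘ K'`, where `K ∘ G` is `comp G K`, *lies over* a map `φ : G ⟶ G'` of
carriers (`Bicomod.IsOver`) if `κ` followed by the counit on the target is the counit on the source
followed by `φ`. This relation is stable under the operations of the bicategory: pasting two 2-cells
side by side gives a 2-cell over the restriction of `φ₁ ⊗ φ₂` (`paste_over`), and tensoring them
gives one over `φ₁ ⊗ φ₂` (`inter_over`).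

The 1-cell `f^{*o} ⊗ f_*` is the comonoid `E = C^o ⊗ C` with its right coaction pushed forward along
`f^o ⊗ f`. Hence its carrier is recovered from its left coaction, and `G ⊗_E E` is `G`, so that a
2-cell with values in `(f^{*o} ⊗ f_*) ⊗ N` is determined by its image in `N`
(`eq_of_base_dropLeft`), while the counit on the source can be cancelled (`dropRight_base_cancel`).
Thus `σ` is determined by the map `φ` over which it lies, and every map compatible with the
coactions underlies a 2-cell, namely its mate (`Cell.baseMate_over`).

The canonical cells `ω₂` and `ω₀` lie over `f ⊗ f ⊗ f` and `f`. Applying the counits to the axioms of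
a quantum functor therefore turns each of them into an equation between maps out of carriers, and
nothing is lost: the comonad map axioms say that `φ` is a comonoid map over `f^o ⊗ f`
(`isComonadMap_iff`), that is, a comonoid map compatible with source and target
(`QuantumGraph.isGraphMap_iff`); the square for the units says `φ ν₀ = ν₀ f`
(`QuantumCategory.square₀_iff`), because the carrier of `j` is recovered from its right coaction;
the square for the multiplications says `φ ν₂ = ν₂ (φ ⊗ φ)|` (`QuantumCategory.square₂_iff`), because
the carrier of `p` is recovered from its left coaction and the object of composable pairs is
isomorphic to the carrier of `p ∘ (A ⊗ A)`, naturally in `A` (`composableInv_composable`,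
`pair_composable`). Pairs `(f, φ)` compose, which gives the category.
-/

/-! ### 2-cells lying over maps of carriers -/

section Over

variable {V : Type u} [Category.{v} V] [MonoidalCategory V] [BraidedCategory V]
  [CoreflexiveTensor V]

namespace Bicomod

variable {B C D E B' C' D' E' : Comon V}

theorem wlHom_dropLeft (K : Bicomod C D) {N N' : Bicomod D E} (g : N ⟶ N') (q : K.X ⟶ 𝟙_ V) :
    wlHom K g ≫ dropLeft K N' q = dropLeft K N q ≫ g.hom := by
  rw [dropLeft, wlHom_ι_assoc, whisker_exchange_assoc, MonoidalCategory.leftUnitor_naturality]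
  simp [dropLeft]

theorem wrHom_dropLeft {K K' : Bicomod C D} (g : K ⟶ K') (N : Bicomod D E) (q : K'.X ⟶ 𝟙_ V) :
    wrHom g N ≫ dropLeft K' N q = dropLeft K N (g.hom ≫ q) := by
  rw [dropLeft, wrHom_ι_assoc, dropLeft, MonoidalCategory.comp_whiskerRight_assoc]

theorem wlHom_dropRight (M : Bicomod C D) {K K' : Bicomod D E} (g : K ⟶ K') (q : K'.X ⟶ 𝟙_ V) :
    wlHom M g ≫ dropRight M K' q = dropRight M K (g.hom ≫ q) := by
  rw [dropRight, wlHom_ι_assoc, dropRight, MonoidalCategory.whiskerLeft_comp_assoc]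

theorem wrHom_dropRight {M M' : Bicomod C D} (g : M ⟶ M') (K : Bicomod D E) (q : K.X ⟶ 𝟙_ V) :
    wrHom g K ≫ dropRight M' K q = dropRight M K q ≫ g.hom := by
  rw [dropRight, wrHom_ι_assoc, ← whisker_exchange_assoc, MonoidalCategory.rightUnitor_naturality]
  simp [dropRight]

/-- The 2-cell `κ : K ∘ G ⇒ G' ∘ K'` lies over the map `φ : G ⟶ G'`: on carriers, `κ` followed by
the counit `q'` of `K'` is the counit `q` of `K` followed by `φ`. The two counits are arbitrary maps
to the unit object. -/
def IsOver {G : Bicomod C D} {K : Bicomod D D'} {K' : Bicomod C C'} {G' : Bicomod C' D'}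
    (q : K.X ⟶ 𝟙_ V) (q' : K'.X ⟶ 𝟙_ V) (κ : comp G K ⟶ comp K' G') (φ : G.X ⟶ G'.X) : Prop :=
  κ.hom ≫ dropLeft K' G' q' = dropRight G K q ≫ φ

/-- The 2-cell `κ` whiskered with `G₁` and read up to associativity acts as `G₁ ⊗ φ` once `K₂` has
been dropped. It is the half of `paste_over` which applies also when the first square has no `K₁`, as
for the units. -/
theorem slide_over {G₁ : Bicomod B C} {G₂ : Bicomod C D} {K₂ : Bicomod C C'} {K₃ : Bicomod D D'}
    {G₂' : Bicomod C' D'} {q₂ : K₂.X ⟶ 𝟙_ V} {q₃ : K₃.X ⟶ 𝟙_ V}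
    {κ : comp G₂ K₃ ⟶ comp K₂ G₂'} {φ : G₂.X ⟶ G₂'.X} (h : IsOver q₃ q₂ κ φ) :
    assocHom G₁ G₂ K₃ ≫ wlHom G₁ κ ≫ assocInv G₁ K₂ G₂' ≫ ι (comp G₁ K₂) G₂' ≫
        dropRight G₁ K₂ q₂ ▷ G₂'.X =
      dropRight (comp G₁ G₂) K₃ q₃ ≫ ι G₁ G₂ ≫ G₁.X ◁ φ := by
  have e := assocInvAux_ι G₁ K₂ G₂'
  unfold IsOver at h
  calc
    _ = assocHom G₁ G₂ K₃ ≫ wlHom G₁ κ ≫ (assocInvAux G₁ K₂ G₂' ≫ ι G₁ K₂ ▷ G₂'.X) ≫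
        (G₁.X ◁ q₂ ≫ (ρ_ _).hom) ▷ G₂'.X := by
      rw [assocInv_ι_assoc, dropRight]; monoidal
    _ = assocHom G₁ G₂ K₃ ≫ (wlHom G₁ κ ≫ ι G₁ (comp K₂ G₂')) ≫ G₁.X ◁ dropLeft K₂ G₂' q₂ := by
      rw [e, dropLeft]; monoidal
    _ = (assocHom G₁ G₂ K₃ ≫ ι G₁ (comp G₂ K₃)) ≫
        G₁.X ◁ (κ.hom ≫ dropLeft K₂ G₂' q₂) := by
      rw [wlHom_ι]; monoidal
    _ = (assocAux G₁ G₂ K₃ ≫ G₁.X ◁ ι G₂ K₃) ≫ G₁.X ◁ (G₂.X ◁ q₃ ≫ (ρ_ _).hom ≫ φ) := by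
      rw [h, assocHom_ι, dropRight]; monoidal
    _ = ι (comp G₁ G₂) K₃ ≫ (ι G₁ G₂ ▷ K₃.X ≫ (G₁.X ⊗ G₂.X) ◁ q₃) ≫ (ρ_ _).hom ≫ G₁.X ◁ φ := by
      rw [assocAux_ι]; monoidal
    _ = _ := by
      rw [← whisker_exchange, dropRight]
      monoidal

/-- Pasting side by side two 2-cells which lie over `φ₁` and `φ₂` gives a 2-cell which lies over
the restriction of `φ₁ ⊗ φ₂`. -/
theorem paste_over {G₁ : Bicomod B C} {G₂ : Bicomod C D} {K₁ : Bicomod B B'} {K₂ : Bicomod C C'}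
    {K₃ : Bicomod D D'} {G₁' : Bicomod B' C'} {G₂' : Bicomod C' D'} {q₁ : K₁.X ⟶ 𝟙_ V}
    {q₂ : K₂.X ⟶ 𝟙_ V} {q₃ : K₃.X ⟶ 𝟙_ V} {κ₁ : comp G₁ K₂ ⟶ comp K₁ G₁'}
    {κ₂ : comp G₂ K₃ ⟶ comp K₂ G₂'} {φ₁ : G₁.X ⟶ G₁'.X} {φ₂ : G₂.X ⟶ G₂'.X}
    (h₁ : IsOver q₂ q₁ κ₁ φ₁) (h₂ : IsOver q₃ q₂ κ₂ φ₂) :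
    assocHom G₁ G₂ K₃ ≫ wlHom G₁ κ₂ ≫ assocInv G₁ K₂ G₂' ≫ wrHom κ₁ G₂' ≫
        assocHom K₁ G₁' G₂' ≫ dropLeft K₁ (comp G₁' G₂') q₁ ≫ ι G₁' G₂' =
      dropRight (comp G₁ G₂) K₃ q₃ ≫ ι G₁ G₂ ≫ (φ₁ ⊗ₘ φ₂) := by
  have e : assocHom K₁ G₁' G₂' ≫ dropLeft K₁ (comp G₁' G₂') q₁ ≫ ι G₁' G₂' =
      ι (comp K₁ G₁') G₂' ≫ dropLeft K₁ G₁' q₁ ▷ G₂'.X := by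
    calc
      _ = (assocHom K₁ G₁' G₂' ≫ ι K₁ (comp G₁' G₂')) ≫
          (q₁ ▷ (comp G₁' G₂').X ≫ 𝟙_ V ◁ ι G₁' G₂') ≫ (λ_ _).hom := by
        rw [dropLeft]; monoidal
      _ = (assocAux K₁ G₁' G₂' ≫ K₁.X ◁ ι G₁' G₂') ≫ q₁ ▷ (G₁'.X ⊗ G₂'.X) ≫ (λ_ _).hom := by
        rw [← whisker_exchange, assocHom_ι]; monoidal
      _ = _ := by rw [assocAux_ι, dropLeft]; monoidal
  have s := slide_over (G₁ := G₁) h₂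
  unfold IsOver at h₁
  rw [e, wrHom_ι_assoc, ← MonoidalCategory.comp_whiskerRight, h₁,
    MonoidalCategory.comp_whiskerRight, reassoc_of% s, MonoidalCategory.tensorHom_def']

theorem inter_dropLeft (M : Bicomod C D) (M' : Bicomod D E) (N : Bicomod C' D') (N' : Bicomod D' E')
    (q : M.X ⟶ 𝟙_ V) (q' : N.X ⟶ 𝟙_ V) :
    interHom M M' N N' ≫
        dropLeft (M.tensor N) (M'.tensor N') ((q ⊗ₘ q') ≫ (λ_ (𝟙_ V)).hom) =
      dropLeft M M' q ⊗ₘ dropLeft N N' q' := by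
  have h := leftUnitor_monoidal M'.X N'.X
  have i := interHom_ι M M' N N'
  rw [dropLeft, reassoc_of% i, MonoidalCategory.comp_whiskerRight, Category.assoc, tensorμ_wr_assoc,
    ← h, tensorHom_comp_tensorHom, tensorHom_comp_tensorHom]
  rfl

theorem interInv_dropRight (M : Bicomod C D) (M' : Bicomod D E) (N : Bicomod C' D')
    (N' : Bicomod D' E') (q : M'.X ⟶ 𝟙_ V) (q' : N'.X ⟶ 𝟙_ V) :
    interInv M M' N N' ≫ (dropRight M M' q ⊗ₘ dropRight N N' q') =
      dropRight (M.tensor N) (M'.tensor N') ((q ⊗ₘ q') ≫ (λ_ (𝟙_ V)).hom) := by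
  have h := rightUnitor_monoidal M.X N.X
  have i := interInv_ι M M' N N'
  rw [dropRight, dropRight, ← tensorHom_comp_tensorHom, reassoc_of% i, ← tensorHom_comp_tensorHom,
    h, ← tensorμ_wl_assoc, tensorδ_tensorμ_assoc, dropRight, MonoidalCategory.whiskerLeft_comp,
    Category.assoc]

/-- Conjugated by the interchange isomorphisms, the tensor product of two 2-cells which lie over `φ`
and `φ₁` lies over `φ ⊗ φ₁`. -/
theorem inter_over {G : Bicomod C D} {K : Bicomod D D'} {K' : Bicomod C C'} {G' : Bicomod C' D'}
    {q : K.X ⟶ 𝟙_ V} {q' : K'.X ⟶ 𝟙_ V} {κ : comp G K ⟶ comp K' G'} {φ : G.X ⟶ G'.X}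
    (h : IsOver q q' κ φ) {C₁ D₁ C₁' D₁' : Comon V} {G₁ : Bicomod C₁ D₁} {K₁ : Bicomod D₁ D₁'}
    {K₁' : Bicomod C₁ C₁'} {G₁' : Bicomod C₁' D₁'} {q₁ : K₁.X ⟶ 𝟙_ V} {q₁' : K₁'.X ⟶ 𝟙_ V}
    {κ₁ : comp G₁ K₁ ⟶ comp K₁' G₁'} {φ₁ : G₁.X ⟶ G₁'.X} (h₁ : IsOver q₁ q₁' κ₁ φ₁) :
    IsOver ((q ⊗ₘ q₁) ≫ (λ_ (𝟙_ V)).hom) ((q' ⊗ₘ q₁') ≫ (λ_ (𝟙_ V)).hom)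
      ((inter G K G₁ K₁).inv ≫ tensorMap κ κ₁ ≫ (inter K' G' K₁' G₁').hom) (φ ⊗ₘ φ₁) := by
  unfold IsOver at *
  have i := interInv_dropRight G K G₁ K₁ q q₁
  rw [← i]
  change (interInv G K G₁ K₁ ≫ (κ.hom ⊗ₘ κ₁.hom) ≫ interHom K' G' K₁' G₁') ≫ _ = _
  have j := inter_dropLeft K' G' K₁' G₁' q' q₁'
  rw [Category.assoc, Category.assoc, j, tensorHom_comp_tensorHom, h, h₁,
    ← tensorHom_comp_tensorHom, Category.assoc]

/-- A map into `K ⊗ N` (over the middle comonoid) which respects the left coactions is determined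
by its image in `N`, if the carrier of `K` can be recovered from its left coaction. -/
theorem eq_of_dropLeft {K : Bicomod C D} {N : Bicomod D E} {T : V} {f g : T ⟶ (comp K N).X}
    (t : T ⟶ C.X ⊗ T) (hf : f ≫ (comp K N).l = t ≫ C.X ◁ f)
    (hg : g ≫ (comp K N).l = t ≫ C.X ◁ g) (q : K.X ⟶ 𝟙_ V) (z : C.X ⟶ K.X)
    (hz : (K.l ≫ C.X ◁ q ≫ (ρ_ C.X).hom) ≫ z = 𝟙 K.X)
    (h : f ≫ dropLeft K N q = g ≫ dropLeft K N q) : f = g := by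
  have e : (comp K N).l ≫ C.X ◁ dropLeft K N q ≫ z ▷ N.X = ι K N := by
    calc
      _ = ((comp K N).l ≫ C.X ◁ ι K N) ≫ C.X ◁ (q ▷ N.X ≫ (λ_ N.X).hom) ≫ z ▷ N.X := by
        rw [dropLeft]; monoidal
      _ = ι K N ≫ ((K.l ≫ C.X ◁ q ≫ (ρ_ C.X).hom) ≫ z) ▷ N.X := by
        rw [l_ι]; monoidal
      _ = _ := by rw [hz]; simp
  apply comp_ext
  rw [← e, reassoc_of% hf, reassoc_of% hg, ← MonoidalCategory.whiskerLeft_comp_assoc, h,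
    MonoidalCategory.whiskerLeft_comp_assoc]

/-- A map into `K ⊗ N` (over the middle comonoid) is determined by its image in `N`, if the carrier
of `K` can be recovered from its right coaction. -/
theorem eq_of_dropLeft_right {K : Bicomod C D} {N : Bicomod D E} {T : V} {f g : T ⟶ (comp K N).X}
    (q : K.X ⟶ 𝟙_ V) (z : D.X ⟶ K.X) (hz : (K.r ≫ q ▷ D.X ≫ (λ_ D.X).hom) ≫ z = 𝟙 K.X)
    (h : f ≫ dropLeft K N q = g ≫ dropLeft K N q) : f = g := by
  have e : dropLeft K N q ≫ N.l ≫ z ▷ N.X = ι K N := by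
    have i := ι_cond K N
    calc
      _ = ι K N ≫ (q ▷ N.X ≫ 𝟙_ V ◁ N.l) ≫ (λ_ _).hom ≫ z ▷ N.X := by
        rw [dropLeft]; monoidal
      _ = (ι K N ≫ K.X ◁ N.l) ≫ q ▷ (D.X ⊗ N.X) ≫ (λ_ _).hom ≫ z ▷ N.X := by
        rw [← whisker_exchange]; monoidal
      _ = ι K N ≫ ((K.r ≫ q ▷ D.X ≫ (λ_ D.X).hom) ≫ z) ▷ N.X := by
        rw [i]; monoidal
      _ = _ := by rw [hz]; simp
  apply comp_ext
  rw [← e, reassoc_of% h]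

/-- The middle coaction on `M ⊗_D K` can be read off on either factor. -/
theorem dropRight_coaction (M : Bicomod C D) (K : Bicomod D E) (q : K.X ⟶ 𝟙_ V) :
    dropRight M K q ≫ M.r = ι M K ≫ M.X ◁ (K.l ≫ D.X ◁ q ≫ (ρ_ D.X).hom) := by
  have i := ι_cond M K
  calc
    _ = ι M K ≫ (M.X ◁ q ≫ M.r ▷ 𝟙_ V) ⊗≫ 𝟙 _ := by rw [dropRight]; monoidal
    _ = (ι M K ≫ M.r ▷ K.X ≫ (α_ _ _ _).hom) ≫ M.X ◁ (D.X ◁ q) ⊗≫ 𝟙 _ := by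
      rw [whisker_exchange]; monoidal
    _ = _ := by rw [← i]; monoidal

/-- A map into `M ⊗ K` (over the middle comonoid) is determined by its image in `M`, if the carrier
of `K` can be recovered from its left coaction. -/
theorem eq_of_dropRight {M : Bicomod C D} {K : Bicomod D E} {T : V} {f g : T ⟶ (comp M K).X}
    (q : K.X ⟶ 𝟙_ V) (z : D.X ⟶ K.X)
    (hz : (K.l ≫ D.X ◁ q ≫ (ρ_ D.X).hom) ≫ z = 𝟙 K.X)
    (h : f ≫ dropRight M K q = g ≫ dropRight M K q) : f = g := by
  have e : dropRight M K q ≫ M.r ≫ M.X ◁ z = ι M K := by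
    have d := dropRight_coaction M K q
    rw [reassoc_of% d, ← MonoidalCategory.whiskerLeft_comp, hz]; simp
  apply comp_ext
  rw [← e, reassoc_of% h]

/-! ### Maps induced by cells -/

theorem Cell.pair_ι {g : C ⟶ C'} {h : D ⟶ D'} {k : E ⟶ E'}
    {M : Bicomod C D} {M' : Bicomod C' D'} {N : Bicomod D E} {N' : Bicomod D' E'}
    (u : Cell g h M M') (w : Cell h k N N') :
    u.pair w ≫ ι M' N' = ι M N ≫ (u.hom ⊗ₘ w.hom) := lift_ι _ _

theorem Cell.pair_l {g : C ⟶ C'} {h : D ⟶ D'} {k : E ⟶ E'}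
    {M : Bicomod C D} {M' : Bicomod C' D'} {N : Bicomod D E} {N' : Bicomod D' E'}
    (u : Cell g h M M') (w : Cell h k N N') :
    u.pair w ≫ (comp M' N').l = (comp M N).l ≫ (g.hom ⊗ₘ u.pair w) := by
  apply tcancel (C'.X ◁ ι M' N')
  have e := u.pair_ι w
  have e' := l_ι M N
  rw [Category.assoc, l_ι, reassoc_of% e, Category.assoc, ← id_tensorHom,
    tensorHom_comp_tensorHom, Category.comp_id, e, ← tensorHom_id, tensorHom_comp_tensorHom_assoc,
    u.l_comm, Category.comp_id]
  calc
    _ = (ι M N ≫ M.l ▷ N.X ≫ (α_ _ _ _).hom) ≫ (g.hom ⊗ₘ (u.hom ⊗ₘ w.hom)) := by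
      rw [Category.assoc, Category.assoc, ← MonoidalCategory.associator_naturality, ← tensorHom_id,
        tensorHom_comp_tensorHom_assoc, Category.id_comp]
    _ = _ := by
      rw [← e', Category.assoc, ← id_tensorHom, tensorHom_comp_tensorHom, Category.id_comp]

theorem Cell.pair_dropLeft {g : C ⟶ C'} {h : D ⟶ D'} {k : E ⟶ E'}
    {M : Bicomod C D} {M' : Bicomod C' D'} {N : Bicomod D E} {N' : Bicomod D' E'}
    (u : Cell g h M M') (w : Cell h k N N') (q : M.X ⟶ 𝟙_ V) (q' : M'.X ⟶ 𝟙_ V)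
    (e : u.hom ≫ q' = q) : u.pair w ≫ dropLeft M' N' q' = dropLeft M N q ≫ w.hom := by
  have i := u.pair_ι w
  rw [dropLeft, reassoc_of% i, ← tensorHom_id, tensorHom_comp_tensorHom_assoc, e, Category.comp_id,
    MonoidalCategory.tensorHom_def, Category.assoc, MonoidalCategory.leftUnitor_naturality,
    dropLeft, Category.assoc, Category.assoc]

theorem Cell.pair_dropRight {g : C ⟶ C'} {h : D ⟶ D'} {k : E ⟶ E'}
    {M : Bicomod C D} {M' : Bicomod C' D'} {N : Bicomod D E} {N' : Bicomod D' E'}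
    (u : Cell g h M M') (w : Cell h k N N') (q : N.X ⟶ 𝟙_ V) (q' : N'.X ⟶ 𝟙_ V)
    (e : w.hom ≫ q' = q) : u.pair w ≫ dropRight M' N' q' = dropRight M N q ≫ u.hom := by
  have i := u.pair_ι w
  rw [dropRight, reassoc_of% i, ← id_tensorHom, tensorHom_comp_tensorHom_assoc, e, Category.comp_id,
    MonoidalCategory.tensorHom_def', Category.assoc, MonoidalCategory.rightUnitor_naturality,
    dropRight, Category.assoc, Category.assoc]

/-- The 2-cell determined by a cell lies over the map underlying the cell. -/
theorem Cell.mate_over {g : C ⟶ C'} {h : D ⟶ D'} {M : Bicomod C D} {M' : Bicomod C' D'}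
    (u : Cell g h M M') : IsOver (K := lower h) (K' := lower g) ε[D.X] ε[C.X] u.mate u.hom := by
  have e := u.pullHom_ι
  change (collapse M h ≫ u.pullHom) ≫ dropLeft (lower g) M' ε[C.X] = collapse M h ≫ u.hom
  rw [Category.assoc, dropLeft, reassoc_of% e, whisker_exchange_assoc]
  have l := M.l_counit
  rw [reassoc_of% l, MonoidalCategory.leftUnitor_naturality, Iso.inv_hom_id_assoc]

end Bicomod
end Over

/-! ### The 1-cell determined by a comonoid map -/

section Base

variable {V : Type u} [Category.{v} V] [MonoidalCategory V] [BraidedCategory V]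

namespace Bicomod

variable {B C D : Comon V} (f : C ⟶ D)

theorem base_l_counit :
    (base f).l ≫ (env C).X ◁ ε[(env C).X] ≫ (ρ_ (env C).X).hom = 𝟙 (env C).X := by
  have e : (base f).l = Δ[(env C).X] := by rw [Comon.tensorObj_comul]
  have h := ComonObj.comul_counit (env C).X
  rw [e, reassoc_of% h, Iso.inv_hom_id]

theorem base_r : (base f).r = Δ[(env C).X] ≫ (env C).X ◁ (envMap f).hom := by
  have h := (lowerTens (Comon.oppMap f) f).hom.r_comm
  change 𝟙 _ ≫ (lower (Comon.tensMap (Comon.oppMap f) f)).r = (base f).r ≫ 𝟙 _ ▷ _ at h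
  simpa using h.symm

/-- On the carrier of `f^{*o} ⊗ f_*`, the right coaction followed by the counit is `f^o ⊗ f`. -/
theorem base_r_counit :
    (base f).r ≫ ε[(env C).X] ▷ (env D).X ≫ (λ_ (env D).X).hom = (envMap f).hom := by
  have h := ComonObj.counit_comul (env C).X
  rw [base_r, Category.assoc, whisker_exchange_assoc, reassoc_of% h,
    MonoidalCategory.leftUnitor_naturality, Iso.inv_hom_id_assoc]

theorem counit_tens (C D : Comon V) :
    ε[(C.tens D).X] = (ε[C.X] ⊗ₘ ε[D.X]) ≫ (λ_ (𝟙_ V)).hom := by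
  rw [Comon.tensorObj_counit]

theorem base_tensor_base_l_counit :
    ((base f).tensor (base f)).l ≫
        ((env C).tens (env C)).X ◁ ε[((env C).tens (env C)).X] ≫ (ρ_ _).hom = 𝟙 _ := by
  have h := tensor_l_counit (base f) (base f) ε[(env C).X] ε[(env C).X]
  have b := base_l_counit f
  rw [b] at h
  rw [counit_tens (env C) (env C)]
  exact h.trans (by simp)

theorem mulCell_counit : (mulCell f).hom ≫ mulCounit D = mulCounit C :=
  (Comon.tensMap (Comon.tensMap (Comon.oppMap f) f) f).isComonHom_hom.hom_counit

theorem envMap_fst : (envMap f).hom ≫ (D.opp.fst D).hom = (C.opp.fst C).hom ≫ f.hom := by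
  dsimp only [Comon.fst]
  rw [← id_tensorHom, tensorHom_comp_tensorHom_assoc, IsComonHom.hom_counit, Category.comp_id,
    MonoidalCategory.tensorHom_def', Category.assoc, MonoidalCategory.rightUnitor_naturality,
    Category.assoc]

theorem envMap_snd : (envMap f).hom ≫ (D.opp.snd D).hom = (C.opp.snd C).hom ≫ f.hom := by
  dsimp only [Comon.snd]
  rw [← tensorHom_id, tensorHom_comp_tensorHom_assoc, Comon.opp_counit, IsComonHom.hom_counit,
    Category.comp_id, MonoidalCategory.tensorHom_def, Category.assoc,
    MonoidalCategory.leftUnitor_naturality, Comon.opp_counit, Category.assoc]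

variable [CoreflexiveTensor V]

/-- The inverse of `dropRight` for the 1-cell `f^{*o} ⊗ f_*`: the canonical map `G ⟶ G ⊗_E E` into
the composite, where `E = C^o ⊗ C`. -/
noncomputable def intoComp (G : Bicomod B (env C)) : G.X ⟶ (comp G (base f)).X :=
  lift (M := G) (N := base f) G.r (by
    have h := G.r_coassoc
    rw [reassoc_of% h, Comon.tensorObj_comul]
    simp)

theorem intoComp_dropRight (G : Bicomod B (env C)) :
    intoComp f G ≫ dropRight G (base f) ε[(env C).X] = 𝟙 G.X := by
  have h := G.r_counit
  rw [intoComp, dropRight, lift_ι_assoc, reassoc_of% h, Iso.inv_hom_id]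

theorem dropRight_base_cancel {G : Bicomod B (env C)} {T : V} {g h : G.X ⟶ T}
    (e : dropRight G (base f) ε[(env C).X] ≫ g = dropRight G (base f) ε[(env C).X] ≫ h) :
    g = h := by
  have i := intoComp_dropRight f G
  have e' := intoComp f G ≫= e
  rwa [reassoc_of% i, reassoc_of% i] at e'

theorem dropRight_intoComp (G : Bicomod B (env C)) :
    dropRight G (base f) ε[(env C).X] ≫ intoComp f G = 𝟙 _ := by
  apply eq_of_dropRight (K := base f) ε[(env C).X] (𝟙 _)
  · rw [base_l_counit]; exact Category.comp_id _
  · have i := intoComp_dropRight f G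
    rw [Category.assoc, i, Category.comp_id, Category.id_comp]

/-- A 2-cell with values in the composite of `f^{*o} ⊗ f_*` and `N` is determined by its image in
`N`. -/
theorem eq_of_base_dropLeft {P : Bicomod (env C) B} {N : Bicomod (env D) B}
    {κ κ' : P ⟶ comp (base f) N}
    (h : κ.hom ≫ dropLeft (base f) N ε[(env C).X] = κ'.hom ≫ dropLeft (base f) N ε[(env C).X]) :
    κ = κ' := by
  apply hom_ext
  refine eq_of_dropLeft P.l κ.l_comm κ'.l_comm ε[(env C).X] (𝟙 _) ?_ h
  rw [base_l_counit]; exact Category.comp_id _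

theorem IsOver.whisker {C D C' D' : Comon V} {G : Bicomod C D} {K K₁ : Bicomod D D'}
    {K' K₁' : Bicomod C C'} {G' : Bicomod C' D'} {q : K.X ⟶ 𝟙_ V} {q' : K'.X ⟶ 𝟙_ V}
    {κ : comp G K ⟶ comp K' G'} {φ : G.X ⟶ G'.X} (h : IsOver q q' κ φ) (a : K₁ ⟶ K)
    (b : K' ⟶ K₁') {q₁ : K₁.X ⟶ 𝟙_ V} {q₁' : K₁'.X ⟶ 𝟙_ V} (ha : a.hom ≫ q = q₁)
    (hb : b.hom ≫ q₁' = q') : IsOver q₁ q₁' (wl G a ≫ κ ≫ wr b G') φ := by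
  unfold IsOver at *
  have l := wlHom_dropRight G a q
  rw [comp_hom, comp_hom, wl_hom, wr_hom, Category.assoc, Category.assoc, wrHom_dropLeft, hb, h,
    reassoc_of% l, ha]

/-- The 2-cell `(f^{*o} ⊗ f_*) ∘ G ⇒ G' ∘ (f^{*o} ⊗ f_*)` determined by a cell. -/
noncomputable def Cell.baseMate {f : C ⟶ D} {G : Bicomod (env C) (env C)}
    {G' : Bicomod (env D) (env D)}
    (u : Cell (envMap f) (envMap f) G G') : comp G (base f) ⟶ comp (base f) G' :=
  wl G (lowerTens (Comon.oppMap f) f).hom ≫ u.mate ≫ wr (lowerTens (Comon.oppMap f) f).inv G'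

theorem Cell.baseMate_over {f : C ⟶ D} {G : Bicomod (env C) (env C)}
    {G' : Bicomod (env D) (env D)} (u : Cell (envMap f) (envMap f) G G') :
    IsOver (K := base f) (K' := base f) ε[(env C).X] ε[(env C).X] u.baseMate u.hom :=
  u.mate_over.whisker _ _ (Category.id_comp _) (Category.id_comp _)

theorem omega₂_over : IsOver (K := base f) (K' := (base f).tensor (base f)) ε[(env C).X]
    ε[((env C).tens (env C)).X] (omega₂ f) (mulCell f).hom :=
  (mulCell f).mate_over.whisker _ _ (Category.id_comp _) (by
    change (𝟙 _ ≫ (𝟙 _ ⊗ₘ 𝟙 _)) ≫ _ = _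
    simp)

theorem omega₀_hom :
    (omega₀ f).hom = dropRight (one C) (base f) ε[(env C).X] ≫ f.hom := by
  have h := wlHom_dropRight (one C) (lowerTens (Comon.oppMap f) f).hom ε[(env C).X]
  change wlHom (one C) (lowerTens (Comon.oppMap f) f).hom ≫
    dropRight (one C) (lower (Comon.tensMap (Comon.oppMap f) f)) ε[(env C).X] ≫ f.hom = _
  rw [reassoc_of% h]
  exact congrArg (fun q => dropRight (one C) (base f) q ≫ f.hom) (Category.id_comp _)

/-- The canonical 2-cell between the composites of `f^{*o} ⊗ f_*` with identity 1-cells lies over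
`f^o ⊗ f`. -/
theorem lunit_runit_dropLeft :
    (lunit (base f)).hom.hom ≫ (runit (base f)).inv.hom ≫
        dropLeft (base f) (reg (env D)) ε[(env C).X] =
      dropRight (reg (env C)) (base f) ε[(env C).X] ≫ (envMap f).hom := by
  have i := runit_inv_hom_ι (base f)
  have d := dropRight_coaction (reg (env C)) (base f) ε[(env C).X]
  have b := base_l_counit f
  have b' := base_r_counit f
  rw [b, MonoidalCategory.whiskerLeft_id, Category.comp_id] at d
  have e : (lunit (base f)).hom.hom = dropRight (reg (env C)) (base f) ε[(env C).X] := by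
    have h := ComonObj.counit_comul (env C).X =≫ (λ_ (env C).X).hom
    rw [Iso.inv_hom_id, Category.assoc] at h
    rw [lunit_hom_hom, ← d, Category.assoc]
    exact (congrArg (dropRight (reg (env C)) (base f) ε[(env C).X] ≫ ·) h).trans
      (Category.comp_id _)
  rw [e]
  refine congrArg (dropRight (reg (env C)) (base f) ε[(env C).X] ≫ ·) ?_
  rw [dropLeft, ← Category.assoc, i]
  exact b'

end Bicomod
end Base

/-! ### Comonad maps -/

section ComonadMaps

variable {V : Type u} [Category.{v} V] [MonoidalCategory V] [BraidedCategory V]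
  [CoreflexiveTensor V]

namespace Bicomod

variable {C D : Comon V} {f : C ⟶ D} {G : Bicomod (env C) (env C)} {G' : Bicomod (env D) (env D)}

/-- For a 2-cell over `φ`, the axioms of a comonad map say that `φ` respects the comultiplications
and the counits. -/
theorem isComonadMap_iff (d : ComonadData G) (d' : ComonadData G')
    {κ : comp G (base f) ⟶ comp (base f) G'} {φ : G.X ⟶ G'.X}
    (h : IsOver (K := base f) (K' := base f) ε[(env C).X] ε[(env C).X] κ φ) :
    IsComonadMap d d' (base f) κ ↔
      φ ≫ d'.comul.hom ≫ ι G' G' = d.comul.hom ≫ ι G G ≫ (φ ⊗ₘ φ) ∧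
        φ ≫ d'.counit.hom = d.counit.hom ≫ (envMap f).hom := by
  have p := paste_over h h
  have r₁ := wrHom_dropRight d.comul (base f) ε[(env C).X]
  have r₂ := wrHom_dropRight d.counit (base f) ε[(env C).X]
  have l₁ := wlHom_dropLeft (base f) d'.comul ε[(env C).X]
  have l₂ := wlHom_dropLeft (base f) d'.counit ε[(env C).X]
  have u := lunit_runit_dropLeft f
  unfold IsOver at h
  have a₁ : (wr d.comul (base f) ≫ (assoc G G (base f)).hom ≫ wl G κ ≫ (assoc G (base f) G').inv ≫
      wr κ G' ≫ (assoc (base f) G' G').hom).hom ≫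
        dropLeft (base f) (comp G' G') ε[(env C).X] ≫ ι G' G' =
      dropRight G (base f) ε[(env C).X] ≫ d.comul.hom ≫ ι G G ≫ (φ ⊗ₘ φ) := by
    simp only [comp_hom, wr_hom, wl_hom, assoc_hom_hom, assoc_inv_hom, Category.assoc]
    rw [p, reassoc_of% r₁]
  have a₂ : (κ ≫ wl (base f) d'.comul).hom ≫
        dropLeft (base f) (comp G' G') ε[(env C).X] ≫ ι G' G' =
      dropRight G (base f) ε[(env C).X] ≫ φ ≫ d'.comul.hom ≫ ι G' G' := by
    rw [comp_hom, wl_hom, Category.assoc, reassoc_of% l₁, reassoc_of% h]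
  have b₁ : (wr d.counit (base f) ≫ (lunit (base f)).hom ≫ (runit (base f)).inv).hom ≫
        dropLeft (base f) (reg (env D)) ε[(env C).X] =
      dropRight G (base f) ε[(env C).X] ≫ d.counit.hom ≫ (envMap f).hom := by
    rw [comp_hom, comp_hom, wr_hom, Category.assoc, Category.assoc, u, reassoc_of% r₂]
  have b₂ : (κ ≫ wl (base f) d'.counit).hom ≫ dropLeft (base f) (reg (env D)) ε[(env C).X] =
      dropRight G (base f) ε[(env C).X] ≫ φ ≫ d'.counit.hom := by
    rw [comp_hom, wl_hom, Category.assoc, l₂, reassoc_of% h]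
  constructor
  · intro m
    constructor
    · have e := m.comul
      apply dropRight_base_cancel f
      rw [← a₁, ← a₂, e]
    · have e := m.counit =≫ (runit (base f)).inv
      simp only [Category.assoc, Iso.hom_inv_id, Category.comp_id] at e
      apply dropRight_base_cancel f
      rw [← b₁, ← b₂, e]
  · rintro ⟨m₁, m₂⟩
    constructor
    · apply eq_of_base_dropLeft f
      apply comp_ext
      rw [Category.assoc, Category.assoc, a₁, a₂, m₁]
    · rw [← cancel_mono (runit (base f)).inv]
      simp only [Category.assoc, Iso.hom_inv_id, Category.comp_id]
      apply eq_of_base_dropLeft f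
      rw [b₁, b₂, m₂]

end Bicomod
end ComonadMaps

/-! ### Composable pairs of arrows -/

section ComposablePairs

variable {V : Type u} [Category.{v} V] [MonoidalCategory V] [BraidedCategory V]
  [CoreflexiveTensor V]

namespace Bicomod

variable {C : Comon V}

theorem comul_fst_snd_counit (C : Comon V) (x : C.X ⊗ C.X ⟶ C.X) :
    (C.X ◁ Δ[C.X]) ▷ C.X ≫ ((C.opp.tens (C.tens C.opp)).fst C).hom ≫
        (C.opp.snd (C.tens C.opp)).hom ≫ x =
      (C.X ⊗ C.X) ◁ ε[C.X] ≫ (ρ_ (C.X ⊗ C.X)).hom ≫ ε[C.X] ▷ C.X ≫ (λ_ C.X).hom ≫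
        Δ[C.X] ≫ x := by
  dsimp only [Comon.fst, Comon.snd]
  rw [Comon.opp_counit]
  simp only [Category.assoc]
  calc
    _ = ((C.X ◁ Δ[C.X]) ▷ C.X ≫ (C.X ⊗ C.X ⊗ C.X) ◁ ε[C.X]) ≫ (ρ_ _).hom ≫
        ε[C.X] ▷ (C.X ⊗ C.X) ≫ (λ_ _).hom ≫ x := by simp only [Category.assoc]
    _ = (C.X ⊗ C.X) ◁ ε[C.X] ≫ (ρ_ _).hom ≫ (C.X ◁ Δ[C.X] ≫ ε[C.X] ▷ (C.X ⊗ C.X)) ≫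
        (λ_ _).hom ≫ x := by
      rw [← whisker_exchange]; monoidal
    _ = _ := by rw [whisker_exchange]; monoidal

/-- On the carrier of `p ∘ (A ⊗ A)` the coactions of the second and of the third factor of
`C^o ⊗ C ⊗ C^o ⊗ C` agree. -/
theorem dropRight_mul_cond {E : Comon V} (A : Bicomod E (env C)) :
    dropRight (A.tensor A) (mul C) (mulCounit C) ≫ A.unfold.r ▷ A.X ≫ (α_ _ _ _).hom =
      dropRight (A.tensor A) (mul C) (mulCounit C) ≫ A.X ◁ A.unfold.l := by
  obtain ⟨k, hk⟩ : ∃ k, k = dropRight (A.tensor A) (mul C) (mulCounit C) := ⟨_, rfl⟩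
  have h₁ := tensor_r_fst A A (C.opp.snd C).hom
  have h₂ := tensor_r_snd A A (C.opp.fst C).hom
  have e₁ := midInv_fst C
  have e₂ := midInv_snd C
  have d := dropRight_coaction (A.tensor A) (mul C) (mulCounit C)
  have m := mul_l_counit C
  have i := mid_midInv C
  have s : ∀ y : (C.X ⊗ (C.X ⊗ C.X)) ⊗ C.X ⟶ C.X,
      k ≫ (A.tensor A).r ≫ (A.X ⊗ A.X) ◁ (midInv C ≫ y) =
        ι (A.tensor A) (mul C) ≫ (A.X ⊗ A.X) ◁ ((C.X ◁ Δ[C.X]) ▷ C.X ≫ y) := by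
    intro y
    rw [← hk] at d
    refine (Category.assoc _ _ _).symm.trans ((congrArg (· ≫ _) d).trans ?_)
    refine (Category.assoc _ _ _).trans (congrArg (ι (A.tensor A) (mul C) ≫ ·) ?_)
    refine (MonoidalCategory.whiskerLeft_comp _ _ _).symm.trans (congrArg ((A.X ⊗ A.X) ◁ ·) ?_)
    refine (congrArg (· ≫ midInv C ≫ y) m).trans ((Category.assoc _ _ _).trans ?_)
    exact congrArg ((C.X ◁ Δ[C.X]) ▷ C.X ≫ ·) ((Category.assoc _ _ _).symm.trans
      ((congrArg (· ≫ y) i).trans (Category.id_comp _)))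
  -- The two middle factors of the coaction come from one comultiplication of the middle factor of
  -- `p`, so that both projections give the same map.
  have c : ∀ x : C.X ⊗ C.X ⟶ C.X, Δ[C.X] ≫ x = 𝟙 C.X →
      k ≫ (A.tensor A).r ≫ (A.X ⊗ A.X) ◁ (midInv C ≫
        ((C.opp.tens (C.tens C.opp)).fst C).hom ≫ (C.opp.snd (C.tens C.opp)).hom ≫ x) =
      ι (A.tensor A) (mul C) ≫ (A.X ⊗ A.X) ◁ ((C.X ⊗ C.X) ◁ ε[C.X] ≫ (ρ_ (C.X ⊗ C.X)).hom ≫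
        ε[C.X] ▷ C.X ≫ (λ_ C.X).hom) := by
    intro x hx
    rw [s, comul_fst_snd_counit, hx, Category.comp_id]
  have c₁ : Δ[C.X] ≫ (C.fst C.opp).hom = 𝟙 C.X := by
    dsimp only [Comon.fst]
    rw [Comon.opp_counit, ComonObj.comul_counit_assoc, Iso.inv_hom_id]
  have c₂ : Δ[C.X] ≫ (C.snd C.opp).hom = 𝟙 C.X := by
    dsimp only [Comon.snd]
    rw [ComonObj.counit_comul_assoc, Iso.inv_hom_id]
  have key := (c _ c₁).trans (c _ c₂).symm
  rw [e₁, e₂] at key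
  have key' : k ≫ ((A.r ≫ A.X ◁ (C.opp.snd C).hom) ▷ A.X ≫ (α_ _ _ _).hom ≫
      A.X ◁ (β_ C.X A.X).hom ≫ (α_ _ _ _).inv) =
      k ≫ (A.X ◁ (A.r ≫ A.X ◁ (C.opp.fst C).hom) ≫ (α_ _ _ _).inv) :=
    (congrArg (k ≫ ·) h₁).symm.trans (key.trans (congrArg (k ≫ ·) h₂))
  have key'' := congrArg (· ≫ (α_ A.X A.X C.X).hom ≫ A.X ◁ (β_ C.X A.X).inv) key'
  rw [← hk]
  simpa using key''

/-- The inverse of `composable A`. -/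
noncomputable def composableInv {E : Comon V} (A : Bicomod E (env C)) :
    (comp (A.tensor A) (mul C)).X ⟶ (comp A.unfold A.unfold).X :=
  lift (M := A.unfold) (N := A.unfold) (dropRight (A.tensor A) (mul C) (mulCounit C))
    (dropRight_mul_cond A)

theorem eq_of_mul_dropRight {E : Comon V} {M : Bicomod E ((env C).tens (env C))} {T : V}
    {g h : T ⟶ (comp M (mul C)).X}
    (e : g ≫ dropRight M (mul C) (mulCounit C) = h ≫ dropRight M (mul C) (mulCounit C)) : g = h :=
  eq_of_dropRight (mulCounit C) (midFst C) (mul_retract C) e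

theorem composableInv_composable {E : Comon V} (A : Bicomod E (env C)) :
    composableInv A ≫ composable A = 𝟙 _ := by
  apply eq_of_mul_dropRight
  rw [Category.assoc, composable_dropRight, composableInv, lift_ι, Category.id_comp]

/-- The canonical maps from the objects of composable pairs are natural. -/
theorem pair_composable {D : Comon V} {f : C ⟶ D} {A : Bicomod (env C) (env C)}
    {A' : Bicomod (env D) (env D)} (u : Cell (envMap f) (envMap f) A A')
    (w : Cell f f A.unfold A'.unfold) (h : w.hom = u.hom) :
    w.pair w ≫ composable A' = composable A ≫ (u.tensor u).pair (mulCell f) := by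
  apply eq_of_mul_dropRight
  have c := composable_dropRight A
  have p := (u.tensor u).pair_dropRight (mulCell f) (mulCounit C) (mulCounit D) (mulCell_counit f)
  rw [Category.assoc, Category.assoc, composable_dropRight, p, Cell.pair_ι, reassoc_of% c, h]

end Bicomod
end ComposablePairs

/-! ### Maps of quantum graphs -/

section GraphMaps

variable {V : Type u} [Category.{v} V] [MonoidalCategory V] [BraidedCategory V]
  [CoreflexiveTensor V]

open Bicomod

namespace QuantumGraph

/-- The counit `A ⟶ C^o ⊗ C` is the pairing of source and target. -/
theorem counit_hom_eq (X : QuantumGraph V) : X.str.counit.hom = X.comul ≫ (X.src ⊗ₘ X.tgt) := by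
  have h : X.str.counit.hom ≫ Δ[(env X.C).X] = X.A.r ≫ X.str.counit.hom ▷ (env X.C).X :=
    X.str.counit.r_comm
  have p := Comon.comul_fst_snd X.C.opp X.C
  have r := X.comul_r
  rw [src, tgt, ← tensorHom_comp_tensorHom, MonoidalCategory.tensorHom_def' X.str.counit.hom,
    Category.assoc, ← Category.assoc X.comul, r, ← Category.assoc X.A.r, ← h, Category.assoc]
  exact ((congrArg (X.str.counit.hom ≫ ·) p).trans (Category.comp_id _)).symm

variable {X Y : QuantumGraph V} {f : X.C ⟶ Y.C} {φ : X.A.X ⟶ Y.A.X}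

/-- Compatibility with the counit of `A`, source and target amounts to compatibility with the
counit 2-cell `A ⟶ C^o ⊗ C`. -/
theorem isGraphMap_iff : IsGraphMap f φ ↔ φ ≫ Y.comul = X.comul ≫ (φ ⊗ₘ φ) ∧
    φ ≫ Y.str.counit.hom = X.str.counit.hom ≫ (envMap f).hom := by
  constructor
  · intro h
    have c := h.comul
    refine ⟨c, ?_⟩
    rw [counit_hom_eq, counit_hom_eq X, reassoc_of% c, tensorHom_comp_tensorHom, h.src, h.tgt,
      Category.assoc, tensorHom_comp_tensorHom]
  · rintro ⟨h₁, h₂⟩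
    have c := (envMap f).isComonHom_hom.hom_counit
    refine ⟨h₁, ?_, ?_, ?_⟩
    · rw [counit, counit, ← Category.assoc, h₂, Category.assoc, c]
    · have e := envMap_fst f
      rw [src, src, ← Category.assoc, h₂, Category.assoc, e]
      exact (Category.assoc _ _ _).symm
    · have e := envMap_snd f
      rw [tgt, tgt, ← Category.assoc, h₂, Category.assoc, e]
      exact (Category.assoc _ _ _).symm

/-- A map of quantum graphs as a cell over `f^o ⊗ f`. -/
def IsGraphMap.envCell (h : IsGraphMap f φ) : Cell (envMap f) (envMap f) X.A Y.A where
  hom := φ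
  l_comm := by
    have ⟨c, e⟩ := isGraphMap_iff.1 h
    rw [← comul_l, ← comul_l, reassoc_of% c, Category.assoc, ← tensorHom_id, ← tensorHom_id,
      tensorHom_comp_tensorHom, tensorHom_comp_tensorHom, e, Category.comp_id, Category.id_comp]
  r_comm := by
    have ⟨c, e⟩ := isGraphMap_iff.1 h
    rw [← comul_r, ← comul_r, reassoc_of% c, Category.assoc, ← id_tensorHom, ← id_tensorHom,
      tensorHom_comp_tensorHom, tensorHom_comp_tensorHom, e, Category.comp_id, Category.id_comp]

end QuantumGraph
end GraphMaps

/-! ### Quantum functors -/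

section Functors

variable {V : Type u} [Category.{v} V] [MonoidalCategory V] [BraidedCategory V]
  [CoreflexiveTensor V]

open Bicomod

/-- The carrier of `j` is recovered from its right coaction through the factor `C^o`. -/
theorem Bicomod.one_r_counit_fst (C : Comon V) :
    ((one C).r ≫ ε[C.X] ▷ (env C).X ≫ (λ_ (env C).X).hom) ≫ (C.opp.fst C).hom = 𝟙 C.X := by
  dsimp only [one, coev, Comon.fst]
  calc
    _ = Δ[C.X] ≫ (Δ[C.X] ≫ (β_ C.X C.X).hom ≫ ε[C.X] ▷ C.X) ▷ C.X ⊗≫ C.X ◁ ε[C.X] ⊗≫ 𝟙 _ := by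
      monoidal
    _ = (Δ[C.X] ≫ C.X ◁ ε[C.X]) ⊗≫ 𝟙 _ := by
      rw [← BraidedCategory.braiding_naturality_right, ComonObj.comul_counit_assoc,
        rightUnitor_inv_braiding]
      monoidal
    _ = 𝟙 _ := by rw [ComonObj.comul_counit]; monoidal

namespace QuantumFunctor

variable {X Y : QuantumCategory V}

theorem σ_over (F : QuantumFunctor X Y) :
    IsOver (K := base F.f) (K' := base F.f) ε[(env X.C).X] ε[(env X.C).X] F.σ F.φ := by
  have i := dropRight_intoComp F.f X.A
  change _ = dropRight X.A (base F.f) ε[(env X.C).X] ≫ intoComp F.f X.A ≫ F.σ.hom ≫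
    dropLeft (base F.f) Y.A ε[(env X.C).X]
  rw [reassoc_of% i]

theorem φ_eq (F : QuantumFunctor X Y) {φ : X.A.X ⟶ Y.A.X}
    (h : IsOver (K := base F.f) (K' := base F.f) ε[(env X.C).X] ε[(env X.C).X] F.σ φ) :
    F.φ = φ :=
  dropRight_base_cancel F.f (F.σ_over.symm.trans h)

/-- A quantum functor is determined by its maps on objects and on arrows. -/
theorem ext_of_φ {F G : QuantumFunctor X Y} (hf : F.f = G.f) (hφ : F.φ = G.φ) : F = G := by
  have hF := F.σ_over
  have hG := G.σ_over
  rw [hφ] at hF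
  generalize G.φ = φ at hF hG
  cases F with | mk f σ h₁ h₂ h₃ =>
  cases G with | mk f' σ' h₁' h₂' h₃' =>
  cases hf
  have e : σ = σ' := eq_of_base_dropLeft f (hF.trans hG.symm)
  cases e
  rfl

end QuantumFunctor

namespace QuantumCategory

variable {X Y Z : QuantumCategory V} {f : X.C ⟶ Y.C} {φ : X.A.X ⟶ Y.A.X}

theorem isComonadMap_iff_isGraphMap {κ : comp X.A (base f) ⟶ comp (base f) Y.A}
    (h : IsOver (K := base f) (K' := base f) ε[(env X.C).X] ε[(env X.C).X] κ φ) :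
    IsComonadMap X.str Y.str (base f) κ ↔
      QuantumGraph.IsGraphMap (X := X.toQuantumGraph) (Y := Y.toQuantumGraph) f φ := by
  rw [isComonadMap_iff X.str Y.str h, QuantumGraph.isGraphMap_iff, QuantumGraph.comul,
    QuantumGraph.comul, Category.assoc]

/-- For a 2-cell over `φ`, compatibility with `μ₀` and `ω₀` says that `φ` preserves the identities. -/
theorem square₀_iff
    (g : QuantumGraph.IsGraphMap (X := X.toQuantumGraph) (Y := Y.toQuantumGraph) f φ)
    {κ : comp X.A (base f) ⟶ comp (base f) Y.A}
    (h : IsOver (K := base f) (K' := base f) ε[(env X.C).X] ε[(env X.C).X] κ φ) :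
    wr X.μ₀ (base f) ≫ (assoc (one X.C) X.A (base f)).hom ≫ wl (one X.C) κ ≫
        (assoc (one X.C) (base f) Y.A).inv ≫ wr (omega₀ f) Y.A = omega₀ f ≫ Y.μ₀ ↔
      X.ν₀ ≫ φ = f.hom ≫ Y.ν₀ := by
  have s := slide_over (G₁ := one X.C) h
  have o := omega₀_hom f
  have r := wrHom_dropRight X.μ₀ (base f) ε[(env X.C).X]
  have p : (Cell.coev f).pair g.envCell ≫ dropLeft (one Y.C) Y.A ε[Y.C.X] =
      dropLeft (one X.C) X.A ε[X.C.X] ≫ φ :=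
    (Cell.coev f).pair_dropLeft g.envCell ε[X.C.X] ε[Y.C.X] (IsComonHom.hom_counit f.hom)
  have hL : (wr X.μ₀ (base f) ≫ (assoc (one X.C) X.A (base f)).hom ≫ wl (one X.C) κ ≫
        (assoc (one X.C) (base f) Y.A).inv ≫ wr (omega₀ f) Y.A).hom =
      dropRight (one X.C) (base f) ε[(env X.C).X] ≫ X.μ₀.hom ≫ (Cell.coev f).pair g.envCell := by
    apply comp_ext
    have i := (Cell.coev f).pair_ι g.envCell
    simp only [comp_hom, wr_hom, wl_hom, assoc_hom_hom, assoc_inv_hom, Category.assoc]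
    rw [i, wrHom_ι, o, MonoidalCategory.comp_whiskerRight, reassoc_of% s, reassoc_of% r,
      MonoidalCategory.tensorHom_def']
    rfl
  have hR : (omega₀ f ≫ Y.μ₀).hom =
      dropRight (one X.C) (base f) ε[(env X.C).X] ≫ f.hom ≫ Y.μ₀.hom := by
    rw [comp_hom, o, Category.assoc]
  have z : ((one Y.C).r ≫ ε[Y.C.X] ▷ (env Y.C).X ≫ (λ_ (env Y.C).X).hom) ≫
      (Y.C.opp.fst Y.C).hom = 𝟙 Y.C.X :=
    one_r_counit_fst Y.C
  constructor
  · intro e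
    have e' := congrArg Hom.hom e
    rw [hL, hR] at e'
    have e'' := dropRight_base_cancel f e'
    have e3 := e'' =≫ dropLeft (one Y.C) Y.A ε[Y.C.X]
    rw [Category.assoc, Category.assoc, p] at e3
    rw [ν₀, ν₀, Category.assoc, e3]
  · intro e
    apply hom_ext
    rw [hL, hR]
    congr 1
    apply eq_of_dropLeft_right ε[Y.C.X] _ z
    rw [ν₀, ν₀, Category.assoc] at e
    rw [Category.assoc, Category.assoc, p, e]

/-- For a 2-cell over `φ`, compatibility with `μ₂` and `ω₂` says that `φ` preserves the composition.
-/
theorem square₂_iff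
    (g : QuantumGraph.IsGraphMap (X := X.toQuantumGraph) (Y := Y.toQuantumGraph) f φ)
    {κ : comp X.A (base f) ⟶ comp (base f) Y.A}
    (h : IsOver (K := base f) (K' := base f) ε[(env X.C).X] ε[(env X.C).X] κ φ) :
    (assoc (X.A.tensor X.A) (mul X.C) (base f)).hom ≫ wl (X.A.tensor X.A) (omega₂ f) ≫
        (assoc (X.A.tensor X.A) ((base f).tensor (base f)) (mul Y.C)).inv ≫
        wr ((inter X.A (base f) X.A (base f)).inv ≫ tensorMap κ κ ≫
          (inter (base f) Y.A (base f) Y.A).hom) (mul Y.C) ≫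
        (assoc ((base f).tensor (base f)) (Y.A.tensor Y.A) (mul Y.C)).hom ≫
        wl ((base f).tensor (base f)) Y.μ₂ =
      wr X.μ₂ (base f) ≫ (assoc (mul X.C) X.A (base f)).hom ≫ wl (mul X.C) κ ≫
        (assoc (mul X.C) (base f) Y.A).inv ≫ wr (omega₂ f) Y.A ≫
        (assoc ((base f).tensor (base f)) (mul Y.C) Y.A).hom ↔
      X.ν₂ ≫ φ = g.pair ≫ Y.ν₂ := by
  have o := omega₂_over f
  have hh : IsOver (K := (base f).tensor (base f)) (K' := (base f).tensor (base f))
      ε[((env X.C).tens (env X.C)).X] ε[((env X.C).tens (env X.C)).X]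
      ((inter X.A (base f) X.A (base f)).inv ≫ tensorMap κ κ ≫
        (inter (base f) Y.A (base f) Y.A).hom) (φ ⊗ₘ φ) := by
    have i := inter_over h h
    rw [counit_tens (env X.C) (env X.C)]
    exact i
  have p₁ := paste_over hh o
  have p₂ := paste_over o h
  have i₁ := (g.envCell.tensor g.envCell).pair_ι (mulCell f)
  have i₂ := (mulCell f).pair_ι g.envCell
  have l₁ := (g.envCell.tensor g.envCell).pair_l (mulCell f)
  have l₂ := (mulCell f).pair_l g.envCell
  have d := (mulCell f).pair_dropLeft g.envCell (mulCounit X.C) (mulCounit Y.C) (mulCell_counit f)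
  have n := pair_composable g.envCell g.cell rfl
  have c := composableInv_composable X.A
  have w := wlHom_dropLeft ((base f).tensor (base f)) Y.μ₂ ε[((env X.C).tens (env X.C)).X]
  have r := wrHom_dropRight X.μ₂ (base f) ε[(env X.C).X]
  generalize hκ : (inter X.A (base f) X.A (base f)).inv ≫ tensorMap κ κ ≫
        (inter (base f) Y.A (base f) Y.A).hom = κκ at *
  obtain ⟨W, hW⟩ : ∃ W, W = (g.envCell.tensor g.envCell).pair (mulCell f) := ⟨_, rfl⟩
  obtain ⟨W', hW'⟩ : ∃ W', W' = (mulCell f).pair g.envCell := ⟨_, rfl⟩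
  rw [← hW] at i₁ l₁ n
  rw [← hW'] at i₂ l₂ d
  have hL : ((assoc (X.A.tensor X.A) (mul X.C) (base f)).hom ≫ wl (X.A.tensor X.A) (omega₂ f) ≫
        (assoc (X.A.tensor X.A) ((base f).tensor (base f)) (mul Y.C)).inv ≫
        wr κκ (mul Y.C) ≫
        (assoc ((base f).tensor (base f)) (Y.A.tensor Y.A) (mul Y.C)).hom ≫
        wl ((base f).tensor (base f)) Y.μ₂).hom ≫
        dropLeft ((base f).tensor (base f)) (comp (mul Y.C) Y.A) ε[((env X.C).tens (env X.C)).X] =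
      dropRight (comp (X.A.tensor X.A) (mul X.C)) (base f) ε[(env X.C).X] ≫ W ≫ Y.μ₂.hom := by
    have p : assocHom (X.A.tensor X.A) (mul X.C) (base f) ≫ wlHom (X.A.tensor X.A) (omega₂ f) ≫
        assocInv (X.A.tensor X.A) ((base f).tensor (base f)) (mul Y.C) ≫
        wrHom κκ (mul Y.C) ≫
        assocHom ((base f).tensor (base f)) (Y.A.tensor Y.A) (mul Y.C) ≫
        dropLeft ((base f).tensor (base f)) (comp (Y.A.tensor Y.A) (mul Y.C))
          ε[((env X.C).tens (env X.C)).X] =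
        dropRight (comp (X.A.tensor X.A) (mul X.C)) (base f) ε[(env X.C).X] ≫ W := by
      apply comp_ext
      simp only [Category.assoc]
      exact p₁.trans (congrArg
        (dropRight (comp (X.A.tensor X.A) (mul X.C)) (base f) ε[(env X.C).X] ≫ ·) i₁.symm)
    simp only [comp_hom, wr_hom, wl_hom, assoc_hom_hom, assoc_inv_hom, Category.assoc]
    rw [w, reassoc_of% p]
  have hR : (wr X.μ₂ (base f) ≫ (assoc (mul X.C) X.A (base f)).hom ≫ wl (mul X.C) κ ≫
        (assoc (mul X.C) (base f) Y.A).inv ≫ wr (omega₂ f) Y.A ≫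
        (assoc ((base f).tensor (base f)) (mul Y.C) Y.A).hom).hom ≫
        dropLeft ((base f).tensor (base f)) (comp (mul Y.C) Y.A) ε[((env X.C).tens (env X.C)).X] =
      dropRight (comp (X.A.tensor X.A) (mul X.C)) (base f) ε[(env X.C).X] ≫ X.μ₂.hom ≫ W' := by
    apply comp_ext
    simp only [comp_hom, wr_hom, wl_hom, assoc_hom_hom, assoc_inv_hom, Category.assoc]
    rw [p₂, reassoc_of% r, i₂]
    rfl
  -- Maps into `A' ∘ p'` which respect the left coactions are determined by their image in `A'`.
  have key : W ≫ Y.μ₂.hom = X.μ₂.hom ≫ W' ↔ X.ν₂ ≫ φ = g.pair ≫ Y.ν₂ := by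
    have eL : composable X.A ≫ (W ≫ Y.μ₂.hom) ≫ dropLeft (mul Y.C) Y.A (mulCounit Y.C) =
        g.pair ≫ Y.ν₂ := by
      rw [ν₂, Category.assoc, ← reassoc_of% n]
      rfl
    have eR : composable X.A ≫ (X.μ₂.hom ≫ W') ≫ dropLeft (mul Y.C) Y.A (mulCounit Y.C) =
        X.ν₂ ≫ φ := by
      rw [ν₂, Category.assoc, d]
      simp only [Category.assoc]
      rfl
    constructor
    · intro e
      rw [← eL, ← eR, e]
    · intro e
      rw [← eL, ← eR] at e
      have e' := composableInv X.A ≫= e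
      rw [reassoc_of% c, reassoc_of% c] at e'
      refine eq_of_dropLeft ((comp (X.A.tensor X.A) (mul X.C)).l ≫
        (Comon.tensMap (envMap f) (envMap f)).hom ▷ _) ?_ ?_ (mulCounit Y.C) (midFst Y.C)
        (mul_retract Y.C) e'.symm
      · have m := Y.μ₂.l_comm
        rw [Category.assoc, m, reassoc_of% l₁, MonoidalCategory.tensorHom_def]
        simp only [Category.assoc, MonoidalCategory.whiskerLeft_comp]
      · have m := X.μ₂.l_comm
        rw [Category.assoc, l₂, reassoc_of% m, MonoidalCategory.tensorHom_def,
          whisker_exchange_assoc]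
        simp only [Category.assoc, MonoidalCategory.whiskerLeft_comp]
  rw [← key]
  constructor
  · intro e
    have e' := congrArg (fun t => Hom.hom t ≫ dropLeft ((base f).tensor (base f))
      (comp (mul Y.C) Y.A) ε[((env X.C).tens (env X.C)).X]) e
    exact dropRight_base_cancel f (hL.symm.trans (e'.trans hR))
  · intro e
    apply hom_ext
    refine eq_of_dropLeft _ (Hom.l_comm _) (Hom.l_comm _) ε[((env X.C).tens (env X.C)).X] (𝟙 _)
      ?_ ?_
    · rw [base_tensor_base_l_counit]; exact Category.comp_id _
    · rw [hL, hR, e]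

theorem IsFunctorPair.id (X : QuantumCategory V) :
    IsFunctorPair (X := X) (Y := X) (𝟙 X.C) (𝟙 X.A.X) := by
  have g : QuantumGraph.IsGraphMap (X := X.toQuantumGraph) (Y := X.toQuantumGraph)
      (𝟙 X.C) (𝟙 X.A.X) :=
    ⟨by simp, by simp, by simp, by simp⟩
  have p : g.pair = 𝟙 _ := by
    apply comp_ext
    have i := g.cell.pair_ι g.cell
    refine i.trans ?_
    change _ ≫ (𝟙 X.A.X ⊗ₘ 𝟙 X.A.X) = _
    simp
  refine ⟨g, ?_, ?_⟩
  · rw [p, Category.comp_id, Category.id_comp]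
  · rw [Category.comp_id, Comon.id_hom', Category.id_comp]

theorem IsFunctorPair.comp {f' : Y.C ⟶ Z.C} {φ' : Y.A.X ⟶ Z.A.X}
    (h : IsFunctorPair (X := X) (Y := Y) f φ) (h' : IsFunctorPair (X := Y) (Y := Z) f' φ') :
    IsFunctorPair (X := X) (Y := Z) (f ≫ f') (φ ≫ φ') := by
  have g : QuantumGraph.IsGraphMap (X := X.toQuantumGraph) (Y := Z.toQuantumGraph)
      (f ≫ f') (φ ≫ φ') := by
    have a := h.graph
    have a' := h'.graph
    have c := a.comul
    have s := a.src
    have t := a.tgt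
    refine ⟨?_, ?_, ?_, ?_⟩
    · rw [Category.assoc, a'.comul, reassoc_of% c, tensorHom_comp_tensorHom]
    · rw [Category.assoc, a'.counit, a.counit]
    · rw [Category.assoc, a'.src, reassoc_of% s, Comon.comp_hom']
    · rw [Category.assoc, a'.tgt, reassoc_of% t, Comon.comp_hom']
  have p : g.pair = h.graph.pair ≫ h'.graph.pair := by
    apply comp_ext
    have i : g.pair ≫ ι Z.arrows Z.arrows = ι X.arrows X.arrows ≫ (φ ≫ φ' ⊗ₘ φ ≫ φ') :=
      g.cell.pair_ι g.cell
    have i₁ : h.graph.pair ≫ ι Y.arrows Y.arrows = ι X.arrows X.arrows ≫ (φ ⊗ₘ φ) :=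
      h.graph.cell.pair_ι h.graph.cell
    have i₂ : h'.graph.pair ≫ ι Z.arrows Z.arrows = ι Y.arrows Y.arrows ≫ (φ' ⊗ₘ φ') :=
      h'.graph.cell.pair_ι h'.graph.cell
    rw [i, Category.assoc, i₂, reassoc_of% i₁, tensorHom_comp_tensorHom]
  have n := h.ν₂
  have n₀ := h.ν₀
  refine ⟨g, ?_, ?_⟩
  · rw [reassoc_of% n, h'.ν₂, p, Category.assoc]
  · rw [reassoc_of% n₀, h'.ν₀, Comon.comp_hom', Category.assoc]

end QuantumCategory

namespace QuantumFunctor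

variable {X Y : QuantumCategory V}

open QuantumCategory

theorem isFunctorPair (F : QuantumFunctor X Y) :
    IsFunctorPair (X := X) (Y := Y) F.f F.φ := by
  have g := (isComonadMap_iff_isGraphMap F.σ_over).1 F.comonadMap
  exact ⟨g, (square₂_iff g F.σ_over).1 F.square₂, (square₀_iff g F.σ_over).1 F.square₀⟩

/-- The quantum functor determined by compatible maps on objects and on arrows. -/
noncomputable def ofPair {f : X.C ⟶ Y.C} {φ : X.A.X ⟶ Y.A.X}
    (h : IsFunctorPair (X := X) (Y := Y) f φ) : QuantumFunctor X Y where
  f := f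
  σ := h.graph.envCell.baseMate
  comonadMap := (isComonadMap_iff_isGraphMap h.graph.envCell.baseMate_over).2 h.graph
  square₂ := (square₂_iff h.graph h.graph.envCell.baseMate_over).2 h.ν₂
  square₀ := (square₀_iff h.graph h.graph.envCell.baseMate_over).2 h.ν₀

theorem ofPair_φ {f : X.C ⟶ Y.C} {φ : X.A.X ⟶ Y.A.X}
    (h : IsFunctorPair (X := X) (Y := Y) f φ) : (ofPair h).φ = φ :=
  (ofPair h).φ_eq h.graph.envCell.baseMate_over

variable (X Y) in
/-- Quantum functors are the same as pairs of compatible maps on objects and on arrows. -/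
noncomputable def pairEquiv :
    { p : (X.C ⟶ Y.C) × (X.A.X ⟶ Y.A.X) // IsFunctorPair (X := X) (Y := Y) p.1 p.2 } ≃
      QuantumFunctor X Y where
  toFun p := ofPair p.2
  invFun F := ⟨(F.f, F.φ), F.isFunctorPair⟩
  left_inv p := Subtype.ext (Prod.ext rfl (ofPair_φ p.2))
  right_inv F := ext_of_φ rfl (ofPair_φ F.isFunctorPair)

end QuantumFunctor

/-- The category of quantum categories and quantum functors, the latter encoded by their maps on
objects and on arrows. -/
@[reducible] def QuantumCategory.category : Category.{v} (QuantumCategory V) where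
  Hom X Y := { p : (X.C ⟶ Y.C) × (X.A.X ⟶ Y.A.X) //
    QuantumCategory.IsFunctorPair (X := X) (Y := Y) p.1 p.2 }
  id X := ⟨(𝟙 X.C, 𝟙 X.A.X), .id X⟩
  comp F G := ⟨(F.1.1 ≫ G.1.1, F.1.2 ≫ G.1.2), F.2.comp G.2⟩
  id_comp _ := Subtype.ext (Prod.ext (Category.id_comp _) (Category.id_comp _))
  comp_id _ := Subtype.ext (Prod.ext (Category.comp_id _) (Category.comp_id _))
  assoc _ _ _ := Subtype.ext (Prod.ext (Category.assoc _ _ _) (Category.assoc _ _ _))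

end Functors

theorem theorem15 {V : Type u} [Category.{v} V] [MonoidalCategory V] [BraidedCategory V]
    [CoreflexiveTensor V] :
    (∀ (X Y : QuantumCategory V) (F : QuantumFunctor X Y),
      QuantumCategory.IsFunctorPair (X := X) (Y := Y) F.f F.φ) ∧
    (∀ (X Y : QuantumCategory V) (f : X.C ⟶ Y.C) (φ : X.A.X ⟶ Y.A.X),
      QuantumCategory.IsFunctorPair (X := X) (Y := Y) f φ →
        ∃! F : QuantumFunctor X Y, F.f = f ∧ F.φ = φ) ∧
    ∃ cat : Category.{v} (QuantumCategory V),
      ∃ e : ∀ X Y : QuantumCategory V, (X ⟶ Y) ≃ QuantumFunctor X Y,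
        (∀ X : QuantumCategory V, (e X X (𝟙 X)).f = 𝟙 X.C ∧ (e X X (𝟙 X)).φ = 𝟙 X.A.X) ∧
        ∀ (X Y Z : QuantumCategory V) (F : X ⟶ Y) (G : Y ⟶ Z),
          (e X Z (F ≫ G)).f = (e X Y F).f ≫ (e Y Z G).f ∧
            (e X Z (F ≫ G)).φ = (e X Y F).φ ≫ (e Y Z G).φ := by
  refine ⟨fun _ _ F => F.isFunctorPair, fun X Y f φ h => ?_, QuantumCategory.category,
    QuantumFunctor.pairEquiv, fun X => ⟨rfl, ?_⟩, fun X Y Z F G => ⟨rfl, ?_⟩⟩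
  · exact ⟨.ofPair h, ⟨rfl, QuantumFunctor.ofPair_φ h⟩, fun F hF =>
      QuantumFunctor.ext_of_φ hF.1 (hF.2.trans (QuantumFunctor.ofPair_φ h).symm)⟩
  · exact QuantumFunctor.ofPair_φ (.id X)
  · exact (QuantumFunctor.ofPair_φ (F.2.comp G.2)).trans
      (congrArg₂ (· ≫ ·) (QuantumFunctor.ofPair_φ F.2) (QuantumFunctor.ofPair_φ G.2)).symm
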